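/- Let $(\varepsilon_t)_{t\in\mathbb Z}$ be i.i.d. real random variables, distributed as $\varepsilon$, on a probability space $(\Omega,\mathcal A,\mathbf P)$. Put $\nu:=\sup\{p>1 : \mathbf E|\varepsilon|^p<\infty\}$ and $\alpha:=\min\{2,\nu\}$. Assume: 1. (Long memory) $\nu>1$, and $(a_j)_{j\ge 0}$ are real numbers such that $n^{1-d}a_n$ converges to a finite nonzero limit for some $d\in(0,1-1/\alpha)$. 2. (Regularity of $G_n$) $(G_n)_{n\ge1}$ are measurable functions $\mathbb R\to\mathbb R$ with $|G_n(x)|\le C_G(1+|x|)^{\gamma_G}\mathbf 1\{x>u_n\}$ for all $n\ge1$ and $x\in\mathbb R$, for some constant $C_G$, some $\gamma_G\ge0$ and a deterministic real sequence $u_n\to\infty$. 3. (Regularity of the innovations) The distribution function $F_\varepsilon$ is $C^2$, $\varepsilon$ has a symmetric distribution, and one of the following holds, with $f_\varepsilon=F_\varepsilon'$: (i) $\alpha=2$, $\mathbf E[\varepsilon^2]<\infty$, and for some $\delta>0$ the function $s\mapsto(1+|s|)^\delta\,\mathbf E[e^{is\varepsilon}]$ is bounded on $\mathbb R$; (ii)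 $\alpha\in(1,2)$, there is $A\in(0,\infty)$ with $\lim_{x\to\infty}x^\alpha\mathbf P[\varepsilon>x]=\lim_{x\to\infty}x^\alpha\mathbf P[\varepsilon<-x]=A/2$, and there is $C_\varepsilon>0$ such that $|f_\varepsilon'(x)|\le C_\varepsilon(1+|x|)^{-\alpha}$ for all $x$, and $|f_\varepsilon'(x)-f_\varepsilon'(y)|\le C_\varepsilon|x-y|(1+|x|)^{-\alpha}$ for all $x,y$ with $|x-y|<1$. Then the series $X_t=\sum_{j=0}^\infty a_j\varepsilon_{t-j}$ converges almost surely for each $t\in\mathbb Z$, and the following hold. (a) If $\gamma_G<\alpha-1$, then for every $n\ge1$ the random variable $G_n(X_0+x)$ is integrable for every $x\in\mathbb R$, and $x\mapsto\mathbf E[G_n(X_0+x)]$ is differentiable at $0$; that is, $$G_{\infty,n}'(0):=\frac{\mathrm d}{\mathrm dx}\mathbf E[G_n(X_0+x)]\Big|_{x=0}$$ is well-defined. (b) If $\gamma,r\in\mathbb R$ satisfy $$\gamma_G<\gamma<\min\Big\{\frac d{1-d},\ 1-\frac1{r(1-d)},\ \frac\alpha r-1\Big\}\qquad\text{and}\qquad\frac1{1-d}<r<\alpha$$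 (so that, in particular, $\gamma_G<\alpha-1$), then there is a constant $C>0$, independent of $n$, such that for all $n\ge1$ with $u_n>0$ (hence for all sufficiently large $n$) $$\Big\|\sum_{t=1}^n\big(G_n(X_t)-\mathbf E[G_n(X_0)]\big)-G_{\infty,n}'(0)\sum_{t=1}^nX_t\Big\|_{L^r(\mathbf P)}\le C\,B_n\qquad\text{and}\qquad B_n\le C\,n^{1+1/r-(1-d)(1+\gamma)},$$ where $$B_n:=u_n^{\gamma_G-\gamma}\,n^{1+1/r-(1-d)(1+\gamma)}+n^{1/r}\max\big\{\|G_n(X_0)\|_{L^r(\mathbf P)},\,|G_{\infty,n}'(0)|\big\}.$$ -/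

import Mathlib

open MeasureTheory ProbabilityTheory Filter Topology
open scoped ENNReal

noncomputable section

/-- The moment index `ν = sup {p > 1 | ‖ε‖_p < ∞}` (possibly `∞`) of a random variable with
law `μ`; the supremum of the empty set is `0`. -/
def momentIndex (μ : Measure ℝ) : ℝ≥0∞ :=
  sSup {p : ℝ≥0∞ | 1 < p ∧ p ≠ ∞ ∧ MemLp (fun x : ℝ => x) p μ}

/-- `α = min (2, ν)`, a real number. -/
def tailExponent (μ : Measure ℝ) : ℝ := (min 2 (momentIndex μ)).toReal

/-- The linear time series `X_t = ∑_{j ≥ 0} a_j ε_{t-j}`, the limit of its partial sums in the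
order of `j` (under long memory the series converges almost surely, but not absolutely, so that
`tsum` would not do). -/
def linearProcess {Ω : Type*} (a : ℕ → ℝ) (ε : ℤ → Ω → ℝ) (t : ℤ) (ω : Ω) : ℝ :=
  limUnder atTop (fun N : ℕ => ∑ j ∈ Finset.range N, a j * ε (t - (j : ℤ)) ω)

/-- Long memory: `ν > 1`, `d ∈ (0, 1 - 1/α)`, and `n^{1-d} a_n` converges to a nonzero limit.
Here `μ` is the law of the innovations. -/
structure LongMemory (μ : Measure ℝ) (a : ℕ → ℝ) (d : ℝ) : Prop where
  one_lt_momentIndex : 1 < momentIndex μ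
  d_pos : 0 < d
  d_lt : d < 1 - 1 / tailExponent μ
  coeff : ∃ c : ℝ, c ≠ 0 ∧ Tendsto (fun n : ℕ => (n : ℝ) ^ (1 - d) * a n) atTop (𝓝 c)

/-- The (measurable) functions `G_n`, `n ≥ 1`, satisfy
`|G_n(x)| ≤ C (1 + |x|)^{γ_G} 1{x > u_n}` with `C` independent of `n` and `x`, where `γ_G ≥ 0`
and `u_n → ∞`. -/
structure ThresholdGrowth (G : ℕ → ℝ → ℝ) (u : ℕ → ℝ) (γG : ℝ) : Prop where
  measurable : ∀ n : ℕ, 1 ≤ n → Measurable (G n)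
  nonneg : 0 ≤ γG
  tendsto : Tendsto u atTop atTop
  bound : ∃ C : ℝ, ∀ n : ℕ, 1 ≤ n → ∀ x : ℝ,
    |G n x| ≤ C * ((1 + |x|) ^ γG * (Set.Ioi (u n)).indicator (fun _ => (1 : ℝ)) x)

/-- The density of a law `μ` with continuously differentiable distribution function. -/
def lawDensity (μ : Measure ℝ) : ℝ → ℝ := deriv (fun x => cdf μ x)

/-- Finite variance regime: `α = 2`, `E[ε²] < ∞` and, for some `δ > 0`, the function
`(1 + |s|)^δ E[exp(i s ε)]` is bounded. -/
def FiniteVarianceRegime (μ : Measure ℝ) : Prop :=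
  tailExponent μ = 2 ∧ MemLp (fun x : ℝ => x) 2 μ ∧
    ∃ δ : ℝ, 0 < δ ∧ ∃ C : ℝ, ∀ s : ℝ, (1 + |s|) ^ δ * ‖charFun μ s‖ ≤ C

/-- Heavy tailed regime: `α ∈ (1,2)`, both tails are asymptotic to `(A/2) x^{-α}`, and the
derivative of the density satisfies the two stated bounds. -/
def HeavyTailRegime (μ : Measure ℝ) : Prop :=
  1 < tailExponent μ ∧ tailExponent μ < 2 ∧
    (∃ A : ℝ, 0 < A ∧
      Tendsto (fun x : ℝ => x ^ tailExponent μ * μ.real (Set.Ioi x)) atTop (𝓝 (A / 2)) ∧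
      Tendsto (fun x : ℝ => x ^ tailExponent μ * μ.real (Set.Iio (-x))) atTop (𝓝 (A / 2))) ∧
    ∃ C : ℝ, 0 < C ∧
      (∀ x : ℝ, |deriv (lawDensity μ) x| ≤ C * (1 + |x|) ^ (-tailExponent μ)) ∧
      (∀ x y : ℝ, |x - y| < 1 →
        |deriv (lawDensity μ) x - deriv (lawDensity μ) y|
          ≤ C * (|x - y| * (1 + |x|) ^ (-tailExponent μ)))

/-- Regular innovations with law `μ`: the distribution function is `C²`, the law is symmetric,
and one of the two regimes holds. -/
structure RegularInnovations (μ : Measure ℝ) : Prop where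
  cdf_contDiff : ContDiff ℝ 2 (fun x => cdf μ x)
  symmetric : μ.map (fun x => -x) = μ
  regime : FiniteVarianceRegime μ ∨ HeavyTailRegime μ

/-- `G'_{∞,n}(0) = d/dx E[g(X + x)]` at `x = 0`, for `g = G_n` and `X = X_0`. -/
def meanShiftDeriv {Ω : Type*} [MeasurableSpace Ω] (P : Measure Ω) (g : ℝ → ℝ) (X : Ω → ℝ) : ℝ :=
  deriv (fun x : ℝ => ∫ ω, g (X ω + x) ∂P) 0

end

set_option linter.unusedSectionVars false

/-! Put κ = 1 - d and V_{t,j} = ∑_{i ≥ j} a_i ε_{t-i}, and let G_j be the average of G over the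
first j terms of the moving average (`blockAvg`), so that G_j(V_{t,j}) is the conditional
expectation of G(X_t) given the innovations up to time t - j. With D the derivative at 0 of x ↦
E[G(X_0 + x)], the variable G(X_t) - E[G(X_0)] - D X_t telescopes (`ae_eq_sum_increment`) into the
increments G_j(a_j ε_{t-j} + V_{t,j+1}) - G_{j+1}(V_{t,j+1}) - D a_j ε_{t-j}, plus a remainder which
tends to 0 in L^r as the number of lags grows.

Smoothing. G is only measurable, but G_j is differentiable with a locally Lipschitz derivative once
j ≥ J, with constants uniform in j (`exists_smoothGrowth_blockAvg`). For heavy tails one innovation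
suffices, since the derivative of its density decays like |x|^{-α} and γ < α - 1. With finite
variance, the characteristic function of a long enough block decays fast enough for Fourier
inversion to give a C² density, decaying like |x|^{-2} together with its first two derivatives.
Smoothness of G_J already proves (a), and it gives D = E[G_j'(V_{0,j})] for all j ≥ J.

Size of one increment. For j ≥ J the increment is a centred Taylor remainder, of order |a_j|^{1+γ},
plus (G_j'(V_{t,j+1}) - E[G_j'(V_{0,j})]) a_j ε_{t-j}, whose first factor has the order of the tails
V, namely j^{1/p - κ} with p = r(1 + γ). The conditions on γ make both parts O(j^{-κ(1+γ)}) in L^r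
(`exists_eLpNorm_increment_le`). The increments with j < J are bounded crudely by a multiple of
max(‖G(X_0)‖_r, |D|).

Summation. The increments of all X_t, t ≤ n, are grouped by the time of their innovation. Distinct
groups are martingale differences, so a von Bahr–Esseen inequality (`integral_abs_sum_rpow_le`)
bounds the r-th moment of their sum by the sum of their r-th moments; inside a group the triangle
inequality is used. The resulting double sum (`exists_window_bound`) gives n^{1 + 1/r - κ(1+γ)} from
the late increments and n^{1/r} from the first J ones.

Dependence on the threshold. Since G_n vanishes below u_n, it is bounded by a multiple of u_n^{γ_G -
γ} (1 + |x|)^γ (`exists_growth_rpow`). All estimates are linear in this growth constant, and this is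
the only way in which u_n enters. -/

/-! ### Power inequalities with exponent between 1 and 2. -/

/-- The odd extension of `x ↦ x ^ s`. -/
noncomputable def signedPow (s x : ℝ) : ℝ := if 0 ≤ x then x ^ s else -(-x) ^ s

lemma measurable_signedPow (s : ℝ) : Measurable (signedPow s) := by
  unfold signedPow
  exact Measurable.ite measurableSet_Ici (by fun_prop) (by fun_prop)

lemma abs_signedPow (s x : ℝ) : |signedPow s x| = |x| ^ s := by
  unfold signedPow
  split_ifs with h
  · rw [abs_of_nonneg (Real.rpow_nonneg h _), abs_of_nonneg h]
  · push Not at h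
    rw [abs_neg, abs_of_nonneg (Real.rpow_nonneg (by linarith) _), abs_of_neg h]

lemma abs_rpow_sub_rpow_le {s x y : ℝ} (hs0 : 0 ≤ s) (hs1 : s ≤ 1) (hx : 0 ≤ x) (hy : 0 ≤ y) :
    |x ^ s - y ^ s| ≤ |x - y| ^ s := by
  wlog h : y ≤ x generalizing x y
  · rw [abs_sub_comm, abs_sub_comm x y]
    exact this hy hx (le_of_not_ge h)
  have h1 := Real.rpow_add_le_add_rpow (sub_nonneg.2 h) hy hs0 hs1
  rw [sub_add_cancel] at h1
  rw [abs_of_nonneg (sub_nonneg.2 (Real.rpow_le_rpow hy h hs0)), abs_of_nonneg (sub_nonneg.2 h)]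
  linarith

/-- For equal signs this is the subadditivity of u^s. The factor 2 pays for opposite signs, where
the difference is u^s + v^s with u + v = |x - y|. -/
lemma abs_signedPow_sub_le {s : ℝ} (hs0 : 0 ≤ s) (hs1 : s ≤ 1) (x y : ℝ) :
    |signedPow s x - signedPow s y| ≤ 2 * |x - y| ^ s := by
  have key : ∀ u v : ℝ, 0 ≤ u → 0 ≤ v → u ^ s + v ^ s ≤ 2 * (u + v) ^ s := by
    intro u v hu hv
    have h1 := Real.rpow_le_rpow hu (by linarith : u ≤ u + v) hs0
    have h2 := Real.rpow_le_rpow hv (by linarith : v ≤ u + v) hs0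
    linarith
  have hnn : 0 ≤ |x - y| ^ s := Real.rpow_nonneg (abs_nonneg _) _
  unfold signedPow
  split_ifs with h1 h2 h2
  · have := abs_rpow_sub_rpow_le hs0 hs1 h1 h2
    linarith
  · push Not at h2
    have := key x (-y) h1 (by linarith)
    have e : |x - y| = x + -y := by rw [abs_of_nonneg (by linarith)]; ring
    have h3 := Real.rpow_nonneg h1 s
    have h4 := Real.rpow_nonneg (show 0 ≤ -y by linarith) s
    rw [e, abs_of_nonneg (by linarith)]
    linarith
  · push Not at h1
    have := key (-x) y (by linarith) h2
    have e : |x - y| = -x + y := by rw [abs_of_nonpos (by linarith)]; ring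
    have h3 := Real.rpow_nonneg h2 s
    have h4 := Real.rpow_nonneg (show 0 ≤ -x by linarith) s
    rw [e, abs_of_nonpos (by linarith)]
    linarith
  · push Not at h1 h2
    have := abs_rpow_sub_rpow_le hs0 hs1 (show 0 ≤ -y by linarith) (show 0 ≤ -x by linarith)
    have e : -y - -x = x - y := by ring
    have e' : -(-x) ^ s - -(-y) ^ s = (-y) ^ s - (-x) ^ s := by ring
    rw [e] at this
    rw [e']
    linarith

lemma signedPow_mul_self {r : ℝ} (hr : 1 < r) (x : ℝ) : signedPow (r - 1) x * x = |x| ^ r := by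
  have key : ∀ u : ℝ, 0 ≤ u → u ^ (r - 1) * u = u ^ r := by
    intro u hu
    rcases hu.eq_or_lt with rfl | hu
    · simp [Real.zero_rpow (by linarith : r ≠ 0)]
    · rw [Real.rpow_sub_one hu.ne']; field_simp
  unfold signedPow
  split_ifs with h
  · rw [abs_of_nonneg h, key x h]
  · push Not at h
    rw [abs_of_neg h, ← key (-x) (by linarith)]; ring

/-- The gradient inequality for the convex function `|x| ^ r`. -/
lemma rpow_gradient_le {r : ℝ} (hr : 1 < r) (x y : ℝ) :
    |y| ^ r + r * signedPow (r - 1) y * (x - y) ≤ |x| ^ r := by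
  -- The gradient inequality is Young's inequality for |x| and |y|^(r-1), with exponents r and
  -- r/(r-1).
  have hconj : (r).HolderConjugate (r / (r - 1)) := Real.HolderConjugate.conjExponent hr
  have h1 := Real.young_inequality_of_nonneg (abs_nonneg x)
    (Real.rpow_nonneg (abs_nonneg y) (r - 1)) hconj
  rw [← Real.rpow_mul (abs_nonneg y)] at h1
  have e : (r - 1) * (r / (r - 1)) = r := by field_simp [(by linarith : r - 1 ≠ 0)]
  rw [e] at h1
  have h2 : signedPow (r - 1) y * x ≤ |x| * |y| ^ (r - 1) := by
    calc signedPow (r - 1) y * x ≤ |signedPow (r - 1) y * x| := le_abs_self _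
      _ = _ := by rw [abs_mul, abs_signedPow, mul_comm]
  have h3 := signedPow_mul_self hr y
  have hr0 : 0 < r := by linarith
  have h4 : r * (|x| * |y| ^ (r - 1)) ≤ |x| ^ r + (r - 1) * |y| ^ r := by
    have := mul_le_mul_of_nonneg_left h1 hr0.le
    have e2 : r * (|x| ^ r / r + |y| ^ r / (r / (r - 1))) = |x| ^ r + (r - 1) * |y| ^ r := by
      have : r - 1 ≠ 0 := by linarith
      field_simp
    linarith
  have h5 : r * (signedPow (r - 1) y * x) ≤ r * (|x| * |y| ^ (r - 1)) :=
    mul_le_mul_of_nonneg_left h2 hr0.le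
  have e3 : r * signedPow (r - 1) y * (x - y) =
    r * (signedPow (r - 1) y * x) - r * (signedPow (r - 1) y * y) := by ring
  rw [e3, h3]
  linarith

/-- The gradient inequality at x + y has the gradient at the wrong point; moving it to x costs 2
|y|^(r-1) |y| by Hölder continuity of order r - 1 ≤ 1. The middle term is linear in y, so it
integrates to zero when y is a martingale increment and x is the past. -/
lemma abs_add_rpow_le {r : ℝ} (hr : 1 < r) (hr2 : r ≤ 2) (x y : ℝ) :
    |x + y| ^ r ≤ |x| ^ r + r * (signedPow (r - 1) x * y) + 2 * r * |y| ^ r := by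
  have h1 := rpow_gradient_le hr x (x + y)
  have h2 : (signedPow (r - 1) (x + y) - signedPow (r - 1) x) * y ≤ 2 * |y| ^ r := by
    calc (signedPow (r - 1) (x + y) - signedPow (r - 1) x) * y
        ≤ |(signedPow (r - 1) (x + y) - signedPow (r - 1) x) * y| := le_abs_self _
      _ ≤ 2 * |x + y - x| ^ (r - 1) * |y| := by
        rw [abs_mul]
        exact mul_le_mul_of_nonneg_right
          (abs_signedPow_sub_le (by linarith) (by linarith) _ _) (abs_nonneg _)
      _ = 2 * |y| ^ r := by
        have := signedPow_mul_self hr |y|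
        rw [signedPow, if_pos (abs_nonneg y), abs_abs] at this
        rw [add_sub_cancel_left, mul_assoc, this]
  have hr0 : 0 < r := by linarith
  have h3 := mul_le_mul_of_nonneg_left h2 hr0.le
  nlinarith

lemma abs_rpow_sub_one_mul_le {r : ℝ} (hr : 1 < r) {x y : ℝ} (hx : 0 ≤ x) (hy : 0 ≤ y) :
    x ^ (r - 1) * y ≤ x ^ r + y ^ r := by
  have key : ∀ u : ℝ, 0 ≤ u → u ^ (r - 1) * u = u ^ r := by
    intro u hu
    have := signedPow_mul_self hr u
    rwa [signedPow, if_pos hu, abs_of_nonneg hu] at this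
  rcases le_total x y with h | h
  · have := mul_le_mul_of_nonneg_right (Real.rpow_le_rpow hx h (by linarith : 0 ≤ r - 1)) hy
    rw [key y hy] at this
    have := Real.rpow_nonneg hx r
    linarith
  · have := mul_le_mul_of_nonneg_left h (Real.rpow_nonneg hx (r - 1))
    rw [key x hx] at this
    have := Real.rpow_nonneg hy r
    linarith

/-! ### Power sums over windows of times. -/

/-- Comparison with the integral of t^(-b), by induction; the inductive step is Bernoulli's
inequality for (1 - 1/(n+1))^(1-b). -/
lemma sum_rpow_neg_le {b : ℝ} (hb0 : 0 ≤ b) (hb1 : b < 1) (n : ℕ) :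
    ∑ i ∈ Finset.range n, ((i : ℝ) + 1) ^ (-b) ≤ (n : ℝ) ^ (1 - b) / (1 - b) := by
  have h1b : 0 < 1 - b := by linarith
  induction n with
  | zero => simp [Real.zero_rpow h1b.ne']
  | succ n ih =>
    rw [Finset.sum_range_succ]
    have hx : (0 : ℝ) < (n : ℝ) + 1 := by positivity
    have hB := rpow_one_add_le_one_add_mul_self (s := -1 / ((n : ℝ) + 1)) (p := 1 - b)
      (by rw [le_div_iff₀ hx]; linarith [(Nat.cast_nonneg n : (0 : ℝ) ≤ n)]) h1b.le (by linarith)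
    have e : 1 + -1 / ((n : ℝ) + 1) = n / ((n : ℝ) + 1) := by field_simp; ring
    rw [e, Real.div_rpow (Nat.cast_nonneg n) hx.le] at hB
    have hp : 0 < ((n : ℝ) + 1) ^ (1 - b) := Real.rpow_pos_of_pos hx _
    rw [div_le_iff₀ hp] at hB
    have e2 : ((n : ℝ) + 1) ^ (-b) = ((n : ℝ) + 1) ^ (1 - b) / ((n : ℝ) + 1) := by
      rw [← Real.rpow_sub_one hx.ne']; congr 1; ring
    have e3 : (1 + (1 - b) * (-1 / ((n : ℝ) + 1))) * ((n : ℝ) + 1) ^ (1 - b) =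
      ((n : ℝ) + 1) ^ (1 - b) - (1 - b) * ((n : ℝ) + 1) ^ (-b) := by rw [e2]; field_simp; ring
    rw [e3] at hB
    push_cast
    rw [le_div_iff₀ h1b] at ih ⊢
    linarith

lemma sub_one_mul_rpow_neg_le {s x : ℝ} (hs : 1 ≤ s) (hx : 0 < x) :
    (s - 1) * (x + 1) ^ (-s) ≤ x ^ (1 - s) - (x + 1) ^ (1 - s) := by
  have hB := one_add_mul_self_le_rpow_one_add (s := 1 / x)
    (by have : 0 < 1 / x := by positivity
        linarith) hs
  have e : 1 + 1 / x = (x + 1) / x := by field_simp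
  have hx1 : 0 < x + 1 := by linarith
  rw [e, Real.div_rpow hx1.le hx.le, le_div_iff₀ (Real.rpow_pos_of_pos hx _)] at hB
  have h1 : (x + 1) ^ (1 - s) = (x + 1) * (x + 1) ^ (-s) := by
    rw [sub_eq_add_neg, Real.rpow_add hx1, Real.rpow_one]
  have h2 : x ^ (1 - s) = x * x ^ (-s) := by
    rw [sub_eq_add_neg, Real.rpow_add hx, Real.rpow_one]
  rw [h1, h2, Real.rpow_neg hx1.le, Real.rpow_neg hx.le]
  have p1 := Real.rpow_pos_of_pos hx s
  have p2 := Real.rpow_pos_of_pos hx1 s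
  have h3 : (x + s) * x ^ s ≤ x * (x + 1) ^ s := by
    have : (1 + s * (1 / x)) * x ^ s * x = (x + s) * x ^ s := by field_simp
    nlinarith
  have h4 : (x + s) * ((x + 1) ^ s)⁻¹ ≤ x * (x ^ s)⁻¹ := by
    rw [← div_eq_mul_inv, ← div_eq_mul_inv, div_le_div_iff₀ p2 p1]
    exact h3
  linarith

/-- Telescoping bounds all terms but the first by (m+1)^(1-s) / (s-1). The term i = 0 is estimated
separately by (m+1)^(1-s), because m may be 0; hence the factor s/(s-1) = 1/(s-1) + 1. -/
lemma sum_rpow_neg_tail_le {s : ℝ} (hs : 1 < s) (m k : ℕ) :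
    ∑ i ∈ Finset.range k, (((m + i : ℕ) : ℝ) + 1) ^ (-s) ≤
      s / (s - 1) * ((m : ℝ) + 1) ^ (1 - s) := by
  have hs0 : 0 < s - 1 := by linarith
  have key : ∀ k : ℕ, ∑ i ∈ Finset.range k, ((m : ℝ) + 1 + i + 1) ^ (-s) ≤
      (((m : ℝ) + 1) ^ (1 - s) - ((m : ℝ) + 1 + k) ^ (1 - s)) / (s - 1) := by
    intro k
    induction k with
    | zero => simp
    | succ k ih =>
      rw [Finset.sum_range_succ]
      have := sub_one_mul_rpow_neg_le hs.le (x := (m : ℝ) + 1 + k) (by positivity)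
      rw [le_div_iff₀ hs0] at ih ⊢
      push_cast
      rw [show (m : ℝ) + 1 + (k + 1) = m + 1 + k + 1 by ring]
      linarith
  have hm : (1 : ℝ) ≤ (m : ℝ) + 1 := by linarith [(Nat.cast_nonneg m : (0 : ℝ) ≤ m)]
  have hpos : 0 ≤ ((m : ℝ) + 1) ^ (1 - s) := by positivity
  cases k with
  | zero => simp; positivity
  | succ k =>
    rw [Finset.sum_range_succ']
    have h1 := key k
    have h2 : (((m : ℝ) + 1) ^ (1 - s) - ((m : ℝ) + 1 + k) ^ (1 - s)) / (s - 1) ≤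
        ((m : ℝ) + 1) ^ (1 - s) / (s - 1) := by
      have : 0 ≤ ((m : ℝ) + 1 + k) ^ (1 - s) := by positivity
      gcongr; linarith
    have h3 : ((m : ℝ) + 1) ^ (-s) ≤ ((m : ℝ) + 1) ^ (1 - s) :=
      Real.rpow_le_rpow_of_exponent_le hm (by linarith)
    have e : s / (s - 1) * ((m : ℝ) + 1) ^ (1 - s) =
      ((m : ℝ) + 1) ^ (1 - s) / (s - 1) + ((m : ℝ) + 1) ^ (1 - s) := by field_simp; ring
    rw [e]
    have e2 : ∑ i ∈ Finset.range k, (((m + (i + 1) : ℕ) : ℝ) + 1) ^ (-s) =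
        ∑ i ∈ Finset.range k, ((m : ℝ) + 1 + i + 1) ^ (-s) := by
      refine Finset.sum_congr rfl fun i _ => ?_
      push_cast; congr 1; ring
    rw [e2]
    simp only [add_zero]
    linarith

/-- The `r`-th powers of the sums of `(t - k) ^ (-b)` over the times `t ≤ n` after `k`, summed over
`k`. -/
lemma sum_window_rpow_le {b r : ℝ} (hb0 : 0 < b) (hb1 : b < 1) (hr : 1 ≤ r) (hbr : 1 < b * r) :
    ∃ C : ℝ, 0 < C ∧ ∀ n N : ℕ, 1 ≤ n →
      ∑ l ∈ Finset.range (N + n), (∑ s ∈ Finset.range n,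
        if l ≤ s + N then (((s + N - l : ℕ) : ℝ) + 1) ^ (-b) else 0) ^ r
      ≤ C * (n : ℝ) ^ (1 + r * (1 - b)) := by
  have h1b : 0 < 1 - b := by linarith
  have hr0 : 0 ≤ r := by linarith
  have hs1 : 0 < b * r - 1 := by linarith
  set c1 : ℝ := (1 / (1 - b)) ^ r
  have hc1 : 0 ≤ c1 := by positivity
  set c2 : ℝ := b * r / (b * r - 1)
  have hc2 : 0 ≤ c2 := by positivity
  -- The n innovation times inside the window and the n times just before it each use the uniform
  -- bound n^(1-b)/(1-b), giving 2 c1. For earlier times every summand is at most its value at the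
  -- smallest lag, and summability of m^(-br) gives c2.
  refine ⟨2 * c1 + c2 + 1, by positivity, fun n N hn => ?_⟩
  have hn0 : (0 : ℝ) < n := by exact_mod_cast hn
  set f : ℕ → ℝ := fun l => ∑ s ∈ Finset.range n,
        if l ≤ s + N then (((s + N - l : ℕ) : ℝ) + 1) ^ (-b) else 0
  have hf0 : ∀ l, 0 ≤ f l := fun l => Finset.sum_nonneg fun s _ => by
    split_ifs <;> positivity
  set e : ℝ := (n : ℝ) ^ (1 + r * (1 - b))
  have he : 0 < e := by positivity
  -- uniform bound
  have hsum := sum_rpow_neg_le hb0.le hb1 n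
  have hU : ∀ l, f l ≤ (n : ℝ) ^ (1 - b) / (1 - b) := by
    intro l
    refine le_trans ?_ hsum
    rcases le_total l N with hl | hl
    · refine Finset.sum_le_sum fun s _ => ?_
      split_ifs
      · refine Real.rpow_le_rpow_of_nonpos (by positivity) ?_ (by linarith)
        have : s ≤ s + N - l := by omega
        have : (s : ℝ) ≤ ((s + N - l : ℕ) : ℝ) := by exact_mod_cast this
        linarith
      · positivity
    · obtain ⟨q, rfl⟩ := Nat.exists_eq_add_of_le hl
      simp only [f]
      rcases le_total q n with hq | hq
      · obtain ⟨n', rfl⟩ := Nat.exists_eq_add_of_le hq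
        rw [Finset.sum_range_add, Finset.sum_eq_zero, zero_add]
        · calc _ = ∑ x ∈ Finset.range n', ((x : ℝ) + 1) ^ (-b) := by
                refine Finset.sum_congr rfl fun x _ => ?_
                rw [if_pos (by omega), show q + x + N - (N + q) = x by omega]
            _ ≤ _ := Finset.sum_le_sum_of_subset_of_nonneg
                (Finset.range_mono (by omega)) fun _ _ _ => by positivity
        · intro s hs
          have := Finset.mem_range.1 hs
          rw [if_neg (by omega)]
      · rw [Finset.sum_eq_zero]
        · exact Finset.sum_nonneg fun _ _ => by positivity
        · intro s hs
          have := Finset.mem_range.1 hs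
          rw [if_neg (by omega)]
  have hUr : ∀ l, f l ^ r ≤ c1 * ((n : ℝ) ^ (r * (1 - b))) := by
    intro l
    calc f l ^ r ≤ ((n : ℝ) ^ (1 - b) / (1 - b)) ^ r := Real.rpow_le_rpow (hf0 l) (hU l) hr0
      _ = _ := by
        rw [div_eq_mul_one_div, Real.mul_rpow (by positivity) (by positivity),
          ← Real.rpow_mul hn0.le, mul_comm r (1 - b)]
        ring
  have hen : (n : ℝ) * (n : ℝ) ^ (r * (1 - b)) = e := by
    simp only [e]; rw [Real.rpow_add hn0, Real.rpow_one]
  -- far past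
  have hV : ∀ l, l < N → f l ≤ n * (((N - 1 - l : ℕ) : ℝ) + 1) ^ (-b) := by
    intro l hl
    have : ∀ s ∈ Finset.range n, (if l ≤ s + N then (((s + N - l : ℕ) : ℝ) + 1) ^ (-b) else 0) ≤
        (((N - 1 - l : ℕ) : ℝ) + 1) ^ (-b) := by
      intro s _
      split_ifs
      · refine Real.rpow_le_rpow_of_nonpos (by positivity) ?_ (by linarith)
        have : N - 1 - l ≤ s + N - l := by omega
        have : ((N - 1 - l : ℕ) : ℝ) ≤ ((s + N - l : ℕ) : ℝ) := by exact_mod_cast this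
        linarith
      · positivity
    calc f l ≤ _ := Finset.sum_le_sum this
      _ = _ := by simp
  rw [Finset.sum_range_add]
  have hA : ∑ x ∈ Finset.range n, f (N + x) ^ r ≤ c1 * e := by
    calc _ ≤ ∑ x ∈ Finset.range n, c1 * ((n : ℝ) ^ (r * (1 - b))) :=
          Finset.sum_le_sum fun x _ => hUr _
      _ = c1 * e := by rw [Finset.sum_const, Finset.card_range, nsmul_eq_mul, ← hen]; ring
  have hB : ∑ l ∈ Finset.range N, f l ^ r ≤ c1 * e + c2 * e := by
    rw [← Finset.sum_range_reflect]
    have hterm : ∀ m ∈ Finset.range N, f (N - 1 - m) ^ r ≤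
        (if m < n then c1 * ((n : ℝ) ^ (r * (1 - b))) else n ^ r * ((m : ℝ) + 1) ^ (-(b * r))) := by
      intro m hm
      have hm := Finset.mem_range.1 hm
      split_ifs with h
      · exact hUr _
      · have h1 := hV (N - 1 - m) (by omega)
        rw [show N - 1 - (N - 1 - m) = m by omega] at h1
        calc _ ≤ (n * ((m : ℝ) + 1) ^ (-b)) ^ r := Real.rpow_le_rpow (hf0 _) h1 hr0
          _ = _ := by
            rw [Real.mul_rpow hn0.le (by positivity), ← Real.rpow_mul (by positivity)]
            congr 2; ring
    refine (Finset.sum_le_sum hterm).trans ?_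
    rw [Finset.sum_ite]
    refine add_le_add ?_ ?_
    · rw [Finset.sum_const, nsmul_eq_mul]
      have : ((Finset.range N).filter (· < n)).card ≤ n := by
        calc _ ≤ (Finset.range n).card := Finset.card_le_card fun x hx => by
              simp at hx ⊢; exact hx.2
          _ = n := Finset.card_range n
      have h' : ((((Finset.range N).filter (· < n)).card : ℕ) : ℝ) ≤ n := by exact_mod_cast this
      calc _ ≤ (n : ℝ) * (c1 * (n : ℝ) ^ (r * (1 - b))) := by gcongr
        _ = c1 * e := by rw [← hen]; ring
    · have htail := sum_rpow_neg_tail_le hbr n N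
      have : ∑ x ∈ (Finset.range N).filter (fun x => ¬ x < n), (n : ℝ) ^ r * ((x : ℝ) + 1) ^ (-(b * r)) ≤
          n ^ r * ∑ i ∈ Finset.range N, (((n + i : ℕ) : ℝ) + 1) ^ (-(b * r)) := by
        rw [← Finset.mul_sum]
        gcongr
        have hsub : (Finset.range N).filter (fun x => ¬ x < n) ⊆ (Finset.range N).image (n + ·) := by
          intro x hx
          simp at hx ⊢
          exact ⟨x - n, by omega, by omega⟩
        refine (Finset.sum_le_sum_of_subset_of_nonneg hsub fun _ _ _ => by positivity).trans ?_
        rw [Finset.sum_image (by intro a _ b _ h; simpa using h)]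
      refine this.trans ?_
      calc _ ≤ (n : ℝ) ^ r * (c2 * ((n : ℝ) + 1) ^ (1 - b * r)) := by gcongr
        _ ≤ (n : ℝ) ^ r * (c2 * (n : ℝ) ^ (1 - b * r)) :=
          mul_le_mul_of_nonneg_left (mul_le_mul_of_nonneg_left
            (Real.rpow_le_rpow_of_nonpos hn0 (le_add_of_nonneg_right zero_le_one)
              (sub_nonpos.2 hbr.le)) hc2) (by positivity)
        _ = c2 * e := by
          simp only [e]
          rw [mul_left_comm, ← Real.rpow_add hn0]; congr 2; ring
  have : (2 * c1 + c2 + 1) * e = (c1 * e + c2 * e) + c1 * e + e := by ring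
  rw [this]
  linarith

/-! ### The von Bahr–Esseen inequality. -/

section BahrEsseen

variable {Ω : Type*} [MeasurableSpace Ω] {P : Measure Ω}

lemma MeasureTheory.MemLp.integrable_abs_rpow {r : ℝ} (hr : 0 < r) {W : Ω → ℝ}
    (hW : MemLp W (ENNReal.ofReal r) P) : Integrable (fun ω => |W ω| ^ r) P := by
  have := hW.integrable_norm_rpow (by simpa using hr) ENNReal.ofReal_ne_top
  simpa [ENNReal.toReal_ofReal hr.le] using this

lemma eLpNorm_ofReal_eq {r : ℝ} (hr : 0 < r) {W : Ω → ℝ}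
    (hW : MemLp W (ENNReal.ofReal r) P) :
    eLpNorm W (ENNReal.ofReal r) P = ENNReal.ofReal ((∫ ω, |W ω| ^ r ∂P) ^ (1 / r)) := by
  rw [hW.eLpNorm_eq_integral_rpow_norm (by simpa using hr) ENNReal.ofReal_ne_top]
  simp [ENNReal.toReal_ofReal hr.le]

lemma integrable_signedPow_mul {r : ℝ} (hr : 1 < r) {W D : Ω → ℝ}
    (hW : MemLp W (ENNReal.ofReal r) P) (hD : MemLp D (ENNReal.ofReal r) P) :
    Integrable (fun ω => signedPow (r - 1) (W ω) * D ω) P := by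
  have h1 := hW.integrable_abs_rpow (by linarith)
  have h2 := hD.integrable_abs_rpow (by linarith)
  refine (h1.add h2).mono' ?_ (ae_of_all _ fun ω => ?_)
  · exact ((measurable_signedPow _).comp_aemeasurable hW.1.aemeasurable).aestronglyMeasurable.mul hD.1
  · rw [Real.norm_eq_abs, abs_mul, abs_signedPow]
    exact abs_rpow_sub_one_mul_le hr (abs_nonneg _) (abs_nonneg _)

lemma integral_abs_add_rpow_le {r : ℝ} (hr : 1 < r) (hr2 : r ≤ 2) {W D : Ω → ℝ}
    (hW : MemLp W (ENNReal.ofReal r) P) (hD : MemLp D (ENNReal.ofReal r) P)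
    (h0 : ∫ ω, signedPow (r - 1) (W ω) * D ω ∂P = 0) :
    ∫ ω, |W ω + D ω| ^ r ∂P ≤ ∫ ω, |W ω| ^ r ∂P + 2 * r * ∫ ω, |D ω| ^ r ∂P := by
  have hr0 : 0 < r := by linarith
  have h1 := hW.integrable_abs_rpow hr0
  have h2 := hD.integrable_abs_rpow hr0
  have h3 := integrable_signedPow_mul hr hW hD
  have h4 := (hW.add hD).integrable_abs_rpow hr0
  calc ∫ ω, |W ω + D ω| ^ r ∂P
      ≤ ∫ ω, (|W ω| ^ r + r * (signedPow (r - 1) (W ω) * D ω) + 2 * r * |D ω| ^ r) ∂P :=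
        integral_mono h4 ((h1.add (h3.const_mul r)).add (h2.const_mul _))
          fun ω => abs_add_rpow_le hr hr2 _ _
    _ = _ := by
      have e1 := integral_add (h1.add (h3.const_mul r)) (h2.const_mul (2 * r))
      simp only [Pi.add_apply] at e1
      rw [e1, integral_add h1 (h3.const_mul r), integral_const_mul, integral_const_mul, h0]
      ring

/-- The von Bahr–Esseen inequality, for increments orthogonal to the past partial sums. -/
lemma integral_abs_sum_rpow_le {r : ℝ} (hr : 1 < r) (hr2 : r ≤ 2) (D : ℕ → Ω → ℝ) (N : ℕ)
    (hD : ∀ k < N, MemLp (D k) (ENNReal.ofReal r) P)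
    (h0 : ∀ k < N, ∫ ω, signedPow (r - 1) (∑ i ∈ Finset.range k, D i ω) * D k ω ∂P = 0) :
    ∫ ω, |∑ i ∈ Finset.range N, D i ω| ^ r ∂P ≤
      2 * r * ∑ i ∈ Finset.range N, ∫ ω, |D i ω| ^ r ∂P := by
  have hr0 : 0 < r := by linarith
  induction N with
  | zero => simp [Real.zero_rpow hr0.ne']
  | succ N ih =>
    have ih' := ih (fun k hk => hD k (by omega)) (fun k hk => h0 k (by omega))
    have hS : MemLp (fun ω => ∑ i ∈ Finset.range N, D i ω) (ENNReal.ofReal r) P :=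
      memLp_finsetSum _ fun i hi => hD i (by have := Finset.mem_range.1 hi; omega)
    have := integral_abs_add_rpow_le hr hr2 hS (hD N (by omega)) (h0 N (by omega))
    simp only [Finset.sum_range_succ]
    rw [mul_add]
    linarith

/-- By independence the innovation X can be integrated first, with the past (W, Z) frozen. The space
of Z is arbitrary so that Z can collect infinitely many tails at once. -/
lemma integral_comp_mul_eq_zero [IsFiniteMeasure P] {E : Type*} [MeasurableSpace E] {X W : Ω → ℝ}
    {Z : Ω → E} (hX : Measurable X) (hW : Measurable W) (hZ : Measurable Z)
    (hind : IndepFun X (fun ω => (W ω, Z ω)) P) {φ : ℝ → ℝ} (hφ : Measurable φ)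
    {h : ℝ × E → ℝ} (hh : Measurable h) (h0 : ∀ z, ∫ e, h (e, z) ∂(P.map X) = 0)
    (hint : Integrable (fun ω => φ (W ω) * h (X ω, Z ω)) P) :
    ∫ ω, φ (W ω) * h (X ω, Z ω) ∂P = 0 := by
  have hWZ : Measurable fun ω => (W ω, Z ω) := hW.prodMk hZ
  have hmap := (indepFun_iff_map_prod_eq_prod_map_map hX.aemeasurable hWZ.aemeasurable).1 hind
  set F : ℝ × (ℝ × E) → ℝ := fun q => φ q.2.1 * h (q.1, q.2.2)
  have hF : Measurable F := by
    refine (hφ.comp (measurable_fst.comp measurable_snd)).mul (hh.comp ?_)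
    exact measurable_fst.prodMk (measurable_snd.comp measurable_snd)
  have e : ∫ ω, φ (W ω) * h (X ω, Z ω) ∂P = ∫ q, F q ∂(P.map fun ω => (X ω, (W ω, Z ω))) := by
    rw [integral_map (hX.prodMk hWZ).aemeasurable hF.aestronglyMeasurable]
  have hint' : Integrable F (P.map fun ω => (X ω, (W ω, Z ω))) := by
    rw [integrable_map_measure hF.aestronglyMeasurable (hX.prodMk hWZ).aemeasurable]
    exact hint
  rw [e]
  rw [hmap] at hint' ⊢
  rw [integral_prod_symm _ hint']
  simp only [F, integral_const_mul, h0, mul_zero, integral_zero]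

end BahrEsseen

/-! ### Almost sure convergence of independent sums. -/

section IndependentSums

variable {Ω : Type*} [MeasurableSpace Ω] {P : Measure Ω} [IsProbabilityMeasure P]

lemma integral_abs_sum_indep_rpow_le {p : ℝ} (hp : 1 < p) (hp2 : p ≤ 2) {Y : ℕ → Ω → ℝ}
    (hYm : ∀ i, Measurable (Y i)) (hY : iIndepFun Y P)
    (hLp : ∀ i, MemLp (Y i) (ENNReal.ofReal p) P) (h0 : ∀ i, ∫ ω, Y i ω ∂P = 0) (N : ℕ) :
    ∫ ω, |∑ i ∈ Finset.range N, Y i ω| ^ p ∂P ≤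
      2 * p * ∑ i ∈ Finset.range N, ∫ ω, |Y i ω| ^ p ∂P := by
  refine integral_abs_sum_rpow_le hp hp2 Y N (fun k _ => hLp k) fun k _ => ?_
  have hind := (hY.indepFun_finsetSum_of_notMem hYm (s := Finset.range k) (i := k) (by simp)).symm
  have hS : Measurable fun ω => ∑ i ∈ Finset.range k, Y i ω :=
    Finset.measurable_sum _ fun i _ => hYm i
  have hc := hind.comp measurable_id (measurable_signedPow (p - 1))
  have hS' : Measurable (∑ i ∈ Finset.range k, Y i) := by
    convert hS using 1
    ext ω
    simp
  have e := IndepFun.integral_fun_mul_eq_mul_integral hc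
    ((hYm k).aestronglyMeasurable) ((measurable_signedPow _).comp hS').aestronglyMeasurable
  simp only [Function.comp_apply, id, Finset.sum_apply] at e
  simp_rw [mul_comm (signedPow _ _)]
  rw [e, h0 k, zero_mul]

lemma eLpNorm_sum_indep_le {p : ℝ} (hp : 1 < p) (hp2 : p ≤ 2) {Y : ℕ → Ω → ℝ}
    (hYm : ∀ i, Measurable (Y i)) (hY : iIndepFun Y P)
    (hLp : ∀ i, MemLp (Y i) (ENNReal.ofReal p) P) (h0 : ∀ i, ∫ ω, Y i ω ∂P = 0) {B : ℝ}
    (hB : ∀ N, ∑ i ∈ Finset.range N, ∫ ω, |Y i ω| ^ p ∂P ≤ B) (N : ℕ) :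
    eLpNorm (fun ω => ∑ i ∈ Finset.range N, Y i ω) (ENNReal.ofReal p) P ≤
      ENNReal.ofReal ((2 * p * B) ^ (1 / p)) := by
  rw [eLpNorm_ofReal_eq (by linarith) (memLp_finsetSum _ fun i _ => hLp i)]
  refine ENNReal.ofReal_le_ofReal (Real.rpow_le_rpow (integral_nonneg fun ω => by positivity) ?_
    (by positivity))
  refine (integral_abs_sum_indep_rpow_le hp hp2 hYm hY hLp h0 N).trans ?_
  exact mul_le_mul_of_nonneg_left (hB N) (by linarith)

/-- An `L^p`-bounded sum of independent centred variables converges almost surely. -/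
lemma ae_exists_tendsto_sum_indep {p : ℝ} (hp : 1 < p) (hp2 : p ≤ 2) {Y : ℕ → Ω → ℝ}
    (hYm : ∀ i, Measurable (Y i)) (hY : iIndepFun Y P)
    (hLp : ∀ i, MemLp (Y i) (ENNReal.ofReal p) P) (h0 : ∀ i, ∫ ω, Y i ω ∂P = 0) {B : ℝ}
    (hB : ∀ N, ∑ i ∈ Finset.range N, ∫ ω, |Y i ω| ^ p ∂P ≤ B) :
    ∀ᵐ ω ∂P, ∃ c, Tendsto (fun N => ∑ i ∈ Finset.range N, Y i ω) atTop (𝓝 c) := by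
  -- The σ-algebra at index N uses only the variables with i < N. It thus matches the partial sum
  -- over `range N` and is independent of the next increment `Y N`.
  let F : Filtration ℕ (inferInstance : MeasurableSpace Ω) :=
    { seq := fun N => ⨆ i ∈ Set.Iio N, MeasurableSpace.comap (Y i) inferInstance
      mono' := fun i j hij => biSup_mono fun k hk => lt_of_lt_of_le hk hij
      le' := fun N => iSup₂_le fun i _ => (hYm i).comap_le }
  have hint : ∀ i, Integrable (Y i) P := fun i =>
    (hLp i).integrable (by simpa using hp.le)
  have hadap : ∀ n, StronglyMeasurable[F n] (fun ω => ∑ i ∈ Finset.range n, Y i ω) := by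
    intro n
    have : Measurable[F n] (fun ω => ∑ i ∈ Finset.range n, Y i ω) := by
      refine @Finset.measurable_sum _ _ _ _ _ _ (F n) _ _ fun i hi => ?_
      have h1 : MeasurableSpace.comap (Y i) inferInstance ≤ F n :=
        le_iSup₂_of_le i (Finset.mem_range.1 hi) le_rfl
      exact (comap_measurable (Y i)).mono h1 le_rfl
    exact this.stronglyMeasurable
  have hmart : Martingale (fun n ω => ∑ i ∈ Finset.range n, Y i ω) F P := by
    refine martingale_of_condExp_sub_eq_zero_nat hadap
      (fun n => integrable_finsetSum _ fun i _ => hint i) fun n => ?_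
    have e : (fun ω => ∑ i ∈ Finset.range (n + 1), Y i ω) - (fun ω => ∑ i ∈ Finset.range n, Y i ω)
        = Y n := by
      ext ω; simp [Finset.sum_range_succ]
    rw [e]
    have hind : Indep (MeasurableSpace.comap (Y n) inferInstance) (F n) P := by
      have := indep_iSup_of_disjoint (fun i => (hYm i).comap_le) hY.iIndep
        (S := {n}) (T := Set.Iio n) (by simp)
      simpa [F] using this
    have := condExp_indep_eq (hYm n).comap_le (F.le n)
      (comap_measurable (Y n)).stronglyMeasurable hind
    filter_upwards [this] with ω hω
    rw [hω, h0 n]; rfl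
  have hbdd : ∀ n, eLpNorm (fun ω => ∑ i ∈ Finset.range n, Y i ω) 1 P ≤
      (Real.toNNReal ((2 * p * B) ^ (1 / p)) : ENNReal) := fun n =>
    (eLpNorm_le_eLpNorm_of_exponent_le (by simpa using hp.le)
      (memLp_finsetSum _ fun i _ => hLp i).1).trans
      (eLpNorm_sum_indep_le hp hp2 hYm hY hLp h0 hB n)
  filter_upwards [hmart.submartingale.ae_tendsto_limitProcess hbdd] with ω hω
  exact ⟨_, hω⟩

end IndependentSums

/-! ### Linear processes: measurability, moments, stationarity. -/

/-- Independent, identically distributed, centred innovations with a moment of order `p`. -/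
structure CenteredInnovations {Ω : Type*} [MeasurableSpace Ω] (P : Measure Ω) (ε : ℤ → Ω → ℝ)
    (p : ℝ) : Prop where
  measurable : ∀ t, Measurable (ε t)
  indep : iIndepFun ε P
  ident : ∀ t, IdentDistrib (ε t) (ε 0) P P
  one_lt : 1 < p
  le_two : p ≤ 2
  memLp : MemLp (ε 0) (ENNReal.ofReal p) P
  centered : ∫ ω, ε 0 ω ∂P = 0

/-- The σ-algebra of the innovations up to time `k`. -/
@[reducible] def pastInnovations {Ω : Type*} (ε : ℤ → Ω → ℝ) (k : ℤ) : MeasurableSpace Ω :=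
  ⨆ i ∈ Set.Iic k, MeasurableSpace.comap (ε i) inferInstance

lemma measurable_pastInnovations {Ω : Type*} {ε : ℤ → Ω → ℝ} {k i : ℤ} (hi : i ≤ k) :
    Measurable[pastInnovations ε k] (ε i) :=
  (comap_measurable (ε i)).mono (le_iSup₂_of_le (f := fun i (_ : i ∈ Set.Iic k) =>
    MeasurableSpace.comap (ε i) inferInstance) i hi le_rfl) le_rfl

lemma pastInnovations_mono {Ω : Type*} {ε : ℤ → Ω → ℝ} {k l : ℤ} (hkl : k ≤ l) :
    pastInnovations ε k ≤ pastInnovations ε l :=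
  biSup_mono fun _ hi => le_trans hi hkl

/-- Exact measurability, with no null set to discard: the total function `limUnder` of measurable
partial sums is measurable, including where the series diverges. Independence of later innovations
follows directly. -/
lemma measurable_linearProcess_past {Ω : Type*} {ε : ℤ → Ω → ℝ} (b : ℕ → ℝ) (k : ℤ) :
    Measurable[pastInnovations ε k] (linearProcess b ε k) := by
  let : MeasurableSpace Ω := pastInnovations ε k
  have : StronglyMeasurable (fun ω => limUnder atTop
      (fun N : ℕ => ∑ j ∈ Finset.range N, b j * ε (k - (j : ℤ)) ω)) := by
    refine StronglyMeasurable.limUnder fun N => ?_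
    exact (Finset.measurable_sum _ fun i _ =>
      (measurable_pastInnovations (by omega)).const_mul _).stronglyMeasurable
  exact this.measurable


namespace CenteredInnovations

variable {Ω : Type*} [MeasurableSpace Ω] {P : Measure Ω} [IsProbabilityMeasure P]
  {ε : ℤ → Ω → ℝ} {p : ℝ}

lemma past_le (h : CenteredInnovations P ε p) (k : ℤ) :
    pastInnovations ε k ≤ (inferInstance : MeasurableSpace Ω) :=
  iSup₂_le fun i _ => (h.measurable i).comap_le

lemma indepFun_past (h : CenteredInnovations P ε p) {k l : ℤ} (hkl : k < l) {E : Type*}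
    [MeasurableSpace E] {Z : Ω → E} (hZ : Measurable[pastInnovations ε k] Z) :
    IndepFun (ε l) Z P := by
  have h1 := indep_iSup_of_disjoint (fun i => (h.measurable i).comap_le) h.indep.iIndep
    (S := {l}) (T := Set.Iic k) (by simpa using hkl)
  have h2 : Indep (MeasurableSpace.comap (ε l) inferInstance) (pastInnovations ε k) P := by
    simpa [pastInnovations] using h1
  exact indep_of_indep_of_le_right h2 hZ.comap_le

lemma measurable_linearProcess_at (h : CenteredInnovations P ε p) (b : ℕ → ℝ) (k : ℤ) :
    Measurable (linearProcess b ε k) :=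
  (measurable_linearProcess_past b k).mono (h.past_le k) le_rfl

lemma memLp_at (h : CenteredInnovations P ε p) (t : ℤ) : MemLp (ε t) (ENNReal.ofReal p) P :=
  (h.ident t).symm.memLp_iff.1 h.memLp

lemma centered_at (h : CenteredInnovations P ε p) (t : ℤ) : ∫ ω, ε t ω ∂P = 0 := by
  rw [(h.ident t).integral_eq, h.centered]

lemma iIndepFun_terms (h : CenteredInnovations P ε p) (b : ℕ → ℝ) (t : ℤ) :
    iIndepFun (fun (j : ℕ) ω => b j * ε (t - (j : ℤ)) ω) P := by
  have h1 := h.indep.precomp (g := fun j : ℕ => t - (j : ℤ)) (fun i j hij => by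
    simp only at hij; omega)
  exact h1.comp (fun j x => b j * x) fun j => measurable_const_mul _

lemma integral_abs_term_rpow (h : CenteredInnovations P ε p) (c : ℝ) (t : ℤ) :
    ∫ ω, |c * ε t ω| ^ p ∂P = |c| ^ p * ∫ ω, |ε 0 ω| ^ p ∂P := by
  simp_rw [abs_mul, Real.mul_rpow (abs_nonneg _) (abs_nonneg _)]
  rw [integral_const_mul]
  congr 1
  exact ((h.ident t).comp (u := fun x : ℝ => |x| ^ p) (by fun_prop)).integral_eq

variable {b : ℕ → ℝ} {B : ℝ}

lemma sum_integral_abs_term_rpow_le (h : CenteredInnovations P ε p)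
    (hB : ∀ N, ∑ i ∈ Finset.range N, |b i| ^ p ≤ B) (t : ℤ) (N : ℕ) :
    ∑ j ∈ Finset.range N, ∫ ω, |b j * ε (t - (j : ℤ)) ω| ^ p ∂P ≤
      B * ∫ ω, |ε 0 ω| ^ p ∂P := by
  simp_rw [h.integral_abs_term_rpow]
  rw [← Finset.sum_mul]
  exact mul_le_mul_of_nonneg_right (hB N) (integral_nonneg fun ω => by positivity)

lemma ae_tendsto_linearProcess_at (h : CenteredInnovations P ε p)
    (hB : ∀ N, ∑ i ∈ Finset.range N, |b i| ^ p ≤ B) (t : ℤ) :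
    ∀ᵐ ω ∂P, Tendsto (fun N : ℕ => ∑ j ∈ Finset.range N, b j * ε (t - (j : ℤ)) ω) atTop
        (𝓝 (linearProcess b ε t ω)) := by
  have := ae_exists_tendsto_sum_indep h.one_lt h.le_two
    (fun j => (h.measurable _).const_mul (b j)) (h.iIndepFun_terms b t)
    (fun j => (h.memLp_at _).const_mul _)
    (fun j => by rw [integral_const_mul, h.centered_at, mul_zero])
    (h.sum_integral_abs_term_rpow_le hB t)
  filter_upwards [this] with ω hω
  exact tendsto_nhds_limUnder hω

lemma eLpNorm_partialSum_le (h : CenteredInnovations P ε p)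
    (hB : ∀ N, ∑ i ∈ Finset.range N, |b i| ^ p ≤ B) (t : ℤ) (N : ℕ) :
    eLpNorm (fun ω => ∑ j ∈ Finset.range N, b j * ε (t - (j : ℤ)) ω) (ENNReal.ofReal p) P ≤
      ENNReal.ofReal ((2 * p * (B * ∫ ω, |ε 0 ω| ^ p ∂P)) ^ (1 / p)) :=
  eLpNorm_sum_indep_le h.one_lt h.le_two
    (fun j => (h.measurable _).const_mul (b j)) (h.iIndepFun_terms b t)
    (fun j => (h.memLp_at _).const_mul _)
    (fun j => by rw [integral_const_mul, h.centered_at, mul_zero])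
    (h.sum_integral_abs_term_rpow_le hB t) N

/-- Fatou's lemma along the almost surely convergent partial sums, whose norms are bounded uniformly
by the von Bahr–Esseen inequality. -/
lemma eLpNorm_linearProcess_le (h : CenteredInnovations P ε p)
    (hB : ∀ N, ∑ i ∈ Finset.range N, |b i| ^ p ≤ B) (t : ℤ) :
    eLpNorm (linearProcess b ε t) (ENNReal.ofReal p) P ≤
      ENNReal.ofReal ((2 * p * (B * ∫ ω, |ε 0 ω| ^ p ∂P)) ^ (1 / p)) :=
  Lp.eLpNorm_le_of_ae_tendsto
    (Eventually.of_forall fun _ => h.eLpNorm_partialSum_le hB t _)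
    (fun _ => (Finset.measurable_sum _ fun j _ =>
      (h.measurable _).const_mul (b j)).aestronglyMeasurable)
    (h.ae_tendsto_linearProcess_at hB t)

lemma ae_linearProcess_eq (h : CenteredInnovations P ε p)
    (hB : ∀ N, ∑ i ∈ Finset.range N, |b i| ^ p ≤ B) (t : ℤ) :
    ∀ᵐ ω ∂P, linearProcess b ε t ω =
      b 0 * ε t ω + linearProcess (fun i => b (i + 1)) ε (t - 1) ω := by
  have hB' : ∀ N, ∑ i ∈ Finset.range N, |b (i + 1)| ^ p ≤ B := fun N => by
    have := hB (N + 1)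
    rw [Finset.sum_range_succ'] at this
    have : 0 ≤ |b 0| ^ p := by positivity
    linarith
  filter_upwards [h.ae_tendsto_linearProcess_at hB t, h.ae_tendsto_linearProcess_at hB' (t - 1)]
    with ω h1 h2
  have h3 := (tendsto_add_atTop_iff_nat 1).2 h1
  refine tendsto_nhds_unique h3 ?_
  have h4 := h2.const_add (b 0 * ε t ω)
  refine h4.congr fun N => ?_
  rw [Finset.sum_range_succ', add_comm]
  congr 1
  · refine Finset.sum_congr rfl fun j _ => ?_
    push_cast
    rw [show t - 1 - (j : ℤ) = t - (j + 1) by ring]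
  · simp

/-- Stationarity: the process at any time is the same measurable functional of an i.i.d. sequence,
the innovations read backwards from that time. -/
lemma map_linearProcess_eq (h : CenteredInnovations P ε p) (b : ℕ → ℝ) (t : ℤ) :
    P.map (linearProcess b ε t) = P.map (linearProcess b ε 0) := by
  have h1 : ∀ s : ℤ, iIndepFun (fun (j : ℕ) => ε (s - (j : ℤ))) P := fun s =>
    h.indep.precomp (g := fun j : ℕ => s - (j : ℤ)) (fun i j hij => by simp only at hij; omega)
  have h2 := IdentDistrib.pi (fun j : ℕ => (h.ident (t - (j : ℤ))).trans
    (h.ident (0 - (j : ℤ))).symm) (h1 t) (h1 0)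
  have h3 : Measurable (fun x : ℕ → ℝ => limUnder atTop
      (fun N : ℕ => ∑ j ∈ Finset.range N, b j * x j)) := by
    refine (StronglyMeasurable.limUnder fun N => ?_).measurable
    exact (Finset.measurable_sum _ fun j _ =>
      (measurable_pi_apply j).const_mul _).stronglyMeasurable
  exact (h2.comp h3).map_eq

end CenteredInnovations

/-! ### Polynomial weights and averages of translates. -/

section Weight

/-- The polynomial weight `(1 + |x|) ^ γ`. -/
noncomputable def polyWeight (γ x : ℝ) : ℝ := (1 + |x|) ^ γ

lemma measurable_polyWeight (γ : ℝ) : Measurable (polyWeight γ) := by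
  unfold polyWeight; fun_prop

lemma polyWeight_pos (γ x : ℝ) : 0 < polyWeight γ x := by unfold polyWeight; positivity

lemma polyWeight_zero (γ : ℝ) : polyWeight γ 0 = 1 := by simp [polyWeight]

lemma one_le_polyWeight {γ : ℝ} (hγ : 0 ≤ γ) (x : ℝ) : 1 ≤ polyWeight γ x :=
  Real.one_le_rpow (by linarith [abs_nonneg x]) hγ

lemma polyWeight_mono {γ : ℝ} (hγ : 0 ≤ γ) {x y : ℝ} (h : |x| ≤ |y|) :
    polyWeight γ x ≤ polyWeight γ y :=
  Real.rpow_le_rpow (by positivity) (by linarith) hγ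

/-- Submultiplicativity, from 1 + |x + y| ≤ (1 + |x|)(1 + |y|). It separates current and past
contributions in all growth bounds and keeps the growth class stable under averaging. -/
lemma polyWeight_add_le {γ : ℝ} (hγ : 0 ≤ γ) (x y : ℝ) :
    polyWeight γ (x + y) ≤ polyWeight γ x * polyWeight γ y := by
  unfold polyWeight
  rw [← Real.mul_rpow (by positivity) (by positivity)]
  refine Real.rpow_le_rpow (by positivity) ?_ hγ
  nlinarith [abs_add_le x y, abs_nonneg x, abs_nonneg y, mul_nonneg (abs_nonneg x) (abs_nonneg y)]

lemma polyWeight_mul_le {γ : ℝ} (hγ : 0 ≤ γ) (x y : ℝ) :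
    polyWeight γ (x * y) ≤ polyWeight γ x * polyWeight γ y := by
  unfold polyWeight
  rw [← Real.mul_rpow (by positivity) (by positivity), abs_mul]
  refine Real.rpow_le_rpow (by positivity) ?_ hγ
  nlinarith [abs_nonneg x, abs_nonneg y, mul_nonneg (abs_nonneg x) (abs_nonneg y)]

lemma polyWeight_le_one_add {γ : ℝ} (hγ1 : γ ≤ 1) (x : ℝ) : polyWeight γ x ≤ 1 + |x| := by
  unfold polyWeight
  calc (1 + |x|) ^ γ ≤ (1 + |x|) ^ (1 : ℝ) :=
        Real.rpow_le_rpow_of_exponent_le (by linarith [abs_nonneg x]) hγ1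
    _ = _ := Real.rpow_one _

end Weight

section Avg

/-- The average of the translates of `H` under `ν`, that is, `x ↦ E[H(x + Z)]` for `Z` with
law `ν`. -/
noncomputable def avg (ν : Measure ℝ) (H : ℝ → ℝ) (x : ℝ) : ℝ := ∫ z, H (x + z) ∂ν

variable {ν ν' : Measure ℝ} {γ A B : ℝ} {H : ℝ → ℝ}

lemma measurable_avg [SFinite ν] (hH : Measurable H) : Measurable (avg ν H) := by
  have : StronglyMeasurable (Function.uncurry fun x z : ℝ => H (x + z)) :=
    (hH.comp (measurable_fst.add measurable_snd)).stronglyMeasurable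
  exact this.integral_prod_right.measurable

lemma nonneg_of_growth (hA : ∀ x, |H x| ≤ A * polyWeight γ x) : 0 ≤ A := by
  have := hA 0
  rw [polyWeight_zero, mul_one] at this
  exact (abs_nonneg _).trans this

lemma abs_comp_add_le (hγ : 0 ≤ γ) (hA : ∀ x, |H x| ≤ A * polyWeight γ x) (x z : ℝ) :
    |H (x + z)| ≤ A * polyWeight γ x * polyWeight γ z := by
  rw [mul_assoc]
  exact (hA _).trans (mul_le_mul_of_nonneg_left (polyWeight_add_le hγ x z) (nonneg_of_growth hA))

lemma integrable_comp_add (hγ : 0 ≤ γ) (hH : Measurable H)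
    (hA : ∀ x, |H x| ≤ A * polyWeight γ x) (hw : Integrable (polyWeight γ) ν) (x : ℝ) :
    Integrable (fun z => H (x + z)) ν :=
  (hw.const_mul (A * polyWeight γ x)).mono'
    (hH.comp (measurable_const_add x)).aestronglyMeasurable
    (ae_of_all _ fun z => abs_comp_add_le hγ hA x z)

lemma abs_avg_le (hγ : 0 ≤ γ) (hA : ∀ x, |H x| ≤ A * polyWeight γ x)
    (hw : Integrable (polyWeight γ) ν) (hB : ∫ z, polyWeight γ z ∂ν ≤ B) (x : ℝ) :
    |avg ν H x| ≤ A * B * polyWeight γ x := by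
  have hA0 := nonneg_of_growth hA
  calc |avg ν H x| ≤ ∫ z, A * polyWeight γ x * polyWeight γ z ∂ν := by
        rw [avg, ← Real.norm_eq_abs]
        exact norm_integral_le_of_norm_le (hw.const_mul _)
          (ae_of_all _ fun z => abs_comp_add_le hγ hA x z)
    _ = A * polyWeight γ x * ∫ z, polyWeight γ z ∂ν := integral_const_mul _ _
    _ ≤ A * polyWeight γ x * B :=
        mul_le_mul_of_nonneg_left hB (mul_nonneg hA0 (polyWeight_pos _ _).le)
    _ = _ := by ring

lemma integrable_polyWeight_conv [IsFiniteMeasure ν] [IsFiniteMeasure ν'] (hγ : 0 ≤ γ)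
    (h : Integrable (polyWeight γ) ν) (h' : Integrable (polyWeight γ) ν') :
    Integrable (polyWeight γ) (ν ∗ ν') := by
  rw [Measure.conv, integrable_map_measure (measurable_polyWeight γ).aestronglyMeasurable
    (by fun_prop)]
  refine (h.mul_prod h').mono'
    ((measurable_polyWeight γ).comp (by fun_prop)).aestronglyMeasurable (ae_of_all _ fun z => ?_)
  rw [Function.comp_apply, Real.norm_eq_abs, abs_of_pos (polyWeight_pos _ _)]
  exact polyWeight_add_le hγ _ _

lemma avg_conv [IsFiniteMeasure ν] [IsFiniteMeasure ν'] (hγ : 0 ≤ γ) (hH : Measurable H)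
    (hA : ∀ x, |H x| ≤ A * polyWeight γ x)
    (h : Integrable (polyWeight γ) ν) (h' : Integrable (polyWeight γ) ν') :
    avg (ν ∗ ν') H = avg ν' (avg ν H) := by
  ext x
  rw [Measure.conv_comm]
  unfold avg
  rw [integral_conv (integrable_comp_add hγ hH hA (integrable_polyWeight_conv hγ h' h) x)]
  simp only [add_assoc]

end Avg

/-! ### Smooth functions of polynomial growth and smoothing measures. -/

/-- Differentiable functions which grow, together with their derivative and its local Lipschitz
constants, at most like `M (1 + |x|) ^ γ`. -/
structure SmoothGrowth (γ M : ℝ) (g : ℝ → ℝ) : Prop where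
  differentiable : Differentiable ℝ g
  bound : ∀ x, |g x| ≤ M * polyWeight γ x
  deriv_bound : ∀ x, |deriv g x| ≤ M * polyWeight γ x
  deriv_lipschitz : ∀ x h, |deriv g (x + h) - deriv g x| ≤
    M * (|h| * polyWeight γ h * polyWeight γ x)

namespace SmoothGrowth

variable {γ M : ℝ} {g : ℝ → ℝ}

lemma nonneg (hg : SmoothGrowth γ M g) : 0 ≤ M := nonneg_of_growth hg.bound

lemma mono {M' : ℝ} (hg : SmoothGrowth γ M g) (h : M ≤ M') : SmoothGrowth γ M' g where
  differentiable := hg.differentiable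
  bound x := (hg.bound x).trans (mul_le_mul_of_nonneg_right h (polyWeight_pos _ _).le)
  deriv_bound x := (hg.deriv_bound x).trans (mul_le_mul_of_nonneg_right h (polyWeight_pos _ _).le)
  deriv_lipschitz x k := (hg.deriv_lipschitz x k).trans (mul_le_mul_of_nonneg_right h
    (mul_nonneg (mul_nonneg (abs_nonneg _) (polyWeight_pos _ _).le) (polyWeight_pos _ _).le))

lemma hasDerivAt_avg {ν : Measure ℝ} (hγ : 0 ≤ γ) (hg : SmoothGrowth γ M g)
    (hw : Integrable (polyWeight γ) ν) (x : ℝ) :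
    HasDerivAt (avg ν g) (avg ν (deriv g) x) x := by
  have hm : Measurable g := hg.differentiable.continuous.measurable
  refine (hasDerivAt_integral_of_dominated_loc_of_deriv_le (μ := ν) (𝕜 := ℝ)
    (F := fun x z => g (x + z)) (F' := fun x z => deriv g (x + z)) (s := Metric.ball x 1)
    (bound := fun z => M * (polyWeight γ x * polyWeight γ 1) * polyWeight γ z)
    (Metric.ball_mem_nhds x one_pos) ?_ ?_ ?_ ?_ ?_ ?_).2
  · exact Eventually.of_forall fun y =>
      (integrable_comp_add hγ hm hg.bound hw y).aestronglyMeasurable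
  · exact integrable_comp_add hγ hm hg.bound hw x
  · exact ((measurable_deriv g).comp (measurable_const_add x)).aestronglyMeasurable
  · refine ae_of_all _ fun z y hy => ?_
    refine (abs_comp_add_le hγ hg.deriv_bound y z).trans ?_
    have : polyWeight γ y ≤ polyWeight γ x * polyWeight γ 1 := by
      have h1 := polyWeight_add_le hγ x (y - x)
      rw [add_sub_cancel] at h1
      refine h1.trans (mul_le_mul_of_nonneg_left (polyWeight_mono hγ ?_) (polyWeight_pos _ _).le)
      rw [abs_one]
      exact (Metric.mem_ball.1 hy).le
    exact mul_le_mul_of_nonneg_right (mul_le_mul_of_nonneg_left this hg.nonneg)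
      (polyWeight_pos _ _).le
  · exact hw.const_mul _
  · refine ae_of_all _ fun z y _ => ?_
    exact ((hg.differentiable (y + z)).hasDerivAt).comp_add_const y z

lemma deriv_avg {ν : Measure ℝ} (hγ : 0 ≤ γ) (hg : SmoothGrowth γ M g)
    (hw : Integrable (polyWeight γ) ν) : deriv (avg ν g) = avg ν (deriv g) :=
  funext fun x => (hg.hasDerivAt_avg hγ hw x).deriv

/-- Differentiation passes under the integral, so each bound is averaged, and submultiplicativity of
the weight splits off the factor B. Further averaging therefore never destroys smoothness and costs
only a moment of the weight. -/
lemma averaged {ν : Measure ℝ} {B : ℝ} (hγ : 0 ≤ γ) (hg : SmoothGrowth γ M g)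
    (hw : Integrable (polyWeight γ) ν) (hB : ∫ z, polyWeight γ z ∂ν ≤ B) :
    SmoothGrowth γ (M * B) (avg ν g) where
  differentiable x := (hg.hasDerivAt_avg hγ hw x).differentiableAt
  bound := abs_avg_le hγ hg.bound hw hB
  deriv_bound x := by
    rw [hg.deriv_avg hγ hw]
    exact abs_avg_le hγ hg.deriv_bound hw hB x
  deriv_lipschitz x h := by
    rw [hg.deriv_avg hγ hw]
    unfold avg
    rw [← integral_sub (integrable_comp_add hγ (measurable_deriv g) hg.deriv_bound hw _)
      (integrable_comp_add hγ (measurable_deriv g) hg.deriv_bound hw _)]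
    set c := |h| * polyWeight γ h * polyWeight γ x with hc
    have hc0 : 0 ≤ c :=
      mul_nonneg (mul_nonneg (abs_nonneg _) (polyWeight_pos _ _).le) (polyWeight_pos _ _).le
    calc _ ≤ ∫ z, M * c * polyWeight γ z ∂ν := by
          rw [← Real.norm_eq_abs]
          refine norm_integral_le_of_norm_le (hw.const_mul _) (ae_of_all _ fun z => ?_)
          have h1 := hg.deriv_lipschitz (x + z) h
          rw [add_right_comm] at h1
          refine h1.trans ?_
          have h2 := mul_le_mul_of_nonneg_left (polyWeight_add_le hγ x z)
            (mul_nonneg hg.nonneg (mul_nonneg (abs_nonneg h) (polyWeight_pos γ h).le))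
          calc _ = M * (|h| * polyWeight γ h) * polyWeight γ (x + z) := by ring
            _ ≤ _ := h2
            _ = _ := by rw [hc]; ring
      _ = M * c * ∫ z, polyWeight γ z ∂ν := integral_const_mul _ _
      _ ≤ M * c * B := mul_le_mul_of_nonneg_left hB (mul_nonneg hg.nonneg hc0)
      _ = _ := by ring

lemma abs_deriv_sub_le (hg : SmoothGrowth γ M g) (x : ℝ) :
    |deriv g x - deriv g 0| ≤ M * (|x| * polyWeight γ x) := by
  have := hg.deriv_lipschitz 0 x
  simpa [polyWeight_zero] using this

lemma abs_sub_le (hγ : 0 ≤ γ) (hg : SmoothGrowth γ M g) (x : ℝ) :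
    |g x - g 0| ≤ M * (|x| * polyWeight γ x) := by
  have := Convex.norm_image_sub_le_of_norm_deriv_le (𝕜 := ℝ) (s := Set.uIcc 0 x) (f := g)
    (x := 0) (y := x) (C := M * polyWeight γ x) (fun y _ => hg.differentiable y) (fun y hy => ?_)
    (convex_uIcc 0 x) Set.left_mem_uIcc Set.right_mem_uIcc
  · rw [Real.norm_eq_abs, Real.norm_eq_abs, sub_zero] at this
    linarith
  · refine (hg.deriv_bound y).trans (mul_le_mul_of_nonneg_left (polyWeight_mono hγ ?_) hg.nonneg)
    have := Set.abs_sub_left_of_mem_uIcc hy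
    simpa using this

/-- First-order Taylor expansion with a remainder of order `1 + γ`. -/
lemma abs_taylor_le (hγ : 0 ≤ γ) (hγ1 : γ ≤ 1) (hg : SmoothGrowth γ M g) (x h : ℝ) :
    |g (x + h) - g x - deriv g x * h| ≤ 4 * M * polyWeight γ x * |h| ^ (1 + γ) := by
  have hM := hg.nonneg
  have hwx := polyWeight_pos γ x
  have hd : ∀ s ∈ Set.uIcc (0 : ℝ) h, HasDerivAt (fun s => g (x + s) - deriv g x * s)
      (deriv g (x + s) - deriv g x) s := fun s _ => by
    have h1 := ((hg.differentiable (x + s)).hasDerivAt).comp_const_add x s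
    have h2 : HasDerivAt (fun s : ℝ => deriv g x * s) (deriv g x) s := by
      simpa using (hasDerivAt_id s).const_mul (deriv g x)
    exact h1.sub h2
  have hbd : ∀ s ∈ Set.uIcc (0 : ℝ) h,
      ‖deriv g (x + s) - deriv g x‖ ≤ 4 * M * polyWeight γ x * |h| ^ γ := by
    intro s hs
    have hsh : |s| ≤ |h| := by simpa using Set.abs_sub_left_of_mem_uIcc hs
    have hws := polyWeight_mono hγ hsh
    have hMx : 0 ≤ M * polyWeight γ x := by positivity
    have h2γ : (2 : ℝ) ^ γ ≤ 2 := by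
      calc (2 : ℝ) ^ γ ≤ 2 ^ (1 : ℝ) := Real.rpow_le_rpow_of_exponent_le (by norm_num) hγ1
        _ = 2 := Real.rpow_one _
    rw [Real.norm_eq_abs]
    -- For small h the Lipschitz bound suffices, as |h| ≤ |h|^γ by γ ≤ 1. For large h the two
    -- derivatives are bounded separately and the weight of h is at most 2|h|^γ.
    rcases le_total |h| 1 with h1 | h1
    · refine (hg.deriv_lipschitz x s).trans ?_
      have e1 : polyWeight γ s ≤ 2 := by
        refine hws.trans (le_trans ?_ h2γ)
        exact Real.rpow_le_rpow (by positivity) (by linarith) hγ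
      have e2 : |h| ≤ |h| ^ γ := by
        rcases (abs_nonneg h).eq_or_lt with h0 | h0
        · rw [← h0]; positivity
        · calc |h| = |h| ^ (1 : ℝ) := (Real.rpow_one _).symm
            _ ≤ _ := Real.rpow_le_rpow_of_exponent_ge h0 h1 hγ1
      have e3 : |s| * polyWeight γ s ≤ |h| ^ γ * 2 :=
        mul_le_mul (hsh.trans e2) e1 (polyWeight_pos _ _).le (by positivity)
      have := mul_le_mul_of_nonneg_left e3 hMx
      have : 0 ≤ M * polyWeight γ x * |h| ^ γ := by positivity
      nlinarith
    · have e1 : polyWeight γ s ≤ 2 * |h| ^ γ := by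
        calc polyWeight γ s ≤ (2 * |h|) ^ γ :=
              hws.trans (Real.rpow_le_rpow (by positivity) (by linarith) hγ)
          _ = 2 ^ γ * |h| ^ γ := Real.mul_rpow (by norm_num) (abs_nonneg _)
          _ ≤ _ := by gcongr
      have e2 : 1 ≤ |h| ^ γ := Real.one_le_rpow h1 hγ
      have e3 := abs_comp_add_le hγ hg.deriv_bound x s
      have e4 := hg.deriv_bound x
      have e5 := mul_le_mul_of_nonneg_left e1 hMx
      have e6 := mul_le_mul_of_nonneg_left e2 hMx
      have := abs_sub (deriv g (x + s)) (deriv g x)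
      linarith
  have := (convex_uIcc (0 : ℝ) h).norm_image_sub_le_of_norm_hasDerivWithin_le
    (fun s hs => (hd s hs).hasDerivWithinAt) hbd Set.left_mem_uIcc Set.right_mem_uIcc
  simp only [add_zero, mul_zero, sub_zero, Real.norm_eq_abs] at this
  rw [sub_right_comm] at this
  refine this.trans ?_
  rcases (abs_nonneg h).eq_or_lt with h0 | h0
  · rw [← h0]; simp [Real.zero_rpow (by linarith : 1 + γ ≠ 0)]
  · rw [Real.rpow_add h0, Real.rpow_one]
    exact le_of_eq (by ring)

end SmoothGrowth

/-- Averaging over `ν` turns measurable functions of growth at most `A (1 + |x|) ^ γ` into smooth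
functions. -/
def IsSmoothing (γ M : ℝ) (ν : Measure ℝ) : Prop :=
  ∀ (H : ℝ → ℝ) (A : ℝ), Measurable H → (∀ x, |H x| ≤ A * polyWeight γ x) →
    SmoothGrowth γ (A * M) (avg ν H)

namespace IsSmoothing

variable {γ M : ℝ} {ν ν' : Measure ℝ}

lemma conv [IsFiniteMeasure ν] [IsFiniteMeasure ν'] (hγ : 0 ≤ γ) (h : IsSmoothing γ M ν)
    (hw : Integrable (polyWeight γ) ν) (hw' : Integrable (polyWeight γ) ν') {B : ℝ}
    (hB : ∫ z, polyWeight γ z ∂ν' ≤ B) : IsSmoothing γ (M * B) (ν ∗ ν') := by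
  intro H A hH hA
  rw [avg_conv hγ hH hA hw hw', ← mul_assoc]
  exact (h H A hH hA).averaged hγ hw' hB

/-- Averaging H over cZ at x is averaging H(c ·) over Z at x/c, so the claim is a change of
variables combined with the chain rule. -/
lemma map_mul (hγ : 0 ≤ γ) (h : IsSmoothing γ M ν) {c : ℝ} (hc : c ≠ 0) :
    ∃ M', IsSmoothing γ M' (ν.map (fun x => c * x)) := by
  -- D dominates both the weight of c⁻¹ and that weight times |c⁻¹|. The square is forced by the
  -- Lipschitz bound, where the chain rule produces c⁻¹ twice and the weight of c⁻¹ twice.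
  set D := polyWeight γ c⁻¹ * (1 + |c⁻¹|) with hD
  refine ⟨polyWeight γ c * M * D ^ 2, fun H A hH hA => ?_⟩
  have hA0 := nonneg_of_growth hA
  have hH' : Measurable fun y => H (c * y) := hH.comp (measurable_const_mul c)
  have hA' : ∀ y, |H (c * y)| ≤ A * polyWeight γ c * polyWeight γ y := fun y => by
    rw [mul_assoc]
    exact (hA _).trans (mul_le_mul_of_nonneg_left (polyWeight_mul_le hγ c y) hA0)
  have hg := h _ _ hH' hA'
  set g := avg ν fun y => H (c * y) with hgdef
  have e : avg (ν.map fun x => c * x) H = fun x => g (c⁻¹ * x) := by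
    ext x
    have hHx : Measurable fun z => H (x + z) := hH.comp (measurable_const_add x)
    rw [avg, integral_map (measurable_const_mul c).aemeasurable hHx.aestronglyMeasurable]
    simp only [hgdef, avg]
    congr 1
    ext y
    congr 1
    field_simp
  have hder : ∀ x, HasDerivAt (fun x => g (c⁻¹ * x)) (c⁻¹ * deriv g (c⁻¹ * x)) x := fun x => by
    have h1 := (hg.differentiable (c⁻¹ * x)).hasDerivAt
    have h2 : HasDerivAt (fun x : ℝ => c⁻¹ * x) c⁻¹ x := by
      simpa using (hasDerivAt_id x).const_mul c⁻¹
    have := h1.comp x h2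
    rwa [mul_comm] at this
  have hder' : deriv (fun x => g (c⁻¹ * x)) = fun x => c⁻¹ * deriv g (c⁻¹ * x) :=
    funext fun x => (hder x).deriv
  have hN := hg.nonneg
  set N := A * polyWeight γ c * M with hNdef
  have hw1 := one_le_polyWeight hγ c⁻¹
  have hc1 := abs_nonneg c⁻¹
  have hD1 : 1 ≤ D := by rw [hD]; nlinarith
  have hDw : polyWeight γ c⁻¹ ≤ D := by rw [hD]; nlinarith
  have hDc : polyWeight γ c⁻¹ * |c⁻¹| ≤ D := by rw [hD]; nlinarith
  have hw : ∀ x, polyWeight γ (c⁻¹ * x) ≤ polyWeight γ c⁻¹ * polyWeight γ x :=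
    fun x => polyWeight_mul_le hγ _ _
  have eN : A * (polyWeight γ c * M * D ^ 2) = N * D ^ 2 := by rw [hNdef]; ring
  rw [e, eN]
  refine ⟨fun x => (hder x).differentiableAt, fun x => ?_, fun x => ?_, fun x k => ?_⟩
  · refine (hg.bound _).trans ?_
    rw [mul_assoc N]
    refine mul_le_mul_of_nonneg_left ((hw x).trans (mul_le_mul_of_nonneg_right ?_
      (polyWeight_pos _ _).le)) hN
    nlinarith
  · rw [hder']
    simp only [abs_mul]
    have h1 := (hg.deriv_bound (c⁻¹ * x)).trans (mul_le_mul_of_nonneg_left (hw x) hN)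
    have h2 := mul_le_mul_of_nonneg_left h1 hc1
    refine h2.trans ?_
    have h3 : N * (polyWeight γ c⁻¹ * |c⁻¹|) * polyWeight γ x ≤ N * D ^ 2 * polyWeight γ x :=
      mul_le_mul_of_nonneg_right (mul_le_mul_of_nonneg_left (by nlinarith) hN)
        (polyWeight_pos _ _).le
    linarith
  · rw [hder']
    simp only
    rw [← mul_sub, abs_mul, mul_add]
    have h1 := mul_le_mul_of_nonneg_left (hg.deriv_lipschitz (c⁻¹ * x) (c⁻¹ * k)) hc1
    refine h1.trans ?_
    have hwk := polyWeight_pos γ k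
    have hwx := polyWeight_pos γ x
    have hcpos := polyWeight_pos γ c⁻¹
    calc |c⁻¹| * (N * (|c⁻¹ * k| * polyWeight γ (c⁻¹ * k) * polyWeight γ (c⁻¹ * x)))
        ≤ |c⁻¹| * (N * (|c⁻¹ * k| * (polyWeight γ c⁻¹ * polyWeight γ k) *
            (polyWeight γ c⁻¹ * polyWeight γ x))) := by
          refine mul_le_mul_of_nonneg_left (mul_le_mul_of_nonneg_left (mul_le_mul
            (mul_le_mul_of_nonneg_left (hw k) (abs_nonneg _)) (hw x) (polyWeight_pos _ _).le
            ?_) hN) hc1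
          positivity
      _ = N * (polyWeight γ c⁻¹ * |c⁻¹|) ^ 2 * (|k| * polyWeight γ k * polyWeight γ x) := by
          rw [abs_mul]; ring
      _ ≤ _ := by
          refine mul_le_mul_of_nonneg_right (mul_le_mul_of_nonneg_left ?_ hN) (by positivity)
          exact pow_le_pow_left₀ (by positivity) hDc 2

end IsSmoothing

/-! ### Smoothing by a law with a regular density. -/

section Density

lemma integrable_one_add_abs_rpow {s : ℝ} (hs : s < -1) :
    Integrable fun x : ℝ => (1 + |x|) ^ s := by
  have := integrable_one_add_norm (E := ℝ) (μ := volume) (r := -s) (by simp; linarith)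
  simpa using this

lemma integral_withDensity_ofReal {K : ℝ → ℝ} (hK : Measurable K) (hK0 : ∀ᵐ x, 0 ≤ K x)
    (F : ℝ → ℝ) :
    ∫ x, F x ∂(volume.withDensity fun x => ENNReal.ofReal (K x)) = ∫ x, F x * K x := by
  rw [integral_withDensity_eq_integral_toReal_smul hK.ennreal_ofReal
    (ae_of_all _ fun _ => ENNReal.ofReal_lt_top)]
  refine integral_congr_ae ?_
  filter_upwards [hK0] with x hx
  rw [ENNReal.toReal_ofReal hx, smul_eq_mul, mul_comm]

lemma integrable_withDensity_ofReal {K : ℝ → ℝ} (hK : Measurable K) (hK0 : ∀ᵐ x, 0 ≤ K x)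
    {F : ℝ → ℝ} (hF : Integrable F (volume.withDensity fun x => ENNReal.ofReal (K x))) :
    Integrable (fun x => F x * K x) := by
  rw [integrable_withDensity_iff_integrable_smul' hK.ennreal_ofReal
    (ae_of_all _ fun _ => ENNReal.ofReal_lt_top)] at hF
  refine hF.congr ?_
  filter_upwards [hK0] with x hx
  rw [ENNReal.toReal_ofReal hx, smul_eq_mul, mul_comm]

lemma one_add_abs_rpow_neg_le {q : ℝ} (hq : 0 ≤ q) {x y : ℝ} (h : |x - y| ≤ 1) :
    (1 + |x|) ^ (-q) ≤ 2 ^ q * (1 + |y|) ^ (-q) := by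
  have h1 : (1 + |y|) / 2 ≤ 1 + |x| := by
    have := abs_sub_abs_le_abs_sub y x
    rw [abs_sub_comm] at this
    linarith [abs_nonneg x, abs_nonneg y]
  calc (1 + |x|) ^ (-q) ≤ ((1 + |y|) / 2) ^ (-q) :=
        Real.rpow_le_rpow_of_nonpos (by positivity) h1 (by linarith)
    _ = _ := by
      rw [Real.div_rpow (by positivity) (by norm_num), Real.rpow_neg (by norm_num : (0:ℝ) ≤ 2)]
      field_simp

/-- Averaging over a law whose density has a derivative with polynomial decay and locally
Lipschitz is smoothing. -/
lemma isSmoothing_withDensity {K k : ℝ → ℝ} {C q γ : ℝ} (hγ : 0 ≤ γ) (hq : γ + 1 < q)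
    (hK : ∀ x, HasDerivAt K (k x) x) (hK0 : ∀ᵐ x, 0 ≤ K x)
    (hk : ∀ x, |k x| ≤ C * (1 + |x|) ^ (-q))
    (hkl : ∀ x y, |x - y| < 1 → |k x - k y| ≤ C * (|x - y| * (1 + |x|) ^ (-q)))
    (hw : Integrable (polyWeight γ) (volume.withDensity fun x => ENNReal.ofReal (K x))) :
    ∃ M, IsSmoothing γ M (volume.withDensity fun x => ENNReal.ofReal (K x)) := by
  set ν := volume.withDensity fun x => ENNReal.ofReal (K x) with hν
  have hKm : Measurable K :=
    (continuous_iff_continuousAt.2 fun x => (hK x).continuousAt).measurable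
  have hkm : Measurable k := by
    rw [show k = deriv K from funext fun x => (hK x).deriv.symm]
    exact measurable_deriv K
  have hC : 0 ≤ C := by simpa using (abs_nonneg _).trans (hk 0)
  set J := ∫ z : ℝ, (1 + |z|) ^ (γ - q) with hJ
  have hJint : Integrable fun z : ℝ => (1 + |z|) ^ (γ - q) :=
    integrable_one_add_abs_rpow (by linarith)
  have hJ0 : 0 ≤ J := integral_nonneg fun z => by positivity
  have hwq : ∀ z : ℝ, polyWeight γ z * (1 + |z|) ^ (-q) = (1 + |z|) ^ (γ - q) := fun z => by
    rw [polyWeight, ← Real.rpow_add (by positivity), sub_eq_add_neg]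
  set W := ∫ z, polyWeight γ z ∂ν with hW
  have hW0 : 0 ≤ W := integral_nonneg fun z => (polyWeight_pos _ _).le
  -- W bounds the average itself and C J its derivative. The factor 2 serves the Lipschitz bound at
  -- distance at least 1, obtained from two derivative bounds.
  refine ⟨W + 2 * C * J, fun H A hH hA => ?_⟩
  have hA0 := nonneg_of_growth hA
  have hHx : ∀ x, Measurable fun z => H (x + z) := fun x => hH.comp (measurable_const_add x)
  -- The translation is moved from H to the density, so that the derivative falls on K and nothing
  -- is required of H beyond measurability and growth.
  have eK : ∀ x, avg ν H x = ∫ y, H y * K (y - x) := by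
    intro x
    rw [avg, hν, integral_withDensity_ofReal hKm hK0,
      ← integral_add_left_eq_self (fun y => H y * K (y - x)) x]
    simp
  have hd0 : ∀ x y : ℝ, |H (x + y) * k y| ≤ A * C * polyWeight γ x * (1 + |y|) ^ (γ - q) := by
    intro x y
    rw [abs_mul]
    calc _ ≤ (A * polyWeight γ x * polyWeight γ y) * (C * (1 + |y|) ^ (-q)) :=
          mul_le_mul (abs_comp_add_le hγ hA x y) (hk y) (abs_nonneg _)
            (mul_nonneg (mul_nonneg hA0 (polyWeight_pos _ _).le) (polyWeight_pos _ _).le)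
      _ = _ := by rw [← hwq]; ring
  have hdi : ∀ x, Integrable fun y => H (x + y) * k y := fun x =>
    (hJint.const_mul (A * C * polyWeight γ x)).mono'
      ((hHx x).mul hkm).aestronglyMeasurable (ae_of_all _ (hd0 x))
  have hder : ∀ x, HasDerivAt (avg ν H) (-∫ y, H (x + y) * k y) x := by
    intro x
    have h1 := (hasDerivAt_integral_of_dominated_loc_of_deriv_le (μ := volume) (𝕜 := ℝ)
      (F := fun x y => H y * K (y - x)) (F' := fun x y => -(H y * k (y - x)))
      (s := Metric.ball x 1) (x₀ := x)
      (bound := fun y => A * C * polyWeight γ x * 2 ^ q * (1 + |y - x|) ^ (γ - q))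
      (Metric.ball_mem_nhds x one_pos) ?_ ?_ ?_ ?_ ?_ ?_).2
    · have e : ∫ y, -(H y * k (y - x)) = -∫ y, H (x + y) * k y := by
        rw [integral_neg, ← integral_add_left_eq_self (fun y => H y * k (y - x)) x]
        simp
      rw [e] at h1
      exact h1.congr_of_eventuallyEq (Eventually.of_forall eK)
    · exact Eventually.of_forall fun y =>
        (hH.mul (hKm.comp (measurable_sub_const y))).aestronglyMeasurable
    · have h2 := integrable_withDensity_ofReal hKm hK0 (integrable_comp_add hγ hH hA hw x)
      have h3 := h2.comp_sub_right x
      simpa using h3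
    · exact (hH.mul (hkm.comp (measurable_sub_const x))).neg.aestronglyMeasurable
    · refine ae_of_all _ fun y x' hx' => ?_
      have h2 := abs_comp_add_le hγ hA x (y - x)
      rw [add_sub_cancel] at h2
      have h3 : |(y - x') - (y - x)| ≤ 1 := by
        have := (Metric.mem_ball.1 hx').le
        rw [Real.dist_eq, abs_sub_comm] at this
        rwa [sub_sub_sub_cancel_left]
      have h4 := (hk (y - x')).trans (mul_le_mul_of_nonneg_left
        (one_add_abs_rpow_neg_le (by linarith : 0 ≤ q) h3) hC)
      rw [norm_neg, Real.norm_eq_abs, abs_mul]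
      calc _ ≤ (A * polyWeight γ x * polyWeight γ (y - x)) *
            (C * (2 ^ q * (1 + |y - x|) ^ (-q))) :=
          mul_le_mul h2 h4 (abs_nonneg _)
            (mul_nonneg (mul_nonneg hA0 (polyWeight_pos _ _).le) (polyWeight_pos _ _).le)
        _ = _ := by rw [← hwq]; ring
    · exact (hJint.comp_sub_right x).const_mul _
    · refine ae_of_all _ fun y x' _ => ?_
      have h2 : HasDerivAt (fun x => y - x) (-1) x' := by
        simpa using (hasDerivAt_id x').const_sub y
      have h3 := ((hK (y - x')).comp x' h2).const_mul (H y)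
      simpa using h3
  have hder' : deriv (avg ν H) = fun x => -∫ y, H (x + y) * k y :=
    funext fun x => (hder x).deriv
  have hdb : ∀ x, |deriv (avg ν H) x| ≤ A * C * J * polyWeight γ x := by
    intro x
    rw [hder']
    simp only [abs_neg]
    calc _ ≤ ∫ y, A * C * polyWeight γ x * (1 + |y|) ^ (γ - q) := by
          rw [← Real.norm_eq_abs]
          exact norm_integral_le_of_norm_le (hJint.const_mul _) (ae_of_all _ (hd0 x))
      _ = _ := by rw [integral_const_mul]; ring
  have hACJ : 0 ≤ A * C * J := by positivity
  refine ⟨fun x => (hder x).differentiableAt, fun x => ?_, fun x => ?_, fun x h => ?_⟩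
  · refine (abs_avg_le hγ hA hw le_rfl x).trans (mul_le_mul_of_nonneg_right ?_
      (polyWeight_pos _ _).le)
    nlinarith
  · refine (hdb x).trans (mul_le_mul_of_nonneg_right ?_ (polyWeight_pos _ _).le)
    nlinarith
  · have hwx := polyWeight_pos γ x
    have hwh := one_le_polyWeight hγ h
    have hh := abs_nonneg h
    have hcoef : 2 * (A * C * J) ≤ A * (W + 2 * C * J) := by nlinarith
    -- For |h| < 1 the shift h is moved onto k, where the local Lipschitz hypothesis applies; for
    -- |h| ≥ 1 the triangle inequality suffices because the factor |h| is then at least 1.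
    rcases lt_or_ge |h| 1 with h1 | h1
    · rw [hder']
      simp only
      have e : ∫ y, H (x + h + y) * k y = ∫ y, H (x + y) * k (y - h) := by
        rw [← integral_sub_right_eq_self (fun y => H (x + h + y) * k y) h]
        congr 1; ext y; congr 2; ring
      have hdi' : Integrable fun y => H (x + y) * k (y - h) := by
        have := (hdi (x + h)).comp_sub_right h
        refine this.congr (ae_of_all _ fun y => ?_)
        simp only
        congr 2; ring
      rw [e, neg_sub_neg, ← integral_sub (hdi x) hdi']
      calc _ ≤ ∫ y, A * C * polyWeight γ x * |h| * (1 + |y|) ^ (γ - q) := by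
            rw [← Real.norm_eq_abs]
            refine norm_integral_le_of_norm_le (hJint.const_mul _) (ae_of_all _ fun y => ?_)
            rw [← mul_sub, Real.norm_eq_abs, abs_mul]
            have h2 := hkl y (y - h) (by simpa using h1)
            rw [sub_sub_cancel] at h2
            calc _ ≤ (A * polyWeight γ x * polyWeight γ y) *
                  (C * (|h| * (1 + |y|) ^ (-q))) :=
                mul_le_mul (abs_comp_add_le hγ hA x y) h2 (abs_nonneg _)
                  (mul_nonneg (mul_nonneg hA0 hwx.le) (polyWeight_pos _ _).le)
              _ = _ := by rw [← hwq]; ring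
        _ = A * C * J * (|h| * 1 * polyWeight γ x) := by rw [integral_const_mul]; ring
        _ ≤ _ := by
          refine mul_le_mul (by linarith) ?_ (by positivity) (by linarith)
          gcongr
    · have h2 := hdb (x + h)
      have h3 := hdb x
      have h4 := mul_le_mul_of_nonneg_left (polyWeight_add_le hγ x h) hACJ
      have h5 := abs_sub (deriv (avg ν H) (x + h)) (deriv (avg ν H) x)
      have h6 : 1 ≤ |h| * polyWeight γ h := by nlinarith
      have h7 : polyWeight γ h ≤ |h| * polyWeight γ h := by nlinarith
      have h8 : A * C * J * (polyWeight γ x * polyWeight γ h) ≤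
          A * C * J * (|h| * polyWeight γ h * polyWeight γ x) :=
        mul_le_mul_of_nonneg_left (by nlinarith) hACJ
      have h9 : A * C * J * polyWeight γ x ≤ A * C * J * (|h| * polyWeight γ h * polyWeight γ x) :=
        mul_le_mul_of_nonneg_left (by nlinarith) hACJ
      calc _ ≤ 2 * (A * C * J) * (|h| * polyWeight γ h * polyWeight γ x) := by linarith
        _ ≤ _ := mul_le_mul_of_nonneg_right hcoef (by positivity)

/-- A law with continuously differentiable distribution function has density `lawDensity`. -/
lemma eq_withDensity_lawDensity {μ : Measure ℝ} [IsProbabilityMeasure μ]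
    (h : ContDiff ℝ 1 fun x => cdf μ x) :
    μ = volume.withDensity fun x => ENNReal.ofReal (lawDensity μ x) := by
  have hcont : Continuous (lawDensity μ) := h.continuous_deriv le_rfl
  have h0 : ∀ x, 0 ≤ lawDensity μ x := fun x => (monotone_cdf μ).deriv_nonneg
  refine Measure.ext_of_Ioc _ _ fun a b hab => ?_
  rw [withDensity_apply _ measurableSet_Ioc]
  conv_lhs => rw [← measure_cdf μ]
  rw [StieltjesFunction.measure_Ioc,
    ← ofReal_integral_eq_lintegral_ofReal (hcont.integrableOn_Ioc) (ae_of_all _ h0),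
    ← intervalIntegral.integral_of_le hab.le, lawDensity,
    intervalIntegral.integral_deriv_eq_sub (fun x _ => (h.differentiable one_ne_zero) x)
      (hcont.intervalIntegrable a b)]

/-- A single innovation smooths: the derivative of its density decays with exponent α, and γ < α - 1
is exactly what makes its product with the weight integrable. -/
lemma HeavyTailRegime.exists_isSmoothing {μ : Measure ℝ} [IsProbabilityMeasure μ]
    (h : HeavyTailRegime μ) (hF : ContDiff ℝ 2 fun x => cdf μ x) {γ : ℝ} (hγ : 0 ≤ γ)
    (hγα : γ < tailExponent μ - 1) (hw : Integrable (polyWeight γ) μ) :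
    ∃ M, IsSmoothing γ M μ := by
  obtain ⟨-, -, -, C, -, hC1, hC2⟩ := h
  have hμ := eq_withDensity_lawDensity (hF.of_le (by norm_num))
  have hd : Differentiable ℝ (lawDensity μ) := by
    have : ContDiff ℝ 1 (lawDensity μ) := (contDiff_succ_iff_deriv (n := 1).1 hF).2.2
    exact this.differentiable one_ne_zero
  have h0 : ∀ x, 0 ≤ lawDensity μ x := fun x => (monotone_cdf μ).deriv_nonneg
  rw [hμ] at hw
  have := isSmoothing_withDensity hγ (by linarith : γ + 1 < tailExponent μ)
    (fun x => (hd x).hasDerivAt) (ae_of_all _ h0) hC1 hC2 hw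
  rwa [← hμ] at this

end Density

/-! ### Laws of finite blocks. -/

/-- The law of `∑_{i < n} a_i ξ_i` for independent `ξ_i` with law `μ`. -/
noncomputable def blockLaw (μ : Measure ℝ) (a : ℕ → ℝ) : ℕ → Measure ℝ
  | 0 => Measure.dirac 0
  | n + 1 => blockLaw μ a n ∗ μ.map (fun x => a n * x)

section BlockLaw


variable {μ : Measure ℝ} [IsProbabilityMeasure μ]

instance (c : ℝ) : IsProbabilityMeasure (μ.map (fun x => c * x)) :=
  Measure.isProbabilityMeasure_map (by fun_prop)

instance (a : ℕ → ℝ) (n : ℕ) : IsProbabilityMeasure (blockLaw μ a n) := by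
  induction n with
  | zero => rw [blockLaw]; infer_instance
  | succ n ih => rw [blockLaw]; infer_instance

lemma integrable_polyWeight_map_mul {γ : ℝ} (hγ : 0 ≤ γ) (hw : Integrable (polyWeight γ) μ)
    (c : ℝ) : Integrable (polyWeight γ) (μ.map (fun x => c * x)) := by
  rw [integrable_map_measure (measurable_polyWeight γ).aestronglyMeasurable (by fun_prop)]
  refine (hw.const_mul (polyWeight γ c)).mono'
    ((measurable_polyWeight γ).comp (by fun_prop)).aestronglyMeasurable (ae_of_all _ fun x => ?_)
  rw [Function.comp_apply, Real.norm_eq_abs, abs_of_pos (polyWeight_pos _ _)]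
  exact polyWeight_mul_le hγ c x

lemma integrable_polyWeight_blockLaw {γ : ℝ} (hγ : 0 ≤ γ) (hw : Integrable (polyWeight γ) μ)
    (a : ℕ → ℝ) (n : ℕ) : Integrable (polyWeight γ) (blockLaw μ a n) := by
  induction n with
  | zero => rw [blockLaw]; exact integrable_dirac (by simp)
  | succ n ih =>
    exact integrable_polyWeight_conv hγ ih (integrable_polyWeight_map_mul hγ hw _)

lemma blockLaw_add (a : ℕ → ℝ) (m n : ℕ) :
    blockLaw μ a (m + n) = blockLaw μ a m ∗ blockLaw μ (fun i => a (i + m)) n := by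
  induction n with
  | zero => simp [blockLaw]
  | succ n ih =>
    rw [← add_assoc, blockLaw, ih, blockLaw, Measure.conv_assoc, add_comm n m]

end BlockLaw

/-! ### Smoothing through decay of characteristic functions. -/

section Fourier

open scoped FourierTransform

/-- `C²` functions for which `ψ`, `ψ'`, `ψ''` decay with exponents `p`, `p - δ`, `p - 2δ`. -/
structure FourierDecay (δ p C : ℝ) (ψ : ℝ → ℂ) : Prop where
  contDiff : ContDiff ℝ 2 ψ
  bound : ∀ s, ‖ψ s‖ ≤ C * (1 + |s|) ^ (-p)
  bound' : ∀ s, ‖deriv ψ s‖ ≤ C * (1 + |s|) ^ (-(p - δ))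
  bound'' : ∀ s, ‖deriv (deriv ψ) s‖ ≤ C * (1 + |s|) ^ (-(p - 2 * δ))

/-- By Leibniz' rule the exponents add, since each derivative costs δ whichever factor it hits; 4
counts the terms of the second derivative. The cost δ is chosen so that one characteristic function
qualifies with p = δ: the required exponents are then δ, 0 and -δ, and the last two follow from
boundedness of the derivatives under finite variance. -/
lemma FourierDecay.mul {δ p q C D : ℝ} {ψ φ : ℝ → ℂ} (h : FourierDecay δ p C ψ)
    (h' : FourierDecay δ q D φ) : FourierDecay δ (p + q) (4 * C * D) (fun s => ψ s * φ s) := by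
  have hC : 0 ≤ C := by simpa using (norm_nonneg _).trans (h.bound 0)
  have hD : 0 ≤ D := by simpa using (norm_nonneg _).trans (h'.bound 0)
  have d1 : Differentiable ℝ ψ := h.contDiff.differentiable two_ne_zero
  have d2 : Differentiable ℝ φ := h'.contDiff.differentiable two_ne_zero
  have d1' : Differentiable ℝ (deriv ψ) := by
    have : ContDiff ℝ 1 (deriv ψ) := (contDiff_succ_iff_deriv (n := 1).1 h.contDiff).2.2
    exact this.differentiable one_ne_zero
  have d2' : Differentiable ℝ (deriv φ) := by
    have : ContDiff ℝ 1 (deriv φ) := (contDiff_succ_iff_deriv (n := 1).1 h'.contDiff).2.2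
    exact this.differentiable one_ne_zero
  have e1 : deriv (fun s => ψ s * φ s) = fun s => deriv ψ s * φ s + ψ s * deriv φ s :=
    funext fun s => ((d1 s).hasDerivAt.mul (d2 s).hasDerivAt).deriv
  have e2 : deriv (deriv (fun s => ψ s * φ s)) = fun s => (deriv (deriv ψ) s * φ s +
      deriv ψ s * deriv φ s) + (deriv ψ s * deriv φ s + ψ s * deriv (deriv φ) s) := by
    rw [e1]
    exact funext fun s => (((d1' s).hasDerivAt.mul (d2 s).hasDerivAt).add
      ((d1 s).hasDerivAt.mul (d2' s).hasDerivAt)).deriv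
  have key : ∀ (s a b c : ℝ) (u v : ℂ), a + b = c → ‖u‖ ≤ C * (1 + |s|) ^ a →
      ‖v‖ ≤ D * (1 + |s|) ^ b → ‖u * v‖ ≤ C * D * (1 + |s|) ^ c := by
    intro s a b c u v hab hu hv
    rw [norm_mul]
    calc _ ≤ (C * (1 + |s|) ^ a) * (D * (1 + |s|) ^ b) :=
          mul_le_mul hu hv (norm_nonneg _) (by positivity)
      _ = C * D * ((1 + |s|) ^ a * (1 + |s|) ^ b) := by ring
      _ = _ := by rw [← Real.rpow_add (by positivity), hab]
  have hCD : 0 ≤ C * D := mul_nonneg hC hD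
  refine ⟨h.contDiff.mul h'.contDiff, fun s => ?_, fun s => ?_, fun s => ?_⟩
  · have := key s _ _ (-(p + q)) _ _ (by ring) (h.bound s) (h'.bound s)
    have h0 : 0 ≤ C * D * (1 + |s|) ^ (-(p + q)) := by positivity
    nlinarith
  · rw [e1]
    have t1 := key s _ _ (-(p + q - δ)) _ _ (by ring) (h.bound' s) (h'.bound s)
    have t2 := key s _ _ (-(p + q - δ)) _ _ (by ring) (h.bound s) (h'.bound' s)
    have h0 : 0 ≤ C * D * (1 + |s|) ^ (-(p + q - δ)) := by positivity
    have := norm_add_le (deriv ψ s * φ s) (ψ s * deriv φ s)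
    simp only
    linarith
  · rw [e2]
    have t1 := key s _ _ (-(p + q - 2 * δ)) _ _ (by ring) (h.bound'' s) (h'.bound s)
    have t2 := key s _ _ (-(p + q - 2 * δ)) _ _ (by ring) (h.bound' s) (h'.bound' s)
    have t3 := key s _ _ (-(p + q - 2 * δ)) _ _ (by ring) (h.bound s) (h'.bound'' s)
    have h0 : 0 ≤ C * D * (1 + |s|) ^ (-(p + q - 2 * δ)) := by positivity
    have n1 := norm_add_le (deriv (deriv ψ) s * φ s + deriv ψ s * deriv φ s)
      (deriv ψ s * deriv φ s + ψ s * deriv (deriv φ) s)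
    have n2 := norm_add_le (deriv (deriv ψ) s * φ s) (deriv ψ s * deriv φ s)
    have n3 := norm_add_le (deriv ψ s * deriv φ s) (ψ s * deriv (deriv φ) s)
    simp only
    linarith

lemma norm_iteratedDeriv_charFun_le {μ : Measure ℝ} [IsFiniteMeasure μ] {n : ℕ}
    (h : MemLp id n μ) (s : ℝ) :
    ‖iteratedDeriv n (charFun μ) s‖ ≤ ∫ x, |x| ^ n ∂μ := by
  rw [iteratedDeriv_charFun h, norm_mul, norm_pow, Complex.norm_I, one_pow, one_mul]
  refine norm_integral_le_of_norm_le ?_ (ae_of_all _ fun x => ?_)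
  · simpa using h.integrable_norm_pow'
  · rw [norm_mul, norm_pow, Complex.norm_real, Real.norm_eq_abs, ← Complex.ofReal_mul,
      Complex.norm_exp_ofReal_mul_I, mul_one]

/-- The characteristic function of `c ξ`, for `ξ` with finite variance. -/
lemma fourierDecay_charFun {μ : Measure ℝ} [IsProbabilityMeasure μ] (h2 : MemLp id 2 μ) {δ C : ℝ}
    (hδ : 0 ≤ δ) (hC : ∀ s : ℝ, (1 + |s|) ^ δ * ‖charFun μ s‖ ≤ C) {c : ℝ} (hc : c ≠ 0) :
    ∃ D, FourierDecay δ δ D (charFun (μ.map (fun x => c * x))) := by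
  have hν2 : MemLp id 2 (μ.map (fun x => c * x)) := by
    rw [memLp_map_measure_iff (by fun_prop) (by fun_prop)]
    exact h2.const_mul c
  have hν1 : MemLp id 1 (μ.map (fun x => c * x)) := hν2.mono_exponent (by norm_num)
  set ν := μ.map (fun x => c * x)
  have hcd : ContDiff ℝ 2 (charFun ν) := contDiff_charFun (n := 2) (by exact_mod_cast hν2)
  have b1 := norm_iteratedDeriv_charFun_le (μ := ν) (n := 1) (by exact_mod_cast hν1)
  have b2 := norm_iteratedDeriv_charFun_le (μ := ν) (n := 2) (by exact_mod_cast hν2)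
  rw [iteratedDeriv_one] at b1
  rw [iteratedDeriv_succ, iteratedDeriv_one] at b2
  set m1 := ∫ x, |x| ^ 1 ∂ν
  set m2 := ∫ x, |x| ^ 2 ∂ν
  have hm1 : 0 ≤ m1 := integral_nonneg fun x => by positivity
  have hm2 : 0 ≤ m2 := integral_nonneg fun x => by positivity
  have hC0 : 0 ≤ C := le_trans (by positivity) (hC 0)
  set w := polyWeight δ c⁻¹
  have hw : 0 < w := polyWeight_pos _ _
  have hD : 0 ≤ C * w := by positivity
  refine ⟨C * w + m1 + m2, hcd, fun s => ?_, fun s => ?_, fun s => ?_⟩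
  · have h1 : (1 + |s|) ^ δ ≤ w * (1 + |c * s|) ^ δ := by
      have := polyWeight_mul_le hδ c⁻¹ (c * s)
      rwa [inv_mul_cancel_left₀ hc] at this
    have h3 := hC (c * s)
    have e : charFun ν s = charFun μ (c * s) := charFun_map_mul c s
    rw [e, Real.rpow_neg (by positivity), ← div_eq_mul_inv, le_div_iff₀ (by positivity)]
    have h4 : ‖charFun μ (c * s)‖ * (1 + |s|) ^ δ ≤
        ‖charFun μ (c * s)‖ * (w * (1 + |c * s|) ^ δ) :=
      mul_le_mul_of_nonneg_left h1 (norm_nonneg _)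
    have h5 := mul_le_mul_of_nonneg_left h3 hw.le
    linarith
  · have := b1 s
    simp only [sub_self, neg_zero, Real.rpow_zero, mul_one]
    linarith
  · have h1 : (1 : ℝ) ≤ (1 + |s|) ^ (-(δ - 2 * δ)) :=
      Real.one_le_rpow (by linarith [abs_nonneg s]) (by linarith)
    have h3 : (C * w + m1 + m2) * 1 ≤ (C * w + m1 + m2) * (1 + |s|) ^ (-(δ - 2 * δ)) :=
      mul_le_mul_of_nonneg_left h1 (by linarith)
    have := b2 s
    linarith

lemma fourierDecay_blockLaw {μ : Measure ℝ} [IsProbabilityMeasure μ] (h2 : MemLp id 2 μ)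
    {δ C : ℝ} (hδ : 0 ≤ δ) (hC : ∀ s : ℝ, (1 + |s|) ^ δ * ‖charFun μ s‖ ≤ C) {a : ℕ → ℝ}
    (ha : ∀ i, a i ≠ 0) (n : ℕ) :
    ∃ D, FourierDecay δ ((n + 1) * δ) D (charFun (blockLaw μ a (n + 1))) := by
  induction n with
  | zero =>
    obtain ⟨D, hD⟩ := fourierDecay_charFun h2 hδ hC (ha 0)
    refine ⟨D, ?_⟩
    simpa [blockLaw] using hD
  | succ n ih =>
    obtain ⟨D, hD⟩ := ih
    obtain ⟨D', hD'⟩ := fourierDecay_charFun h2 hδ hC (ha (n + 1))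
    refine ⟨4 * D * D', ?_⟩
    have e : charFun (blockLaw μ a (n + 1 + 1)) = fun s =>
        charFun (blockLaw μ a (n + 1)) s * charFun (μ.map (fun x => a (n + 1) * x)) s := by
      ext s
      conv_lhs => rw [blockLaw]
      rw [charFun_conv]
    rw [e]
    convert hD.mul hD' using 1
    push_cast; ring

/-- Decay of the Fourier transform and of its first two derivatives. -/
lemma FourierDecay.fourier_bounds {δ p C : ℝ} (hδ : 0 ≤ δ) (hp : 4 + 2 * δ ≤ p) {ψ : ℝ → ℂ}
    (h : FourierDecay δ p C ψ) :
    ContDiff ℝ 2 (𝓕 ψ) ∧ Integrable ψ ∧ ∃ D, ∀ k ≤ 2, ∀ w : ℝ,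
      ‖iteratedDeriv k (𝓕 ψ) w‖ ≤ D * (1 + |w|) ^ (-(2 : ℝ)) := by
  have hC : 0 ≤ C := by simpa using (norm_nonneg _).trans (h.bound 0)
  -- Exponent 4 is what is needed: the factor |s|^k with k ≤ 2, which gives two derivatives of the
  -- Fourier transform, still leaves an integrable (1 + |s|)^(-2). Two derivatives of ψ give the
  -- quadratic decay of the transform.
  have hit : ∀ n ≤ 2, ∀ s, ‖iteratedDeriv n ψ s‖ ≤ C * (1 + |s|) ^ (-(4 : ℝ)) := by
    have key : ∀ s e : ℝ, 4 ≤ e → C * (1 + |s|) ^ (-e) ≤ C * (1 + |s|) ^ (-(4 : ℝ)) := fun s e he =>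
      mul_le_mul_of_nonneg_left (Real.rpow_le_rpow_of_exponent_le
        (by linarith [abs_nonneg s]) (by linarith)) hC
    intro n hn s
    interval_cases n
    · rw [iteratedDeriv_zero]; exact (h.bound s).trans (key s _ (by linarith))
    · rw [iteratedDeriv_one]; exact (h.bound' s).trans (key s _ (by linarith))
    · rw [iteratedDeriv_succ, iteratedDeriv_one]
      exact (h.bound'' s).trans (key s _ (by linarith))
  have hint : ∀ (k n : ℕ), (k : ℕ∞) ≤ 2 → (n : ℕ∞) ≤ 2 →
      Integrable fun v => ‖v‖ ^ k * ‖iteratedFDeriv ℝ n ψ v‖ := by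
    intro k n hk hn
    have hk' : k ≤ 2 := by exact_mod_cast hk
    have hn' : n ≤ 2 := by exact_mod_cast hn
    refine ((integrable_one_add_abs_rpow (s := -2) (by norm_num)).const_mul C).mono' ?_
      (ae_of_all _ fun s => ?_)
    · refine Continuous.aestronglyMeasurable ?_
      have := h.contDiff.continuous_iteratedFDeriv (m := n) (by exact_mod_cast hn')
      fun_prop
    · rw [norm_iteratedFDeriv_eq_norm_iteratedDeriv, Real.norm_eq_abs, abs_of_nonneg
        (by positivity), Real.norm_eq_abs]
      have h1 : |s| ^ k ≤ (1 + |s|) ^ (2 : ℝ) := by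
        calc |s| ^ k ≤ (1 + |s|) ^ k := pow_le_pow_left₀ (abs_nonneg _) (by linarith) _
          _ ≤ (1 + |s|) ^ 2 := pow_le_pow_right₀ (by linarith [abs_nonneg s]) hk'
          _ = _ := (Real.rpow_natCast _ 2).symm
      calc _ ≤ (1 + |s|) ^ (2 : ℝ) * (C * (1 + |s|) ^ (-(4 : ℝ))) :=
            mul_le_mul h1 (hit n hn' s) (norm_nonneg _) (by positivity)
        _ = C * ((1 + |s|) ^ (2 : ℝ) * (1 + |s|) ^ (-(4 : ℝ))) := by ring
        _ = _ := by rw [← Real.rpow_add (by positivity)]; norm_num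
  have hcd : ContDiff ℝ 2 (𝓕 ψ) := by
    refine Real.contDiff_fourier (N := 2) fun n hn => ?_
    simpa using hint n 0 hn (by simp)
  have hψi : Integrable ψ := by
    refine (integrable_norm_iff h.contDiff.continuous.aestronglyMeasurable).1 ?_
    simpa using hint 0 0 (by simp) (by simp)
  refine ⟨hcd, hψi, ?_⟩
  have hb : ∀ k n : ℕ, k ≤ 2 → n ≤ 2 → ∃ D, ∀ w : ℝ,
      ‖w‖ ^ n * ‖iteratedFDeriv ℝ k (𝓕 ψ) w‖ ≤ D := fun k n hk hn =>
    ⟨_, fun w => Real.pow_mul_norm_iteratedFDeriv_fourier_le (K := 2) (N := 2) h.contDiff hint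
      (by exact_mod_cast hk) (by exact_mod_cast hn) w⟩
  have hb2 : ∀ k : ℕ, k ≤ 2 → ∃ D, ∀ w : ℝ,
      ‖iteratedDeriv k (𝓕 ψ) w‖ ≤ D * (1 + |w|) ^ (-(2 : ℝ)) := by
    intro k hk
    obtain ⟨D0, h0⟩ := hb k 0 hk (by norm_num)
    obtain ⟨D2, h2⟩ := hb k 2 hk le_rfl
    refine ⟨2 * (D0 + D2), fun w => ?_⟩
    have h0 := h0 w
    have h2 := h2 w
    rw [norm_iteratedFDeriv_eq_norm_iteratedDeriv] at h0 h2
    rw [pow_zero, one_mul] at h0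
    rw [Real.norm_eq_abs] at h2
    rw [Real.rpow_neg (by positivity), ← div_eq_mul_inv, le_div_iff₀ (by positivity),
      show ((2 : ℝ)) = ((2 : ℕ) : ℝ) by norm_num, Real.rpow_natCast]
    push_cast
    have : (1 + |w|) ^ 2 ≤ 2 * (1 + |w| ^ 2) := by nlinarith [sq_nonneg (1 - |w|)]
    have := mul_le_mul_of_nonneg_left this (norm_nonneg (iteratedDeriv k (𝓕 ψ) w))
    nlinarith
  choose! D hD using hb2
  refine ⟨|D 0| + |D 1| + |D 2|, fun k hk w => (hD k hk w).trans
    (mul_le_mul_of_nonneg_right ?_ (by positivity))⟩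
  have n0 := abs_nonneg (D 0)
  have n1 := abs_nonneg (D 1)
  have n2 := abs_nonneg (D 2)
  have p0 := le_abs_self (D 0)
  have p1 := le_abs_self (D 1)
  have p2 := le_abs_self (D 2)
  interval_cases k <;> linarith

/-- A finite measure whose characteristic function is the Fourier transform of the integrable real
function `R` has density `R`, which is then nonnegative. -/
lemma eq_withDensity_of_charFun_eq {ν : Measure ℝ} [IsFiniteMeasure ν] {R : ℝ → ℝ}
    (hRm : Measurable R) (hR : Integrable R)
    (h : ∀ t, charFun ν t = ∫ x, (R x : ℂ) * Complex.exp (t * x * Complex.I)) :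
    (∀ᵐ x, 0 ≤ R x) ∧ ν = volume.withDensity fun x => ENNReal.ofReal (R x) := by
  set mp := volume.withDensity fun x => ENNReal.ofReal (R x) with hmp
  set mn := volume.withDensity fun x => ENNReal.ofReal (-R x) with hmn
  have : IsFiniteMeasure mp := isFiniteMeasure_withDensity_ofReal hR.2
  have : IsFiniteMeasure mn := isFiniteMeasure_withDensity_ofReal hR.neg.2
  have hE : ∀ t x : ℝ, ‖Complex.exp (t * x * Complex.I)‖ = 1 := fun t x => by
    rw [← Complex.ofReal_mul, Complex.norm_exp_ofReal_mul_I]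
  have hcf : ∀ f : ℝ → ℝ, Measurable f → ∀ t,
      charFun (volume.withDensity fun x => ENNReal.ofReal (f x)) t =
      ∫ x, ((max (f x) 0 : ℝ) : ℂ) * Complex.exp (t * x * Complex.I) := by
    intro f hf t
    rw [charFun_apply_real, integral_withDensity_eq_integral_toReal_smul hf.ennreal_ofReal
      (ae_of_all _ fun _ => ENNReal.ofReal_lt_top)]
    congr 1
  have hint : ∀ f : ℝ → ℝ, Integrable f → ∀ t : ℝ,
      Integrable fun x => ((max (f x) 0 : ℝ) : ℂ) * Complex.exp (t * x * Complex.I) := by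
    intro f hf t
    refine (hf.pos_part.ofReal (𝕜 := ℂ)).mono ?_ (ae_of_all _ fun x => ?_)
    · exact hf.pos_part.ofReal.aestronglyMeasurable.mul
        (Continuous.aestronglyMeasurable (by fun_prop))
    · rw [norm_mul, hE, mul_one]
      rfl
  -- Uniqueness of characteristic functions, after moving the negative part of R to the other side.
  -- As mp does not charge {R < 0} while mn lives on that set, domination of mn by mp forces mn = 0,
  -- hence R ≥ 0 almost everywhere.
  have hsum : ν + mn = mp := by
    refine Measure.ext_of_charFun (funext fun t => ?_)
    have e1 : charFun (ν + mn) t = charFun ν t + charFun mn t := by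
      simp only [charFun_apply_real]
      refine integral_add_measure ?_ ?_ <;>
      · refine (integrable_const (1 : ℝ)).mono (Continuous.aestronglyMeasurable (by fun_prop))
          (ae_of_all _ fun x => ?_)
        rw [hE]; simp
    rw [e1, h t, hmn, hcf (fun x => -R x) hRm.neg, hmp, hcf _ hRm, ← eq_sub_iff_add_eq,
      ← integral_sub (hint R hR t) (hint (fun x => -R x) hR.neg t)]
    congr 1
    ext x
    rw [← sub_mul, ← Complex.ofReal_sub]
    congr 2
    rcases le_total 0 (R x) with h0 | h0
    · rw [max_eq_left h0, max_eq_right (by linarith)]; ring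
    · rw [max_eq_right h0, max_eq_left (by linarith)]; ring
  have hmn0 : mn = 0 := by
    have hS : MeasurableSet {x | R x < 0} := measurableSet_lt hRm measurable_const
    have h1 : mp {x | R x < 0} = 0 := by
      rw [hmp, withDensity_apply _ hS, setLIntegral_congr_fun (g := fun _ => 0) hS
        (fun x hx => ENNReal.ofReal_of_nonpos (le_of_lt hx))]
      simp
    have h2 : mn {x | R x < 0} = 0 := by
      rw [← hsum, Measure.add_apply] at h1
      exact (add_eq_zero.1 h1).2
    have h3 : mn {x | R x < 0}ᶜ = 0 := by
      rw [hmn, withDensity_apply _ hS.compl, setLIntegral_congr_fun (g := fun _ => 0) hS.compl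
        (fun x hx => ENNReal.ofReal_of_nonpos (by
          have : ¬ R x < 0 := hx
          linarith))]
      simp
    exact Measure.measure_univ_eq_zero.1 (by
      rw [← Set.union_compl_self {x | R x < 0}]
      exact measure_union_null h2 h3)
  refine ⟨?_, by rw [← hsum, hmn0, add_zero]⟩
  have := (withDensity_eq_zero_iff hRm.neg.ennreal_ofReal.aemeasurable).1 hmn0
  filter_upwards [this] with x hx
  simpa using hx

/-- Fourier inversion produces a density which, with its first two derivatives, decays like (1 +
|x|)^(-2); since γ < 1, this decay makes the density criterion applicable. -/
lemma isSmoothing_of_fourierDecay {ν : Measure ℝ} [IsProbabilityMeasure ν] {δ p C : ℝ}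
    (hδ : 0 ≤ δ) (hp : 4 + 2 * δ ≤ p) (h : FourierDecay δ p C (charFun ν)) {γ : ℝ} (hγ : 0 ≤ γ)
    (hγ1 : γ < 1) (hw : Integrable (polyWeight γ) ν) : ∃ M, IsSmoothing γ M ν := by
  obtain ⟨hcd, hψ, D, hD⟩ := h.fourier_bounds hδ hp
  set ψ := charFun ν with hψdef
  set ρ := 𝓕 ψ with hρ
  have hD0 : 0 ≤ D := by simpa using (norm_nonneg _).trans (hD 0 (by norm_num) 0)
  have hρi : Integrable ρ := by
    refine ((integrable_one_add_abs_rpow (s := -2) (by norm_num)).const_mul D).mono'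
      hcd.continuous.aestronglyMeasurable (ae_of_all _ fun w => ?_)
    simpa using hD 0 (by norm_num) w
  have hinv : ∀ t : ℝ, ∫ w, ρ w * Complex.exp (t * w * Complex.I) =
      ψ ((2 * Real.pi)⁻¹ * t) := by
    intro t
    have := congrFun (h.contDiff.continuous.fourierInv_fourier_eq hψ hρi) ((2 * Real.pi)⁻¹ * t)
    rw [← this, Real.fourierInv_eq']
    congr 1
    ext w
    rw [smul_eq_mul, mul_comm]
    congr 2
    simp only [RCLike.inner_apply, conj_trivial]
    push_cast
    have : (Real.pi : ℂ) ≠ 0 := by exact_mod_cast Real.pi_ne_zero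
    field_simp
  set R : ℝ → ℝ := fun w => (ρ w).re with hR
  have hRi : Integrable R := hρi.re
  have hRc : Continuous R := Complex.continuous_re.comp hcd.continuous
  -- The rescaling absorbs the 2π of the Fourier convention: the rescaled law has density R. It is
  -- undone at the end by `map_mul`.
  set ν' := ν.map (fun x => (2 * Real.pi)⁻¹ * x) with hν'
  have hint : ∀ t : ℝ, Integrable fun w => ρ w * Complex.exp (t * w * Complex.I) := by
    intro t
    refine hρi.mono (hcd.continuous.mul (by fun_prop)).aestronglyMeasurable
      (ae_of_all _ fun x => ?_)
    rw [norm_mul, ← Complex.ofReal_mul, Complex.norm_exp_ofReal_mul_I, mul_one]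
  have hcf : ∀ t, charFun ν' t = ∫ x, (R x : ℂ) * Complex.exp (t * x * Complex.I) := by
    intro t
    have e0 : charFun ν' t = ψ ((2 * Real.pi)⁻¹ * t) := charFun_map_mul _ t
    have e1 := hinv t
    -- Conjugating the inversion formula at -t shows that the conjugate of ρ inverts to the same
    -- function, because a characteristic function at -s is the conjugate of its value at s.
    -- Averaging the two formulas replaces ρ by its real part.
    have e2 : ∫ w, (starRingEnd ℂ) (ρ w) * Complex.exp (t * w * Complex.I) =
        ψ ((2 * Real.pi)⁻¹ * t) := by
      have := congrArg (starRingEnd ℂ) (hinv (-t))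
      rw [← integral_conj, mul_neg, hψdef, charFun_neg, Complex.conj_conj] at this
      rw [hψdef, ← this]
      congr 1
      ext w
      rw [map_mul, ← Complex.exp_conj]
      congr 2
      simp
    have hint' : Integrable fun w => (starRingEnd ℂ) (ρ w) * Complex.exp (t * w * Complex.I) := by
      refine hρi.mono ((Complex.continuous_conj.comp hcd.continuous).mul
        (by fun_prop)).aestronglyMeasurable (ae_of_all _ fun x => ?_)
      rw [norm_mul, ← Complex.ofReal_mul, Complex.norm_exp_ofReal_mul_I, mul_one, RCLike.norm_conj]
    have e3 : ∀ w, (R w : ℂ) * Complex.exp (t * w * Complex.I) =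
        2⁻¹ * (ρ w * Complex.exp (t * w * Complex.I) +
          (starRingEnd ℂ) (ρ w) * Complex.exp (t * w * Complex.I)) := by
      intro w
      rw [← add_mul, Complex.add_conj]
      simp only [hR]
      push_cast
      ring
    simp_rw [e3]
    rw [integral_const_mul, integral_add (hint t) hint', e1, e2, e0]
    ring
  have : IsProbabilityMeasure ν' := Measure.isProbabilityMeasure_map (by fun_prop)
  obtain ⟨hR0, hνR⟩ := eq_withDensity_of_charFun_eq hRc.measurable hRi hcf
  have hd1 : Differentiable ℝ ρ := hcd.differentiable two_ne_zero
  have hd2 : Differentiable ℝ (deriv ρ) := by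
    have : ContDiff ℝ 1 (deriv ρ) := (contDiff_succ_iff_deriv (n := 1).1 hcd).2.2
    exact this.differentiable one_ne_zero
  have hre : ∀ {f : ℝ → ℂ} {f' : ℂ} {x : ℝ}, HasDerivAt f f' x →
      HasDerivAt (fun x => (f x).re) f'.re x := fun {f f' x} hf =>
    (Complex.reCLM.hasFDerivAt.comp_hasDerivAt x hf)
  have hw' : Integrable (polyWeight γ) ν' := integrable_polyWeight_map_mul hγ hw _
  have hsm : ∃ M, IsSmoothing γ M ν' := by
    rw [hνR] at hw' ⊢
    refine isSmoothing_withDensity (k := fun w => (deriv ρ w).re) (C := 2 ^ (2 : ℝ) * D) (q := 2)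
      hγ (by linarith) (fun x => hre (hd1 x).hasDerivAt) hR0 (fun x => ?_) (fun x y hxy => ?_) hw'
    · have h1 := hD 1 (by norm_num) x
      rw [iteratedDeriv_one] at h1
      have h2 := (Complex.abs_re_le_norm (deriv ρ x)).trans h1
      have h3 : 0 ≤ D * (1 + |x|) ^ (-(2 : ℝ)) := by positivity
      refine h2.trans ?_
      norm_num at h3 ⊢
      nlinarith
    · have h1 := Convex.norm_image_sub_le_of_norm_hasDerivWithin_le (s := Set.uIcc x y)
        (f := fun w => (deriv ρ w).re) (f' := fun w => (deriv (deriv ρ) w).re)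
        (C := D * (2 ^ (2 : ℝ) * (1 + |x|) ^ (-(2 : ℝ)))) (x := y) (y := x)
        (fun w _ => (hre (hd2 w).hasDerivAt).hasDerivWithinAt) (fun w hw => ?_)
        (convex_uIcc _ _) Set.right_mem_uIcc Set.left_mem_uIcc
      · rw [Real.norm_eq_abs, Real.norm_eq_abs] at h1
        calc _ ≤ _ := h1
          _ = _ := by ring
      · have h2 := hD 2 le_rfl w
        rw [iteratedDeriv_succ, iteratedDeriv_one] at h2
        refine ((Complex.abs_re_le_norm _).trans h2).trans (mul_le_mul_of_nonneg_left
          (one_add_abs_rpow_neg_le (by norm_num) ?_) hD0)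
        exact (Set.abs_sub_left_of_mem_uIcc hw).trans (by rw [abs_sub_comm]; exact hxy.le)
  obtain ⟨M, hM⟩ := hsm
  have hpi : (2 * Real.pi) ≠ 0 := by positivity
  obtain ⟨M', hM'⟩ := hM.map_mul hγ hpi
  refine ⟨M', ?_⟩
  have e : ν'.map (fun x => 2 * Real.pi * x) = ν := by
    rw [hν', Measure.map_map (by fun_prop) (by fun_prop)]
    convert Measure.map_id
    ext x
    simp only [Function.comp_apply, id]
    rw [mul_inv_cancel_left₀ hpi]
  rwa [e] at hM'

/-- Each term contributes decay δ, so a block of n + 1 terms with nδ > 4 + 2δ has enough; here γ < 1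
because α = 2. -/
lemma FiniteVarianceRegime.exists_isSmoothing {μ : Measure ℝ} [IsProbabilityMeasure μ]
    (h : FiniteVarianceRegime μ) {γ : ℝ} (hγ : 0 ≤ γ) (hγα : γ < tailExponent μ - 1)
    (hw : Integrable (polyWeight γ) μ) {a : ℕ → ℝ} (ha : ∀ i, a i ≠ 0) :
    ∃ n M, IsSmoothing γ M (blockLaw μ a n) := by
  obtain ⟨hα, h2, δ, hδ, C, hC⟩ := h
  obtain ⟨n, hn⟩ := exists_nat_gt ((4 + 2 * δ) / δ)
  obtain ⟨D, hD⟩ := fourierDecay_blockLaw h2 hδ.le hC ha n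
  rw [div_lt_iff₀ hδ] at hn
  obtain ⟨M, hM⟩ := isSmoothing_of_fourierDecay hδ.le (by linarith) hD hγ (by linarith)
    (integrable_polyWeight_blockLaw hγ hw a _)
  exact ⟨n + 1, M, hM⟩

end Fourier

/-- Averaging over enough terms of the moving average is smoothing. -/
lemma RegularInnovations.exists_isSmoothing {μ : Measure ℝ} [IsProbabilityMeasure μ]
    (h : RegularInnovations μ) {γ : ℝ} (hγ : 0 ≤ γ) (hγα : γ < tailExponent μ - 1)
    (hw : Integrable (polyWeight γ) μ) {a : ℕ → ℝ} (ha : ∀ᶠ i in atTop, a i ≠ 0) :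
    ∃ n M, IsSmoothing γ M (blockLaw μ a n) := by
  -- The coefficients are only eventually nonzero. Smoothing is obtained from a block beginning at
  -- m, and the first m terms are then convolved back in, which preserves it.
  obtain ⟨m, hm⟩ := eventually_atTop.1 ha
  have ha' : ∀ i, a (i + m) ≠ 0 := fun i => hm _ (by omega)
  have key : ∃ n M, IsSmoothing γ M (blockLaw μ (fun i => a (i + m)) n) := by
    rcases h.regime with hr | hr
    · exact hr.exists_isSmoothing hγ hγα hw ha'
    · obtain ⟨M, hM⟩ := hr.exists_isSmoothing h.cdf_contDiff hγ hγα hw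
      obtain ⟨M', hM'⟩ := hM.map_mul hγ (ha' 0)
      exact ⟨1, M', by simpa [blockLaw] using hM'⟩
  obtain ⟨n, M, hM⟩ := key
  refine ⟨m + n, M * ∫ z, polyWeight γ z ∂(blockLaw μ a m), ?_⟩
  rw [blockLaw_add, Measure.conv_comm]
  exact hM.conv hγ (integrable_polyWeight_blockLaw hγ hw _ _)
    (integrable_polyWeight_blockLaw hγ hw _ _) le_rfl

/-! ### Tails of the linear process and their moments. -/

section CoefficientSums

variable {a : ℕ → ℝ} {c₀ κ p B : ℝ}

lemma sum_shift_abs_rpow_le (hB : ∀ N, ∑ i ∈ Finset.range N, |a i| ^ p ≤ B) (j N : ℕ) :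
    ∑ i ∈ Finset.range N, |a (i + j)| ^ p ≤ B := by
  refine le_trans ?_ (hB (j + N))
  rw [Finset.sum_range_add]
  have : 0 ≤ ∑ x ∈ Finset.range j, |a x| ^ p := Finset.sum_nonneg fun _ _ => by positivity
  simp_rw [add_comm _ j]
  linarith

lemma sum_tail_abs_rpow_le (hp : 0 < p) (hc : ∀ j : ℕ, |a j| ≤ c₀ * ((j : ℝ) + 1) ^ (-κ))
    (hpκ : 1 < p * κ) (j N : ℕ) :
    ∑ i ∈ Finset.range N, |a (i + j)| ^ p ≤
      c₀ ^ p * (p * κ / (p * κ - 1) * ((j : ℝ) + 1) ^ (1 - p * κ)) := by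
  have hc0 : 0 ≤ c₀ := by simpa using (abs_nonneg _).trans (hc 0)
  calc _ ≤ ∑ i ∈ Finset.range N, c₀ ^ p * (((j + i : ℕ) : ℝ) + 1) ^ (-(p * κ)) := by
        refine Finset.sum_le_sum fun i _ => ?_
        rw [add_comm i j]
        calc _ ≤ (c₀ * (((j + i : ℕ) : ℝ) + 1) ^ (-κ)) ^ p :=
              Real.rpow_le_rpow (abs_nonneg _) (hc _) hp.le
          _ = _ := by
              rw [Real.mul_rpow hc0 (by positivity), ← Real.rpow_mul (by positivity)]
              congr 2; ring
    _ = c₀ ^ p * ∑ i ∈ Finset.range N, (((j + i : ℕ) : ℝ) + 1) ^ (-(p * κ)) := by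
        rw [Finset.mul_sum]
    _ ≤ _ := mul_le_mul_of_nonneg_left (sum_rpow_neg_tail_le hpκ j N) (by positivity)

end CoefficientSums

/-- The law of the tail `∑_{i ≥ j} a_i ε_{j - i}` of the linear process. -/
noncomputable def tailLaw {Ω : Type*} [MeasurableSpace Ω] (P : Measure Ω) (ε : ℤ → Ω → ℝ)
    (a : ℕ → ℝ) (j : ℕ) : Measure ℝ :=
  P.map (linearProcess (fun i => a (i + j)) ε 0)


namespace CenteredInnovations

variable {Ω : Type*} [MeasurableSpace Ω] {P : Measure Ω} [IsProbabilityMeasure P]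
  {ε : ℤ → Ω → ℝ} {p B : ℝ} {a b : ℕ → ℝ}

lemma isProbabilityMeasure_law (h : CenteredInnovations P ε p) :
    IsProbabilityMeasure (P.map (ε 0)) :=
  Measure.isProbabilityMeasure_map (h.measurable 0).aemeasurable

lemma isProbabilityMeasure_tailLaw (h : CenteredInnovations P ε p) (j : ℕ) :
    IsProbabilityMeasure (tailLaw P ε a j) :=
  Measure.isProbabilityMeasure_map (h.measurable_linearProcess_at _ 0).aemeasurable

lemma map_tail_eq (h : CenteredInnovations P ε p) (j : ℕ) (t : ℤ) :
    P.map (linearProcess (fun i => a (i + j)) ε t) = tailLaw P ε a j :=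
  h.map_linearProcess_eq _ t

lemma map_mul_innovation (h : CenteredInnovations P ε p) (c : ℝ) (t : ℤ) :
    P.map (fun ω => c * ε t ω) = (P.map (ε 0)).map (fun x => c * x) := by
  rw [← (h.ident t).map_eq, Measure.map_map (by fun_prop) (h.measurable t)]
  rfl

lemma tailLaw_succ (h : CenteredInnovations P ε p)
    (hB : ∀ N, ∑ i ∈ Finset.range N, |a i| ^ p ≤ B) (j : ℕ) :
    tailLaw P ε a j = (P.map (ε 0)).map (fun x => a j * x) ∗ tailLaw P ε a (j + 1) := by
  have hsh := sum_shift_abs_rpow_le hB j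
  have hae := h.ae_linearProcess_eq (b := fun i => a (i + j)) hsh 0
  have hind : IndepFun (ε 0) (linearProcess (fun i => a (i + (j + 1))) ε (0 - 1)) P :=
    h.indepFun_past (by norm_num) (measurable_linearProcess_past _ _)
  have hind' := hind.comp (measurable_const_mul (a j)) measurable_id
  rw [← h.map_mul_innovation (a j) 0, ← h.map_tail_eq (j + 1) (0 - 1), tailLaw,
    Measure.map_congr (g := (fun ω => a j * ε 0 ω) +
      linearProcess (fun i => a (i + (j + 1))) ε (0 - 1))]
  · exact hind'.map_add_eq_map_conv_map ((h.measurable 0).const_mul _)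
      (h.measurable_linearProcess_at _ _)
  · filter_upwards [hae] with ω hω
    rw [hω, Pi.add_apply]
    simp only [zero_add]
    congr 3
    ext i
    congr 1
    ring

/-- Iterating the independence of the current innovation and the past splits X_0 into a block of j
terms and an independent tail. This is how averages over blocks are related to expectations of
G(X_0). -/
lemma tailLaw_zero_eq (h : CenteredInnovations P ε p)
    (hB : ∀ N, ∑ i ∈ Finset.range N, |a i| ^ p ≤ B) (j : ℕ) :
    tailLaw P ε a 0 = blockLaw (P.map (ε 0)) a j ∗ tailLaw P ε a j := by
  have := h.isProbabilityMeasure_law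
  have := fun j => h.isProbabilityMeasure_tailLaw (a := a) j
  induction j with
  | zero => simp [blockLaw]
  | succ j ih =>
    rw [ih, h.tailLaw_succ hB j, blockLaw, Measure.conv_assoc]

lemma map_partialSum (h : CenteredInnovations P ε p) (b : ℕ → ℝ) (t : ℤ) (N : ℕ) :
    P.map (fun ω => ∑ j ∈ Finset.range N, b j * ε (t - (j : ℤ)) ω) =
      blockLaw (P.map (ε 0)) b N := by
  induction N with
  | zero => simp [blockLaw]
  | succ N ih =>
    have hm : ∀ j : ℕ, Measurable fun ω => b j * ε (t - (j : ℤ)) ω := fun j =>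
      (h.measurable _).const_mul _
    have hind := (h.iIndepFun_terms b t).indepFun_finsetSum_of_notMem hm
      (s := Finset.range N) (i := N) (by simp)
    have e : (∑ j ∈ Finset.range N, fun ω => b j * ε (t - (j : ℤ)) ω) =
        fun ω => ∑ j ∈ Finset.range N, b j * ε (t - (j : ℤ)) ω := by
      ext ω; simp
    rw [e] at hind
    have := hind.map_add_eq_map_conv_map (Finset.measurable_sum _ fun j _ => hm j) (hm N)
    rw [blockLaw, ← ih, ← h.map_mul_innovation (b N) (t - N), ← this]
    congr 1
    ext ω
    simp [Finset.sum_range_succ]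

lemma integrable_polyWeight_law (h : CenteredInnovations P ε p) {γ : ℝ} (hγ1 : γ ≤ 1) :
    Integrable (polyWeight γ) (P.map (ε 0)) := by
  rw [integrable_map_measure (measurable_polyWeight γ).aestronglyMeasurable
    (h.measurable 0).aemeasurable]
  have hi : Integrable (ε 0) P := h.memLp.integrable (by simpa using h.one_lt.le)
  refine ((integrable_const 1).add hi.abs).mono'
    ((measurable_polyWeight γ).comp (h.measurable 0)).aestronglyMeasurable
    (ae_of_all _ fun ω => ?_)
  rw [Real.norm_eq_abs, Function.comp_apply, abs_of_pos (polyWeight_pos _ _)]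
  exact polyWeight_le_one_add hγ1 _

/-- As γ ≤ 1, the weight is controlled by a first moment, hence by the L^p norm of the partial sum.
The essential point is uniformity in N: it makes the smoothness constants of long block averages
uniform. -/
lemma integral_polyWeight_blockLaw_le (h : CenteredInnovations P ε p) {γ : ℝ} (hγ1 : γ ≤ 1)
    (hB : ∀ N, ∑ i ∈ Finset.range N, |b i| ^ p ≤ B) (N : ℕ) :
    ∫ z, polyWeight γ z ∂(blockLaw (P.map (ε 0)) b N) ≤
      1 + (2 * p * (B * ∫ ω, |ε 0 ω| ^ p ∂P)) ^ (1 / p) := by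
  have hp := h.one_lt
  have hm : Measurable fun ω => ∑ j ∈ Finset.range N, b j * ε (0 - (j : ℤ)) ω :=
    Finset.measurable_sum _ fun j _ => (h.measurable _).const_mul _
  have hL := h.eLpNorm_partialSum_le hB 0 N
  rw [← h.map_partialSum b 0 N, integral_map hm.aemeasurable
    (measurable_polyWeight γ).aestronglyMeasurable]
  set S := fun ω => ∑ j ∈ Finset.range N, b j * ε (0 - (j : ℤ)) ω with hS
  have hSp : MemLp S (ENNReal.ofReal p) P := ⟨hm.aestronglyMeasurable, hL.trans_lt
    ENNReal.ofReal_lt_top⟩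
  have hSi : Integrable S P := hSp.integrable (by simpa using hp.le)
  have h1 : ENNReal.ofReal (∫ ω, |S ω| ∂P) ≤
      ENNReal.ofReal ((2 * p * (B * ∫ ω, |ε 0 ω| ^ p ∂P)) ^ (1 / p)) := by
    refine le_trans (le_of_eq ?_) ((eLpNorm_le_eLpNorm_of_exponent_le
      (show (1 : ℝ≥0∞) ≤ ENNReal.ofReal p by simpa using hp.le)
      hm.aestronglyMeasurable).trans hL)
    rw [eLpNorm_one_eq_lintegral_enorm, ← ofReal_integral_norm_eq_lintegral_enorm hSi]
    rfl
  have hB0 : 0 ≤ B := by simpa using hB 0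
  have hI : 0 ≤ ∫ ω, |ε 0 ω| ^ p ∂P := integral_nonneg fun ω => by positivity
  rw [ENNReal.ofReal_le_ofReal_iff (by positivity)] at h1
  calc _ ≤ ∫ ω, (1 + |S ω|) ∂P := by
        refine integral_mono_of_nonneg (ae_of_all _ fun ω => (polyWeight_pos _ _).le)
          ((integrable_const 1).add hSi.abs) (ae_of_all _ fun ω => polyWeight_le_one_add hγ1 _)
    _ = 1 + ∫ ω, |S ω| ∂P := by
        rw [integral_add (integrable_const 1) hSi.abs]; simp
    _ ≤ _ := by linarith

/-- The tails of the linear process decay like `j ^ (1 / p - κ)` in `L^p`. -/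
lemma exists_eLpNorm_tail_le (h : CenteredInnovations P ε p) {c₀ κ : ℝ}
    (hc : ∀ j : ℕ, |a j| ≤ c₀ * ((j : ℝ) + 1) ^ (-κ)) (hpκ : 1 < p * κ) :
    ∃ R, 0 ≤ R ∧ ∀ (j : ℕ) (t : ℤ),
      eLpNorm (linearProcess (fun i => a (i + j)) ε t) (ENNReal.ofReal p) P ≤
        ENNReal.ofReal (R * ((j : ℝ) + 1) ^ (1 / p - κ)) := by
  have hp := h.one_lt
  have hp0 : 0 < p := by linarith
  have hc0 : 0 ≤ c₀ := by simpa using (abs_nonneg _).trans (hc 0)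
  have hI : 0 ≤ ∫ ω, |ε 0 ω| ^ p ∂P := integral_nonneg fun ω => by positivity
  have hs : 0 < p * κ - 1 := by linarith
  have hK : 0 ≤ p * κ / (p * κ - 1) := by positivity
  refine ⟨(2 * p * (c₀ ^ p * (p * κ / (p * κ - 1))) * ∫ ω, |ε 0 ω| ^ p ∂P) ^ (1 / p),
    by positivity, fun j t => ?_⟩
  refine (h.eLpNorm_linearProcess_le (sum_tail_abs_rpow_le hp0 hc hpκ j) t).trans
    (ENNReal.ofReal_le_ofReal (le_of_eq ?_))
  have e : ((j : ℝ) + 1) ^ (1 / p - κ) = (((j : ℝ) + 1) ^ (1 - p * κ)) ^ (1 / p) := by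
    rw [← Real.rpow_mul (by positivity)]
    congr 1
    field_simp
  rw [e, ← Real.mul_rpow (by positivity) (by positivity)]
  congr 1
  ring

end CenteredInnovations

section ProductNorms

lemma eLpNorm_fun_add_le {X : Type*} [MeasurableSpace X] {m : Measure X} {q : ℝ≥0∞} {f g : X → ℝ}
    (hf : AEStronglyMeasurable f m) (hg : AEStronglyMeasurable g m) (hq : 1 ≤ q) :
    eLpNorm (fun x => f x + g x) q m ≤ eLpNorm f q m + eLpNorm g q m :=
  eLpNorm_add_le hf hg hq

lemma eLpNorm_prod_mul {r : ℝ} (hr : 0 < r) {μ ν : Measure ℝ} [SFinite μ] [SFinite ν]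
    {f g : ℝ → ℝ} (hf : Measurable f) (hg : Measurable g) :
    eLpNorm (fun q : ℝ × ℝ => f q.1 * g q.2) (ENNReal.ofReal r) (μ.prod ν) =
      eLpNorm f (ENNReal.ofReal r) μ * eLpNorm g (ENNReal.ofReal r) ν := by
  have h0 : ENNReal.ofReal r ≠ 0 := by simpa using hr
  simp only [eLpNorm_eq_lintegral_rpow_enorm_toReal h0 ENNReal.ofReal_ne_top,
    ENNReal.toReal_ofReal hr.le, enorm_mul]
  rw [← ENNReal.mul_rpow_of_nonneg _ _ (by positivity)]
  simp_rw [ENNReal.mul_rpow_of_nonneg _ _ hr.le]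
  rw [lintegral_prod_mul (hf.enorm.pow_const r).aemeasurable (hg.enorm.pow_const r).aemeasurable]

/-- Jensen's inequality for the inner average, then Tonelli: conditioning contracts L^r. -/
lemma eLpNorm_avg_le {r : ℝ} (hr : 1 ≤ r) {ν lam : Measure ℝ} [IsProbabilityMeasure ν]
    [IsProbabilityMeasure lam] {H : ℝ → ℝ} (hH : Measurable H) :
    eLpNorm (avg ν H) (ENNReal.ofReal r) lam ≤ eLpNorm H (ENNReal.ofReal r) (ν ∗ lam) := by
  have hr0 : 0 < r := by linarith
  have h0 : ENNReal.ofReal r ≠ 0 := by simpa using hr0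
  rw [Measure.conv_comm]
  simp only [eLpNorm_eq_lintegral_rpow_enorm_toReal h0 ENNReal.ofReal_ne_top,
    ENNReal.toReal_ofReal hr0.le]
  refine ENNReal.rpow_le_rpow ?_ (by positivity)
  rw [Measure.lintegral_conv (hH.enorm.pow_const r)]
  refine lintegral_mono fun x => ?_
  have hHx : Measurable fun z => H (x + z) := hH.comp (measurable_const_add x)
  have h1 : ‖avg ν H x‖ₑ ≤ eLpNorm (fun z => H (x + z)) 1 ν := by
    rw [eLpNorm_one_eq_lintegral_enorm]
    exact enorm_integral_le_lintegral_enorm _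
  have h2 := h1.trans (eLpNorm_le_eLpNorm_of_exponent_le
    (show (1 : ℝ≥0∞) ≤ ENNReal.ofReal r by simpa using hr) hHx.aestronglyMeasurable)
  rw [eLpNorm_eq_lintegral_rpow_enorm_toReal h0 ENNReal.ofReal_ne_top,
    ENNReal.toReal_ofReal hr0.le] at h2
  have h3 := ENNReal.rpow_le_rpow h2 hr0.le
  rwa [← ENNReal.rpow_mul, one_div_mul_cancel hr0.ne', ENNReal.rpow_one] at h3

end ProductNorms

/-! ### Linearization of one increment. -/

section Kernel

/-- Comparison of one martingale increment of `G(X_t)` with its linearization: `c e` is the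
contribution of the current innovation and `z` that of the past. -/
lemma SmoothGrowth.abs_increment_le {γ N c : ℝ} {g : ℝ → ℝ} {μ lam : Measure ℝ}
    [IsProbabilityMeasure μ] [IsProbabilityMeasure lam] (hγ : 0 ≤ γ) (hγ1 : γ ≤ 1)
    (hg : SmoothGrowth γ N g) (hμ1 : Integrable (fun e => e) μ) (hμ0 : ∫ e, e ∂μ = 0)
    (hμγ : Integrable (fun e => |e| ^ (1 + γ)) μ) (hμw : Integrable (polyWeight γ) μ)
    (hlw : Integrable (polyWeight γ) lam) (hl : Integrable (fun z => |z| * polyWeight γ z) lam)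
    (e z : ℝ) :
    |g (c * e + z) - avg (μ.map (fun x => c * x)) g z - (∫ w, deriv g w ∂lam) * (c * e)| ≤
      4 * N * |c| ^ (1 + γ) * ((|e| ^ (1 + γ) + ∫ x, |x| ^ (1 + γ) ∂μ) * polyWeight γ z) +
      N * |c| * (|e| * (|z| * polyWeight γ z + ∫ w, |w| * polyWeight γ w ∂lam)) := by
  have hN := hg.nonneg
  have hgm : Measurable g := hg.differentiable.continuous.measurable
  set m := ∫ x, |x| ^ (1 + γ) ∂μ with hm
  set L := ∫ w, |w| * polyWeight γ w ∂lam with hL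
  have hgz : Measurable fun x => g (z + x) := hgm.comp (measurable_const_add z)
  have eavg : avg (μ.map (fun x => c * x)) g z = ∫ x, g (z + c * x) ∂μ := by
    rw [avg, integral_map (by fun_prop) hgz.aestronglyMeasurable]
  have hgi : Integrable (fun x => g (z + c * x)) μ := by
    have := integrable_comp_add hγ hgm hg.bound (integrable_polyWeight_map_mul hγ hμw c) z
    rwa [integrable_map_measure hgz.aestronglyMeasurable (by fun_prop)] at this
  -- T is the Taylor remainder at the past z. The innovation is centred, so the linear term
  -- disappears on averaging, and the increment equals T(e) minus its mean plus the fluctuation of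
  -- the derivative times c e.
  set T : ℝ → ℝ := fun x => g (z + c * x) - g z - deriv g z * (c * x) with hT
  have hTb : ∀ x, |T x| ≤ 4 * N * polyWeight γ z * |c| ^ (1 + γ) * |x| ^ (1 + γ) := by
    intro x
    have := hg.abs_taylor_le hγ hγ1 z (c * x)
    rw [abs_mul, Real.mul_rpow (abs_nonneg _) (abs_nonneg _)] at this
    exact this.trans_eq (by ring)
  have hTint : ∫ x, T x ∂μ = (∫ x, g (z + c * x) ∂μ) - g z := by
    have h1 : Integrable (fun x => deriv g z * (c * x)) μ := (hμ1.const_mul c).const_mul _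
    have h2 : Integrable (fun x => g (z + c * x) - g z) μ := hgi.sub (integrable_const _)
    simp only [hT]
    rw [integral_sub h2 h1, integral_sub hgi (integrable_const _), integral_const_mul,
      integral_const_mul, hμ0]
    simp
  have hTI : |∫ x, T x ∂μ| ≤ 4 * N * polyWeight γ z * |c| ^ (1 + γ) * m := by
    calc _ ≤ ∫ x, 4 * N * polyWeight γ z * |c| ^ (1 + γ) * |x| ^ (1 + γ) ∂μ := by
          rw [← Real.norm_eq_abs]
          exact norm_integral_le_of_norm_le (hμγ.const_mul _) (ae_of_all _ hTb)
      _ = _ := integral_const_mul _ _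
  have hdi : Integrable (deriv g) lam := by
    have := integrable_comp_add hγ (measurable_deriv g) hg.deriv_bound hlw 0
    simpa using this
  have hdL : |deriv g z - ∫ w, deriv g w ∂lam| ≤ N * (|z| * polyWeight γ z + L) := by
    have h1 : |∫ w, (deriv g w - deriv g 0) ∂lam| ≤ N * L := by
      calc _ ≤ ∫ w, N * (|w| * polyWeight γ w) ∂lam := by
            rw [← Real.norm_eq_abs]
            exact norm_integral_le_of_norm_le (hl.const_mul _) (ae_of_all _ hg.abs_deriv_sub_le)
        _ = _ := integral_const_mul _ _
    rw [integral_sub hdi (integrable_const _)] at h1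
    simp only [integral_const, probReal_univ, one_smul] at h1
    have h2 := hg.abs_deriv_sub_le z
    have h3 := abs_sub (deriv g z - deriv g 0) ((∫ w, deriv g w ∂lam) - deriv g 0)
    rw [sub_sub_sub_cancel_right] at h3
    linarith
  have e1 : g (c * e + z) - avg (μ.map (fun x => c * x)) g z - (∫ w, deriv g w ∂lam) * (c * e) =
      T e - (∫ x, T x ∂μ) + (deriv g z - ∫ w, deriv g w ∂lam) * (c * e) := by
    rw [eavg, hTint, hT, add_comm (c * e) z]
    ring
  rw [e1]
  have h1 := abs_add_le (T e - ∫ x, T x ∂μ) ((deriv g z - ∫ w, deriv g w ∂lam) * (c * e))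
  have h2 := abs_sub (T e) (∫ x, T x ∂μ)
  have h3 : |(deriv g z - ∫ w, deriv g w ∂lam) * (c * e)| ≤
      N * (|z| * polyWeight γ z + L) * (|c| * |e|) := by
    rw [abs_mul, abs_mul]
    exact mul_le_mul_of_nonneg_right hdL (by positivity)
  have h4 := hTb e
  calc _ ≤ 4 * N * polyWeight γ z * |c| ^ (1 + γ) * |e| ^ (1 + γ) +
        4 * N * polyWeight γ z * |c| ^ (1 + γ) * m +
        N * (|z| * polyWeight γ z + L) * (|c| * |e|) := by linarith
    _ = _ := by ring

end Kernel

namespace CenteredInnovations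

variable {Ω : Type*} [MeasurableSpace Ω] {P : Measure Ω} [IsProbabilityMeasure P]
  {ε : ℤ → Ω → ℝ} {p r γ c₀ κ : ℝ} {a : ℕ → ℝ}

lemma abs_mul_polyWeight_le (hγ : 0 ≤ γ) (hγ1 : γ ≤ 1) (z : ℝ) :
    |z| * polyWeight γ z ≤ |z| + |z| ^ (1 + γ) := by
  have h1 : polyWeight γ z ≤ 1 + |z| ^ γ := by
    have := Real.rpow_add_le_add_rpow zero_le_one (abs_nonneg z) hγ hγ1
    rwa [Real.one_rpow] at this
  rcases (abs_nonneg z).eq_or_lt with h0 | h0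
  · rw [← h0]; simp [Real.zero_rpow (by linarith : 1 + γ ≠ 0)]
  · rw [Real.rpow_add h0, Real.rpow_one]
    nlinarith

lemma eLpNorm_tailLaw (h : CenteredInnovations P ε p) {f : ℝ → ℝ} (hf : Measurable f)
    (q : ℝ≥0∞) (j : ℕ) (t : ℤ) :
    eLpNorm f q (tailLaw P ε a j) =
      eLpNorm (fun ω => f (linearProcess (fun i => a (i + j)) ε t ω)) q P := by
  rw [← h.map_tail_eq j t, eLpNorm_map_measure hf.aestronglyMeasurable
    (h.measurable_linearProcess_at _ t).aemeasurable]
  rfl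

/-- Moments of the law of the tails. -/
lemma exists_eLpNorm_tailLaw_le (h : CenteredInnovations P ε p) (hr : 1 < r) (hγ : 0 ≤ γ)
    (hγ1 : γ ≤ 1) (hp : p = r * (1 + γ))
    (hc : ∀ j : ℕ, |a j| ≤ c₀ * ((j : ℝ) + 1) ^ (-κ)) (hpκ : 1 < p * κ) :
    ∃ R, 0 ≤ R ∧ ∀ j : ℕ,
      eLpNorm (fun z => z) (ENNReal.ofReal r) (tailLaw P ε a j) ≤
        ENNReal.ofReal (R * ((j : ℝ) + 1) ^ (1 / p - κ)) ∧
      eLpNorm (polyWeight γ) (ENNReal.ofReal r) (tailLaw P ε a j) ≤ ENNReal.ofReal R ∧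
      eLpNorm (fun z => |z| * polyWeight γ z) (ENNReal.ofReal r) (tailLaw P ε a j) ≤
        ENNReal.ofReal (R * ((j : ℝ) + 1) ^ (1 / p - κ)) := by
  obtain ⟨R, hR0, hR⟩ := h.exists_eLpNorm_tail_le hc hpκ
  have hp0 : 0 < p := by linarith [h.one_lt]
  have hr0 : 0 < r := by linarith
  have hτ : 1 / p - κ ≤ 0 := by
    rw [sub_nonpos, div_le_iff₀ hp0]; linarith
  have hrp : r ≤ p := by rw [hp]; nlinarith
  have hrr : (1 : ℝ≥0∞) ≤ ENNReal.ofReal r := by simpa using hr.le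
  have key : ∀ j : ℕ, eLpNorm (fun z => z) (ENNReal.ofReal p) (tailLaw P ε a j) ≤
      ENNReal.ofReal (R * ((j : ℝ) + 1) ^ (1 / p - κ)) := fun j => by
    rw [h.eLpNorm_tailLaw measurable_id' _ j 0]
    exact hR j 0
  have hx1 : ∀ j : ℕ, ((j : ℝ) + 1) ^ (1 / p - κ) ≤ 1 := fun j =>
    Real.rpow_le_one_of_one_le_of_nonpos
      (by linarith [(Nat.cast_nonneg j : (0 : ℝ) ≤ j)]) hτ
  refine ⟨1 + R + R ^ (1 + γ), by positivity, fun j => ?_⟩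
  have := h.isProbabilityMeasure_tailLaw (a := a) j
  set x : ℝ := ((j : ℝ) + 1) ^ (1 / p - κ) with hx
  have hx0 : 0 ≤ x := by positivity
  have hRγ : 0 ≤ R ^ (1 + γ) := by positivity
  have b1 : eLpNorm (fun z => z) (ENNReal.ofReal r) (tailLaw P ε a j) ≤
      ENNReal.ofReal (R * x) :=
    (eLpNorm_le_eLpNorm_of_exponent_le (ENNReal.ofReal_le_ofReal hrp)
      measurable_id'.aestronglyMeasurable).trans (key j)
  refine ⟨b1.trans (ENNReal.ofReal_le_ofReal (by nlinarith)), ?_, ?_⟩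
  · calc _ ≤ eLpNorm (fun z => 1 + |z|) (ENNReal.ofReal r) (tailLaw P ε a j) := by
          refine eLpNorm_mono_real fun z => ?_
          rw [Real.norm_eq_abs, abs_of_pos (polyWeight_pos _ _)]
          exact polyWeight_le_one_add hγ1 z
      _ ≤ eLpNorm (fun _ => (1 : ℝ)) (ENNReal.ofReal r) (tailLaw P ε a j) +
          eLpNorm (fun z : ℝ => |z|) (ENNReal.ofReal r) (tailLaw P ε a j) :=
          eLpNorm_fun_add_le (f := fun _ => (1 : ℝ)) (g := fun z : ℝ => |z|) aestronglyMeasurable_const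
            (Measurable.aestronglyMeasurable (by fun_prop)) hrr
      _ ≤ ENNReal.ofReal 1 + ENNReal.ofReal (R * x) := by
          refine add_le_add ?_ ?_
          · rw [eLpNorm_const _ (by simpa using hr0) (IsProbabilityMeasure.ne_zero _)]
            simp
          · exact (eLpNorm_norm (fun z : ℝ => z)).le.trans b1
      _ ≤ _ := by
          rw [← ENNReal.ofReal_add zero_le_one (by positivity)]
          exact ENNReal.ofReal_le_ofReal (by nlinarith [hx1 j])
  · calc _ ≤ eLpNorm (fun z => |z| + |z| ^ (1 + γ)) (ENNReal.ofReal r) (tailLaw P ε a j) := by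
          refine eLpNorm_mono_real fun z => ?_
          rw [Real.norm_eq_abs, abs_of_nonneg (mul_nonneg (abs_nonneg _) (polyWeight_pos _ _).le)]
          exact abs_mul_polyWeight_le hγ hγ1 z
      _ ≤ eLpNorm (fun z : ℝ => |z|) (ENNReal.ofReal r) (tailLaw P ε a j) +
          eLpNorm (fun z : ℝ => |z| ^ (1 + γ)) (ENNReal.ofReal r) (tailLaw P ε a j) :=
          eLpNorm_fun_add_le (f := fun z : ℝ => |z|) (g := fun z : ℝ => |z| ^ (1 + γ))
            (Measurable.aestronglyMeasurable (by fun_prop))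
            (Measurable.aestronglyMeasurable (by fun_prop)) hrr
      _ ≤ ENNReal.ofReal (R * x) + ENNReal.ofReal ((R * x) ^ (1 + γ)) := by
          refine add_le_add ((eLpNorm_norm (fun z : ℝ => z)).le.trans b1) ?_
          have e := eLpNorm_norm_rpow (μ := tailLaw P ε a j) (p := ENNReal.ofReal r)
            (fun z : ℝ => z) (q := 1 + γ) (by linarith)
          rw [← ENNReal.ofReal_mul hr0.le, ← hp] at e
          simp only [Real.norm_eq_abs] at e
          rw [e, ← ENNReal.ofReal_rpow_of_nonneg (by positivity) (by linarith)]
          exact ENNReal.rpow_le_rpow (key j) (by linarith)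
      _ ≤ _ := by
          rw [← ENNReal.ofReal_add (by positivity) (by positivity)]
          refine ENNReal.ofReal_le_ofReal ?_
          have h2 : x ^ (1 + γ) ≤ x := by
            rcases hx0.eq_or_lt with h0 | h0
            · rw [← h0, Real.zero_rpow (by linarith)]
            · calc x ^ (1 + γ) ≤ x ^ (1 : ℝ) :=
                    Real.rpow_le_rpow_of_exponent_ge h0 (hx1 j) (by linarith)
                _ = x := Real.rpow_one x
          rw [Real.mul_rpow hR0 hx0]
          have := mul_le_mul_of_nonneg_left h2 hRγ
          nlinarith

lemma integrable_tailLaw_of_eLpNorm_le (h : CenteredInnovations P ε p) (hr : 1 < r) {f : ℝ → ℝ}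
    (hf : Measurable f) {j : ℕ} {B : ℝ}
    (hB : eLpNorm f (ENNReal.ofReal r) (tailLaw P ε a j) ≤ ENNReal.ofReal B) :
    Integrable f (tailLaw P ε a j) := by
  have := h.isProbabilityMeasure_tailLaw (a := a) j
  have hf' : MemLp f (ENNReal.ofReal r) (tailLaw P ε a j) :=
    ⟨hf.aestronglyMeasurable, hB.trans_lt ENNReal.ofReal_lt_top⟩
  exact hf'.integrable (by simpa using hr.le)

lemma integral_tailLaw_le_of_eLpNorm_le (h : CenteredInnovations P ε p) (hr : 1 < r) {f : ℝ → ℝ}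
    (hf : Measurable f) (hf0 : ∀ z, 0 ≤ f z) {j : ℕ} {B : ℝ} (hB0 : 0 ≤ B)
    (hB : eLpNorm f (ENNReal.ofReal r) (tailLaw P ε a j) ≤ ENNReal.ofReal B) :
    ∫ z, f z ∂(tailLaw P ε a j) ≤ B := by
  have := h.isProbabilityMeasure_tailLaw (a := a) j
  have hi := h.integrable_tailLaw_of_eLpNorm_le hr hf hB
  have h1 := (eLpNorm_le_eLpNorm_of_exponent_le
    (show (1 : ℝ≥0∞) ≤ ENNReal.ofReal r by simpa using hr.le) hf.aestronglyMeasurable).trans hB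
  rw [eLpNorm_one_eq_lintegral_enorm, ← ofReal_integral_norm_eq_lintegral_enorm hi,
    ENNReal.ofReal_le_ofReal_iff hB0] at h1
  simpa [Real.norm_eq_abs, abs_of_nonneg (hf0 _)] using h1

lemma measurable_abs_mul_polyWeight (γ : ℝ) : Measurable fun z => |z| * polyWeight γ z :=
  Measurable.mul (by fun_prop) (measurable_polyWeight γ)

lemma memLp_law (h : CenteredInnovations P ε p) :
    MemLp (fun e : ℝ => e) (ENNReal.ofReal p) (P.map (ε 0)) := by
  rw [memLp_map_measure_iff (by fun_prop) (h.measurable 0).aemeasurable]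
  exact h.memLp

/-- The martingale increments of the linearized process decay like `j ^ (-κ (1 + γ))`. -/
lemma exists_eLpNorm_increment_le (h : CenteredInnovations P ε p) (hr : 1 < r) (hγ : 0 ≤ γ)
    (hγ1 : γ ≤ 1) (hp : p = r * (1 + γ))
    (hc : ∀ j : ℕ, |a j| ≤ c₀ * ((j : ℝ) + 1) ^ (-κ)) (hpκ : 1 < p * κ)
    (hτ : 1 / p ≤ κ * (1 - γ)) :
    ∃ K, 0 ≤ K ∧ ∀ (j : ℕ) (N : ℝ) (g : ℝ → ℝ), SmoothGrowth γ N g →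
      eLpNorm (fun q : ℝ × ℝ => g (a j * q.1 + q.2) -
          avg ((P.map (ε 0)).map (fun x => a j * x)) g q.2 -
          (∫ w, deriv g w ∂(tailLaw P ε a j)) * (a j * q.1)) (ENNReal.ofReal r)
        ((P.map (ε 0)).prod (tailLaw P ε a (j + 1))) ≤
      ENNReal.ofReal (N * K * ((j : ℝ) + 1) ^ (-(κ * (1 + γ)))) := by
  obtain ⟨R, hR0, hR⟩ := h.exists_eLpNorm_tailLaw_le hr hγ hγ1 hp hc hpκ
  have hprob := h.isProbabilityMeasure_law
  have hprobt := fun j => h.isProbabilityMeasure_tailLaw (a := a) j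
  have hp0 : 0 < p := by linarith [h.one_lt]
  have hr0 : 0 < r := by linarith
  have hrr : (1 : ℝ≥0∞) ≤ ENNReal.ofReal r := by simpa using hr.le
  have hτ0 : 1 / p - κ ≤ 0 := by
    rw [sub_nonpos, div_le_iff₀ hp0]; linarith
  have hrp : r ≤ p := by rw [hp]; nlinarith
  have hγp : 1 + γ ≤ p := by rw [hp]; nlinarith
  have hc0 : 0 ≤ c₀ := by simpa using (abs_nonneg _).trans (hc 0)
  set μ := P.map (ε 0) with hμ
  have hμr : MemLp (fun e : ℝ => e) (ENNReal.ofReal r) μ :=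
    h.memLp_law.mono_exponent (ENNReal.ofReal_le_ofReal hrp)
  have hμ1 : Integrable (fun e : ℝ => e) μ := hμr.integrable hrr
  have hμ0 : ∫ e, e ∂μ = 0 := by
    rw [hμ, integral_map (h.measurable 0).aemeasurable measurable_id'.aestronglyMeasurable]
    exact h.centered
  have hμγ : Integrable (fun e : ℝ => |e| ^ (1 + γ)) μ :=
    (h.memLp_law.mono_exponent (ENNReal.ofReal_le_ofReal hγp)).integrable_abs_rpow (by linarith)
  set m := ∫ x, |x| ^ (1 + γ) ∂μ with hm
  have hm0 : 0 ≤ m := integral_nonneg fun x => by positivity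
  -- norms of the innovation factors
  have hE1 : MemLp (fun e : ℝ => |e| ^ (1 + γ) + m) (ENNReal.ofReal r) μ := by
    refine MemLp.add ?_ (memLp_const m)
    have e := eLpNorm_norm_rpow (μ := μ) (p := ENNReal.ofReal r)
      (fun z : ℝ => z) (q := 1 + γ) (by linarith)
    rw [← ENNReal.ofReal_mul hr0.le, ← hp] at e
    simp only [Real.norm_eq_abs] at e
    refine ⟨Measurable.aestronglyMeasurable (by fun_prop), ?_⟩
    rw [e]
    exact ENNReal.rpow_lt_top_of_nonneg (by linarith) h.memLp_law.2.ne
  set E1 := (eLpNorm (fun e : ℝ => |e| ^ (1 + γ) + m) (ENNReal.ofReal r) μ).toReal with hE1d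
  set E2 := (eLpNorm (fun e : ℝ => |e|) (ENNReal.ofReal r) μ).toReal with hE2d
  have hE1e : eLpNorm (fun e : ℝ => |e| ^ (1 + γ) + m) (ENNReal.ofReal r) μ =
      ENNReal.ofReal E1 := (ENNReal.ofReal_toReal hE1.2.ne).symm
  have hE2e : eLpNorm (fun e : ℝ => |e|) (ENNReal.ofReal r) μ = ENNReal.ofReal E2 :=
    (ENNReal.ofReal_toReal hμr.abs.2.ne).symm
  have hE10 : 0 ≤ E1 := ENNReal.toReal_nonneg
  have hE20 : 0 ≤ E2 := ENNReal.toReal_nonneg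
  refine ⟨4 * c₀ ^ (1 + γ) * (E1 * R) + c₀ * (E2 * (2 * R)), by positivity, fun j N g hg => ?_⟩
  have hN := hg.nonneg
  set x : ℝ := (j : ℝ) + 1 with hx
  have hx0 : 0 < x := by positivity
  have hx1 : 1 ≤ x := by linarith [(Nat.cast_nonneg j : (0 : ℝ) ≤ j)]
  obtain ⟨-, hRw, hRl⟩ := hR j
  obtain ⟨-, hRw', hRl'⟩ := hR (j + 1)
  have hxR : 0 ≤ R * x ^ (1 / p - κ) := by positivity
  set L := ∫ w, |w| * polyWeight γ w ∂(tailLaw P ε a j) with hL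
  have hLb : L ≤ R * x ^ (1 / p - κ) := h.integral_tailLaw_le_of_eLpNorm_le hr
    (measurable_abs_mul_polyWeight γ)
    (fun z => mul_nonneg (abs_nonneg _) (polyWeight_pos _ _).le) hxR hRl
  have hL0 : 0 ≤ L := integral_nonneg fun z => mul_nonneg (abs_nonneg _) (polyWeight_pos _ _).le
  have hpt := fun q : ℝ × ℝ => hg.abs_increment_le (c := a j) hγ hγ1 hμ1 hμ0 hμγ
    (h.integrable_polyWeight_law hγ1)
    (h.integrable_tailLaw_of_eLpNorm_le hr (measurable_polyWeight γ) hRw)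
    (h.integrable_tailLaw_of_eLpNorm_le hr (measurable_abs_mul_polyWeight γ) hRl) q.1 q.2
  have hmw := measurable_polyWeight γ
  have hml := measurable_abs_mul_polyWeight γ
  set c1 := 4 * N * |a j| ^ (1 + γ) with hc1
  set c2 := N * |a j| with hc2
  have hc10 : 0 ≤ c1 := by positivity
  have hc20 : 0 ≤ c2 := by positivity
  have hF1 : Measurable fun e : ℝ => |e| ^ (1 + γ) + m := by fun_prop
  have hF2 : Measurable fun z : ℝ => |z| * polyWeight γ z + L := hml.add_const L
  have n2 : eLpNorm (fun z => |z| * polyWeight γ z + L) (ENNReal.ofReal r)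
      (tailLaw P ε a (j + 1)) ≤ ENNReal.ofReal (2 * R * x ^ (1 / p - κ)) := by
    calc _ ≤ eLpNorm (fun z => |z| * polyWeight γ z) (ENNReal.ofReal r) (tailLaw P ε a (j + 1)) +
          eLpNorm (fun _ => L) (ENNReal.ofReal r) (tailLaw P ε a (j + 1)) :=
          eLpNorm_fun_add_le (f := fun z => |z| * polyWeight γ z) (g := fun _ => L)
            hml.aestronglyMeasurable aestronglyMeasurable_const hrr
      _ ≤ ENNReal.ofReal (R * x ^ (1 / p - κ)) + ENNReal.ofReal (R * x ^ (1 / p - κ)) := by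
          refine add_le_add (hRl'.trans (ENNReal.ofReal_le_ofReal
            (mul_le_mul_of_nonneg_left ?_ hR0))) ?_
          · refine Real.rpow_le_rpow_of_nonpos hx0 ?_ hτ0
            push_cast; linarith
          · rw [eLpNorm_const _ (by simpa using hr0) (IsProbabilityMeasure.ne_zero _)]
            simp only [measure_univ, ENNReal.one_rpow, mul_one, Real.enorm_eq_ofReal hL0]
            exact ENNReal.ofReal_le_ofReal hLb
      _ = _ := by
          rw [← ENNReal.ofReal_add hxR hxR]; congr 1; ring
  calc _ ≤ eLpNorm (fun q : ℝ × ℝ => c1 * ((|q.1| ^ (1 + γ) + m) * polyWeight γ q.2) +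
          c2 * (|q.1| * (|q.2| * polyWeight γ q.2 + L))) (ENNReal.ofReal r)
          (μ.prod (tailLaw P ε a (j + 1))) := eLpNorm_mono_real fun q => hpt q
    _ ≤ eLpNorm (fun q : ℝ × ℝ => c1 * ((|q.1| ^ (1 + γ) + m) * polyWeight γ q.2))
          (ENNReal.ofReal r) (μ.prod (tailLaw P ε a (j + 1))) +
        eLpNorm (fun q : ℝ × ℝ => c2 * (|q.1| * (|q.2| * polyWeight γ q.2 + L)))
          (ENNReal.ofReal r) (μ.prod (tailLaw P ε a (j + 1))) := by
        refine eLpNorm_fun_add_le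
          (f := fun q : ℝ × ℝ => c1 * ((|q.1| ^ (1 + γ) + m) * polyWeight γ q.2))
          (g := fun q : ℝ × ℝ => c2 * (|q.1| * (|q.2| * polyWeight γ q.2 + L))) (Measurable.aestronglyMeasurable ?_)
          (Measurable.aestronglyMeasurable ?_) hrr
        · exact ((hF1.comp measurable_fst).mul (hmw.comp measurable_snd)).const_mul _
        · exact (measurable_fst.abs.mul (hF2.comp measurable_snd)).const_mul _
    _ = ENNReal.ofReal c1 * (eLpNorm (fun e : ℝ => |e| ^ (1 + γ) + m) (ENNReal.ofReal r) μ *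
          eLpNorm (polyWeight γ) (ENNReal.ofReal r) (tailLaw P ε a (j + 1))) +
        ENNReal.ofReal c2 * (eLpNorm (fun e : ℝ => |e|) (ENNReal.ofReal r) μ *
          eLpNorm (fun z => |z| * polyWeight γ z + L) (ENNReal.ofReal r)
            (tailLaw P ε a (j + 1))) := by
        rw [← eLpNorm_prod_mul hr0 hF1 hmw, ← eLpNorm_prod_mul hr0 (by fun_prop) hF2]
        have ec : ∀ (c : ℝ), 0 ≤ c → ∀ f : ℝ × ℝ → ℝ, eLpNorm (fun q => c * f q)
            (ENNReal.ofReal r) (μ.prod (tailLaw P ε a (j + 1))) = ENNReal.ofReal c *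
            eLpNorm f (ENNReal.ofReal r) (μ.prod (tailLaw P ε a (j + 1))) := by
          intro c hc f
          rw [← Real.enorm_eq_ofReal hc]
          exact eLpNorm_const_smul c f _ _
        rw [ec c1 hc10, ec c2 hc20]
    _ ≤ ENNReal.ofReal c1 * (ENNReal.ofReal E1 * ENNReal.ofReal R) +
        ENNReal.ofReal c2 * (ENNReal.ofReal E2 * ENNReal.ofReal (2 * R * x ^ (1 / p - κ))) := by
        rw [hE1e, hE2e]
        gcongr
    _ = ENNReal.ofReal (c1 * (E1 * R) + c2 * (E2 * (2 * R * x ^ (1 / p - κ)))) := by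
        rw [ENNReal.ofReal_add (by positivity) (by positivity), ENNReal.ofReal_mul hc10,
          ENNReal.ofReal_mul hc20, ENNReal.ofReal_mul hE10, ENNReal.ofReal_mul hE20]
    _ ≤ _ := by
        refine ENNReal.ofReal_le_ofReal ?_
        have haj := hc j
        have k1 : |a j| ^ (1 + γ) ≤ c₀ ^ (1 + γ) * x ^ (-(κ * (1 + γ))) := by
          calc _ ≤ (c₀ * x ^ (-κ)) ^ (1 + γ) :=
                Real.rpow_le_rpow (abs_nonneg _) haj (by linarith)
            _ = _ := by
                rw [Real.mul_rpow hc0 (by positivity), ← Real.rpow_mul hx0.le]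
                congr 2; ring
        -- The fluctuation of the derivative contributes the exponent -κ + (1/p - κ); that it is at
        -- most -κ(1 + γ) is precisely `hτ`.
        have k2 : |a j| * x ^ (1 / p - κ) ≤ c₀ * x ^ (-(κ * (1 + γ))) := by
          calc _ ≤ c₀ * x ^ (-κ) * x ^ (1 / p - κ) :=
                mul_le_mul_of_nonneg_right haj (by positivity)
            _ = c₀ * x ^ (-κ + (1 / p - κ)) := by rw [mul_assoc, ← Real.rpow_add hx0]
            _ ≤ _ := mul_le_mul_of_nonneg_left
                (Real.rpow_le_rpow_of_exponent_le hx1 (by linarith)) hc0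
        have k3 := mul_le_mul_of_nonneg_left k1 (show 0 ≤ 4 * N * (E1 * R) by positivity)
        have k4 := mul_le_mul_of_nonneg_left k2 (show 0 ≤ N * (E2 * (2 * R)) by positivity)
        rw [hc1, hc2]
        linarith

end CenteredInnovations

/-! ### Summation of increments over lags and innovation times. -/

section WindowSums

lemma add_rpow_le_two_rpow {r u v : ℝ} (hr : 0 ≤ r) (hu : 0 ≤ u) (hv : 0 ≤ v) :
    (u + v) ^ r ≤ 2 ^ r * (u ^ r + v ^ r) := by
  have h1 : u + v ≤ 2 * max u v := by
    linarith [le_max_left u v, le_max_right u v]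
  calc (u + v) ^ r ≤ (2 * max u v) ^ r := Real.rpow_le_rpow (by positivity) h1 hr
    _ = 2 ^ r * (max u v) ^ r := Real.mul_rpow (by norm_num) (by positivity)
    _ ≤ _ := by
      refine mul_le_mul_of_nonneg_left ?_ (by positivity)
      have := Real.rpow_nonneg hu r
      have := Real.rpow_nonneg hv r
      rcases max_cases u v with ⟨h, -⟩ | ⟨h, -⟩ <;> rw [h] <;> linarith

/-- The inner sum is an integer c(l), counting the times at lag less than J from the innovation l.
It is at most J and has total at most nJ, and c^r ≤ c² ≤ J c since r ≤ 2. -/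
lemma sum_window_card_rpow_le {r : ℝ} (hr : 0 < r) (hr2 : r ≤ 2) (J n N : ℕ) :
    ∑ l ∈ Finset.range (N + n), (∑ s ∈ Finset.range n,
      if l ≤ s + N then (if s + N - l < J then (1 : ℝ) else 0) else 0) ^ r ≤ J ^ 2 * n := by
  set c : ℕ → ℕ := fun l => ((Finset.range n).filter fun s => l ≤ s + N ∧ s + N - l < J).card
  have hc : ∀ l, (∑ s ∈ Finset.range n,
      if l ≤ s + N then (if s + N - l < J then (1 : ℝ) else 0) else 0) = c l := by
    intro l
    simp only [c, Finset.card_filter, ← ite_and]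
    push_cast
    rfl
  have hcJ : ∀ l, c l ≤ J := by
    intro l
    calc c l ≤ ((Finset.Ico (l - N) (l - N + J))).card := by
          refine Finset.card_le_card fun s hs => ?_
          simp only [Finset.mem_filter, Finset.mem_Ico] at hs ⊢
          omega
      _ = J := by simp
  have hcr : ∀ l, (c l : ℝ) ^ r ≤ J * c l := by
    intro l
    rcases Nat.eq_zero_or_pos (c l) with h0 | h0
    · rw [h0]; simp [Real.zero_rpow hr.ne']
    · have h1 : (1 : ℝ) ≤ c l := by exact_mod_cast h0
      have h2 : (c l : ℝ) ≤ J := by exact_mod_cast hcJ l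
      calc (c l : ℝ) ^ r ≤ (c l : ℝ) ^ (2 : ℝ) := Real.rpow_le_rpow_of_exponent_le h1 hr2
        _ = c l * c l := by rw [Real.rpow_two]; ring
        _ ≤ _ := mul_le_mul_of_nonneg_right h2 (by positivity)
  have hsum : ∑ l ∈ Finset.range (N + n), (c l : ℝ) ≤ n * J := by
    have : ∑ l ∈ Finset.range (N + n), c l ≤ n * J := by
      simp only [c, Finset.card_filter]
      rw [Finset.sum_comm]
      calc _ ≤ ∑ s ∈ Finset.range n, J := by
            refine Finset.sum_le_sum fun s _ => ?_
            rw [← Finset.card_filter]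
            calc _ ≤ ((Finset.Ico (s + N + 1 - J) (s + N + 1))).card := by
                  refine Finset.card_le_card fun l hl => ?_
                  simp only [Finset.mem_filter, Finset.mem_Ico] at hl ⊢
                  omega
              _ ≤ J := by rw [Nat.card_Ico]; omega
        _ = n * J := by simp
    exact_mod_cast this
  simp_rw [hc]
  calc _ ≤ ∑ l ∈ Finset.range (N + n), (J : ℝ) * c l := Finset.sum_le_sum fun l _ => hcr l
    _ = J * ∑ l ∈ Finset.range (N + n), (c l : ℝ) := by rw [Finset.mul_sum]
    _ ≤ J * (n * J) := mul_le_mul_of_nonneg_left hsum (by positivity)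
    _ = _ := by ring

/-- Q is the size of the first J increments and A j^(-b) that of the others. The two parts are
separated before and after summation, the root 1/r being subadditive, and (1 + r(1 - b))/r = 1 + 1/r
- b. -/
lemma exists_window_bound {b r : ℝ} (hb0 : 0 < b) (hb1 : b < 1) (hr : 1 < r) (hr2 : r ≤ 2)
    (hbr : 1 < b * r) (J : ℕ) :
    ∃ C : ℝ, 0 < C ∧ ∀ (Q A : ℝ) (n N : ℕ), 0 ≤ Q → 0 ≤ A → 1 ≤ n →
      (2 * r * ∑ l ∈ Finset.range (N + n), (∑ s ∈ Finset.range n, if l ≤ s + N then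
        ((if s + N - l < J then Q else 0) + A * (((s + N - l : ℕ) : ℝ) + 1) ^ (-b)) else 0) ^ r)
          ^ (1 / r) ≤ C * (Q * (n : ℝ) ^ (1 / r) + A * (n : ℝ) ^ (1 + 1 / r - b)) := by
  obtain ⟨C, hC, hCb⟩ := sum_window_rpow_le hb0 hb1 hr.le hbr
  have hr0 : 0 < r := by linarith
  set c1 : ℝ := (2 * r * 2 ^ r * J ^ 2) ^ (1 / r)
  set c2 : ℝ := (2 * r * 2 ^ r * C) ^ (1 / r)
  have hc1 : 0 ≤ c1 := by positivity
  have hc2 : 0 ≤ c2 := by positivity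
  refine ⟨c1 + c2 + 1, by positivity, fun Q A n N hQ hA hn => ?_⟩
  have hn0 : (0 : ℝ) < n := by exact_mod_cast hn
  set u : ℕ → ℝ := fun l => ∑ s ∈ Finset.range n,
    if l ≤ s + N then (if s + N - l < J then (1 : ℝ) else 0) else 0
  set v : ℕ → ℝ := fun l => ∑ s ∈ Finset.range n,
    if l ≤ s + N then (((s + N - l : ℕ) : ℝ) + 1) ^ (-b) else 0
  have hu : ∀ l, 0 ≤ u l := fun l => Finset.sum_nonneg fun s _ => by split_ifs <;> norm_num
  have hv : ∀ l, 0 ≤ v l := fun l => Finset.sum_nonneg fun s _ => by split_ifs <;> positivity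
  have e : ∀ l, (∑ s ∈ Finset.range n, if l ≤ s + N then
        ((if s + N - l < J then Q else 0) + A * (((s + N - l : ℕ) : ℝ) + 1) ^ (-b)) else 0) =
      Q * u l + A * v l := by
    intro l
    simp only [u, v, Finset.mul_sum, ← Finset.sum_add_distrib]
    refine Finset.sum_congr rfl fun s _ => ?_
    split_ifs <;> ring
  simp_rw [e]
  have h1 : ∑ l ∈ Finset.range (N + n), (Q * u l + A * v l) ^ r ≤
      2 ^ r * (Q ^ r * (J ^ 2 * n) + A ^ r * (C * (n : ℝ) ^ (1 + r * (1 - b)))) := by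
    calc _ ≤ ∑ l ∈ Finset.range (N + n), 2 ^ r * (Q ^ r * u l ^ r + A ^ r * v l ^ r) := by
          refine Finset.sum_le_sum fun l _ => ?_
          rw [← Real.mul_rpow hQ (hu l), ← Real.mul_rpow hA (hv l)]
          exact add_rpow_le_two_rpow hr0.le (mul_nonneg hQ (hu l)) (mul_nonneg hA (hv l))
      _ = 2 ^ r * (Q ^ r * ∑ l ∈ Finset.range (N + n), u l ^ r +
          A ^ r * ∑ l ∈ Finset.range (N + n), v l ^ r) := by
          rw [← Finset.mul_sum, Finset.sum_add_distrib, Finset.mul_sum, Finset.mul_sum]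
      _ ≤ _ := by
          refine mul_le_mul_of_nonneg_left (add_le_add (mul_le_mul_of_nonneg_left ?_ ?_)
            (mul_le_mul_of_nonneg_left (hCb n N hn) ?_)) (by positivity)
          · exact sum_window_card_rpow_le hr0 hr2 J n N
          · positivity
          · positivity
  have hs0 : 0 ≤ ∑ l ∈ Finset.range (N + n), (Q * u l + A * v l) ^ r :=
    Finset.sum_nonneg fun l _ => Real.rpow_nonneg
      (add_nonneg (mul_nonneg hQ (hu l)) (mul_nonneg hA (hv l))) _
  have hinv : 0 ≤ 1 / r := by positivity
  have hroot : ∀ y : ℝ, 0 ≤ y → (y ^ r) ^ (1 / r) = y := fun y hy => by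
    rw [← Real.rpow_mul hy, mul_one_div_cancel hr0.ne', Real.rpow_one]
  calc _ ≤ (2 * r * (2 ^ r * (Q ^ r * (J ^ 2 * n) +
        A ^ r * (C * (n : ℝ) ^ (1 + r * (1 - b)))))) ^ (1 / r) :=
        Real.rpow_le_rpow (by positivity) (mul_le_mul_of_nonneg_left h1 (by positivity)) hinv
    _ = ((2 * r * 2 ^ r * J ^ 2) * Q ^ r * n +
        (2 * r * 2 ^ r * C) * A ^ r * (n : ℝ) ^ (1 + r * (1 - b))) ^ (1 / r) := by
        congr 1; ring
    _ ≤ ((2 * r * 2 ^ r * J ^ 2) * Q ^ r * n) ^ (1 / r) +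
        ((2 * r * 2 ^ r * C) * A ^ r * (n : ℝ) ^ (1 + r * (1 - b))) ^ (1 / r) :=
        Real.rpow_add_le_add_rpow (by positivity) (by positivity) hinv
          (by rw [div_le_one hr0]; exact hr.le)
    _ = c1 * (Q * (n : ℝ) ^ (1 / r)) + c2 * (A * (n : ℝ) ^ (1 + 1 / r - b)) := by
        rw [Real.mul_rpow (by positivity) hn0.le, Real.mul_rpow (by positivity) (by positivity),
          Real.mul_rpow (x := 2 * r * 2 ^ r * C * A ^ r) (by positivity) (by positivity),
          Real.mul_rpow (x := 2 * r * 2 ^ r * C) (by positivity) (by positivity),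
          hroot Q hQ, hroot A hA, ← Real.rpow_mul hn0.le,
          show (1 + r * (1 - b)) * (1 / r) = 1 + 1 / r - b by field_simp; ring]
        ring
    _ ≤ _ := by
        have p1 : 0 ≤ Q * (n : ℝ) ^ (1 / r) := by positivity
        have p2 : 0 ≤ A * (n : ℝ) ^ (1 + 1 / r - b) := by positivity
        nlinarith

/-- The index l stands for the innovation time l + 1 - N; seen from the time s + 1, the lag is s + N
- l. -/
lemma sum_window_reflect {M : Type*} [AddCommMonoid M] (f : ℕ → ℕ → M) (n N : ℕ) :
    ∑ l ∈ Finset.range (N + n), ∑ s ∈ Finset.range n,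
      (if l ≤ s + N then f s (s + N - l) else 0) =
    ∑ s ∈ Finset.range n, ∑ j ∈ Finset.range (s + N + 1), f s j := by
  rw [Finset.sum_comm]
  refine Finset.sum_congr rfl fun s hs => ?_
  have hs := Finset.mem_range.1 hs
  rw [← Finset.sum_range_reflect (f s), ← Finset.sum_filter]
  refine Finset.sum_congr ?_ fun l _ => ?_
  · ext l
    simp only [Finset.mem_filter, Finset.mem_range]
    omega
  · congr 1

end WindowSums

/-! ### Martingale decomposition. -/

/-- The average of `G` over the first `j` terms of the moving average. -/
noncomputable def blockAvg (μ : Measure ℝ) (a : ℕ → ℝ) (G : ℝ → ℝ) (j : ℕ) : ℝ → ℝ :=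
  avg (blockLaw μ a j) G

/-- The martingale increment of `G(X_t) - D X_t` at time `t - j`, as a function of the innovation
at this time and of the contribution of the past. -/
noncomputable def increment (μ : Measure ℝ) (a : ℕ → ℝ) (G : ℝ → ℝ) (D : ℝ) (j : ℕ)
    (q : ℝ × ℝ) : ℝ :=
  blockAvg μ a G j (a j * q.1 + q.2) - blockAvg μ a G (j + 1) q.2 - D * (a j * q.1)

lemma measurable_pair {X E F : Type*} {m : MeasurableSpace X} [MeasurableSpace E]
    [MeasurableSpace F] {f : X → E} {g : X → F} (hf : Measurable f) (hg : Measurable g) :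
    Measurable fun x => (f x, g x) := hf.prodMk hg

section Increment

variable {μ : Measure ℝ} [IsProbabilityMeasure μ] {a : ℕ → ℝ} {G : ℝ → ℝ} {γ A D : ℝ}

lemma blockAvg_zero : blockAvg μ a G 0 = G := by
  ext x; simp [blockAvg, blockLaw, avg]

lemma measurable_blockAvg (hG : Measurable G) (j : ℕ) : Measurable (blockAvg μ a G j) :=
  measurable_avg hG

lemma measurable_increment (hG : Measurable G) (j : ℕ) : Measurable (increment μ a G D j) := by
  have h1 : Measurable fun q : ℝ × ℝ => a j * q.1 := measurable_fst.const_mul _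
  exact (((measurable_blockAvg hG j).comp (h1.add measurable_snd)).sub
    ((measurable_blockAvg hG (j + 1)).comp measurable_snd)).sub (h1.const_mul D)

lemma blockAvg_succ (hγ : 0 ≤ γ) (hG : Measurable G) (hA : ∀ x, |G x| ≤ A * polyWeight γ x)
    (hw : Integrable (polyWeight γ) μ) (j : ℕ) :
    blockAvg μ a G (j + 1) = avg (μ.map (fun x => a j * x)) (blockAvg μ a G j) :=
  avg_conv hγ hG hA (integrable_polyWeight_blockLaw hγ hw a j)
    (integrable_polyWeight_map_mul hγ hw _)

lemma integral_increment_eq_zero (hγ : 0 ≤ γ) (hG : Measurable G)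
    (hA : ∀ x, |G x| ≤ A * polyWeight γ x) (hw : Integrable (polyWeight γ) μ)
    (hμ1 : Integrable (fun e => e) μ) (hμ0 : ∫ e, e ∂μ = 0) (j : ℕ) (z : ℝ) :
    Integrable (fun e => increment μ a G D j (e, z)) μ ∧
      ∫ e, increment μ a G D j (e, z) ∂μ = 0 := by
  have hm := measurable_blockAvg (μ := μ) (a := a) hG j
  have hgr := abs_avg_le hγ hA (integrable_polyWeight_blockLaw hγ hw a j) le_rfl
  have hmz : Measurable fun x => blockAvg μ a G j (z + x) := hm.comp (measurable_const_add z)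
  have h1 : Integrable (fun e => blockAvg μ a G j (a j * e + z)) μ := by
    have := integrable_comp_add hγ hm hgr (integrable_polyWeight_map_mul hγ hw (a j)) z
    rw [integrable_map_measure hmz.aestronglyMeasurable (by fun_prop)] at this
    refine this.congr (ae_of_all _ fun e => ?_)
    simp only [Function.comp_apply, add_comm]
  have h2 : Integrable (fun e => D * (a j * e)) μ := (hμ1.const_mul _).const_mul _
  have h3 : Integrable (fun e => blockAvg μ a G j (a j * e + z) - blockAvg μ a G (j + 1) z) μ :=
    h1.sub (integrable_const _)
  refine ⟨h3.sub h2, ?_⟩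
  simp only [increment]
  rw [integral_sub h3 h2, integral_sub h1 (integrable_const _), integral_const_mul,
    integral_const_mul, hμ0, blockAvg_succ hγ hG hA hw, avg,
    integral_map (by fun_prop) hmz.aestronglyMeasurable]
  simp [add_comm z]

end Increment

namespace CenteredInnovations

variable {Ω : Type*} [MeasurableSpace Ω] {P : Measure Ω} [IsProbabilityMeasure P]
  {ε : ℤ → Ω → ℝ} {p r γ c₀ κ A B D : ℝ} {a : ℕ → ℝ} {G : ℝ → ℝ}

lemma integral_law (h : CenteredInnovations P ε p) : ∫ e, e ∂(P.map (ε 0)) = 0 := by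
  rw [integral_map (h.measurable 0).aemeasurable measurable_id'.aestronglyMeasurable]
  exact h.centered

/-- The expansion of `G(X_t) - D X_t` into increments. -/
lemma ae_eq_sum_increment (h : CenteredInnovations P ε p)
    (hB : ∀ N, ∑ i ∈ Finset.range N, |a i| ^ p ≤ B) (G : ℝ → ℝ) (D : ℝ) (t : ℤ) (J : ℕ) :
    ∀ᵐ ω ∂P, G (linearProcess a ε t ω) - D * linearProcess a ε t ω =
      ∑ j ∈ Finset.range J, increment (P.map (ε 0)) a G D j
        (ε (t - j) ω, linearProcess (fun i => a (i + (j + 1))) ε (t - j - 1) ω) +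
      (blockAvg (P.map (ε 0)) a G J (linearProcess (fun i => a (i + J)) ε (t - J) ω) -
        D * linearProcess (fun i => a (i + J)) ε (t - J) ω) := by
  have := h.isProbabilityMeasure_law
  induction J with
  | zero => simp [blockAvg_zero]
  | succ J ih =>
    filter_upwards [ih, h.ae_linearProcess_eq (b := fun i => a (i + J))
      (sum_shift_abs_rpow_le hB J) (t - J)] with ω h1 h2
    rw [h1, Finset.sum_range_succ, h2]
    have e : (fun i => a (i + 1 + J)) = fun i => a (i + (J + 1)) := by
      ext i; congr 1; ring
    simp only [e, zero_add, increment]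
    push_cast
    rw [show t - ((J : ℤ) + 1) = t - J - 1 by ring]
    ring

/-- The increments occurring at time `k` are orthogonal to functions of the past. -/
lemma integral_signedPow_mul_eq_zero (h : CenteredInnovations P ε p) (hr : 1 < r)
    (hγ : 0 ≤ γ) (hγ1 : γ ≤ 1) (hG : Measurable G) (hA : ∀ x, |G x| ≤ A * polyWeight γ x)
    {k : ℤ} {W : Ω → ℝ} (hW : Measurable[pastInnovations ε (k - 1)] W)
    (s : Finset ℕ) (J : ℕ → ℕ)
    (hWr : MemLp W (ENNReal.ofReal r) P)
    (hDr : MemLp (fun ω => ∑ i ∈ s, increment (P.map (ε 0)) a G D (J i)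
      (ε k ω, linearProcess (fun i' => a (i' + (J i + 1))) ε (k - 1) ω)) (ENNReal.ofReal r) P) :
    ∫ ω, signedPow (r - 1) (W ω) * ∑ i ∈ s, increment (P.map (ε 0)) a G D (J i)
      (ε k ω, linearProcess (fun i' => a (i' + (J i + 1))) ε (k - 1) ω) ∂P = 0 := by
  have := h.isProbabilityMeasure_law
  have hw := h.integrable_polyWeight_law hγ1
  have hμ1 : Integrable (fun e : ℝ => e) (P.map (ε 0)) :=
    h.memLp_law.integrable (by simpa using h.one_lt.le)
  -- All tails at time k - 1 are gathered in one random sequence, so that the innovation at time k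
  -- is independent of W and of every tail jointly.
  set Z : Ω → (ℕ → ℝ) := fun ω j => linearProcess (fun i' => a (i' + (j + 1))) ε (k - 1) ω
  have hZ : Measurable[pastInnovations ε (k - 1)] Z :=
    @measurable_pi_lambda _ _ _ (pastInnovations ε (k - 1)) _ _ fun j =>
      measurable_linearProcess_past _ _
  have hWZ : Measurable[pastInnovations ε (k - 1)] fun ω => (W ω, Z ω) :=
    measurable_pair hW hZ
  have hle := h.past_le (k - 1)
  set F : ℝ × (ℕ → ℝ) → ℝ := fun q =>
    ∑ i ∈ s, increment (P.map (ε 0)) a G D (J i) (q.1, q.2 (J i))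
  have hF : Measurable F := Finset.measurable_sum _ fun i _ =>
    (measurable_increment hG (J i)).comp
      (measurable_fst.prodMk ((measurable_pi_apply _).comp measurable_snd))
  have hF0 : ∀ z, ∫ e, F (e, z) ∂(P.map (ε k)) = 0 := by
    intro z
    rw [(h.ident k).map_eq]
    have key := fun i => integral_increment_eq_zero (D := D) (a := a) hγ hG hA hw hμ1
      h.integral_law (J i) (z (J i))
    rw [integral_finsetSum _ fun i _ => (key i).1]
    exact Finset.sum_eq_zero fun i _ => (key i).2
  exact integral_comp_mul_eq_zero (h.measurable k) (hW.mono hle le_rfl) (hZ.mono hle le_rfl)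
    (h.indepFun_past (by omega) hWZ) (measurable_signedPow (r - 1)) hF hF0
    (integrable_signedPow_mul hr hWr hDr)

lemma map_innovation_tail (h : CenteredInnovations P ε p) (j : ℕ) (k : ℤ) :
    P.map (fun ω => (ε k ω, linearProcess (fun i => a (i + j)) ε (k - 1) ω)) =
      (P.map (ε 0)).prod (tailLaw P ε a j) := by
  have hind : IndepFun (ε k) (linearProcess (fun i => a (i + j)) ε (k - 1)) P :=
    h.indepFun_past (by omega) (measurable_linearProcess_past _ _)
  rw [(indepFun_iff_map_prod_eq_prod_map_map (h.measurable k).aemeasurable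
    (h.measurable_linearProcess_at _ _).aemeasurable).1 hind, (h.ident k).map_eq, h.map_tail_eq]

lemma eLpNorm_increment_eq (h : CenteredInnovations P ε p) (hG : Measurable G) (q : ℝ≥0∞)
    (j : ℕ) (k : ℤ) :
    eLpNorm (fun ω => increment (P.map (ε 0)) a G D j
      (ε k ω, linearProcess (fun i => a (i + (j + 1))) ε (k - 1) ω)) q P =
    eLpNorm (increment (P.map (ε 0)) a G D j) q
      ((P.map (ε 0)).prod (tailLaw P ε a (j + 1))) := by
  have := h.isProbabilityMeasure_law
  rw [← h.map_innovation_tail (j + 1) k, eLpNorm_map_measure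
    (measurable_increment hG j).aestronglyMeasurable
    ((h.measurable k).prodMk (h.measurable_linearProcess_at _ _)).aemeasurable]
  rfl

/-- A bound for the martingale part of the partial sums. -/
lemma eLpNorm_sum_increment_le (h : CenteredInnovations P ε p) (hr : 1 < r) (hr2 : r ≤ 2)
    (hγ : 0 ≤ γ) (hγ1 : γ ≤ 1) (hG : Measurable G) (hA : ∀ x, |G x| ≤ A * polyWeight γ x)
    {η : ℕ → ℝ} (hη0 : ∀ j, 0 ≤ η j)
    (hη : ∀ j, eLpNorm (increment (P.map (ε 0)) a G D j) (ENNReal.ofReal r)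
      ((P.map (ε 0)).prod (tailLaw P ε a (j + 1))) ≤ ENNReal.ofReal (η j)) (n N : ℕ) :
    eLpNorm (fun ω => ∑ s ∈ Finset.range n, ∑ j ∈ Finset.range (s + N + 1),
      increment (P.map (ε 0)) a G D j (ε ((s : ℤ) + 1 - j) ω,
        linearProcess (fun i => a (i + (j + 1))) ε ((s : ℤ) + 1 - j - 1) ω))
      (ENNReal.ofReal r) P ≤
    ENNReal.ofReal ((2 * r * ∑ l ∈ Finset.range (N + n), (∑ s ∈ Finset.range n,
      if l ≤ s + N then η (s + N - l) else 0) ^ r) ^ (1 / r)) := by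
  have := h.isProbabilityMeasure_law
  have hr0 : 0 < r := by linarith
  have hrr : (1 : ℝ≥0∞) ≤ ENNReal.ofReal r := by simpa using hr.le
  set μ := P.map (ε 0) with hμ
  set I : ℕ → ℤ → Ω → ℝ := fun j k ω => increment μ a G D j
    (ε k ω, linearProcess (fun i => a (i + (j + 1))) ε (k - 1) ω) with hI
  have hIpast : ∀ j k, Measurable[pastInnovations ε k] (I j k) := fun j k =>
    (measurable_increment hG j).comp (measurable_pair
      (measurable_pastInnovations le_rfl) ((measurable_linearProcess_past _ (k - 1)).mono
        (pastInnovations_mono (sub_le_self k zero_le_one)) le_rfl))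
  have hInorm : ∀ j k, eLpNorm (I j k) (ENNReal.ofReal r) P ≤ ENNReal.ofReal (η j) := fun j k =>
    (h.eLpNorm_increment_eq hG _ j k).trans_le (hη j)
  have hImem : ∀ j k, MemLp (I j k) (ENNReal.ofReal r) P := fun j k =>
    ⟨((hIpast j k).mono (h.past_le k) le_rfl).aestronglyMeasurable,
      (hInorm j k).trans_lt ENNReal.ofReal_lt_top⟩
  -- All increments driven by one innovation, whatever the time s + 1 they come from. The triangle
  -- inequality bounds each group; the groups are then combined by orthogonality.
  set Δ : ℕ → Ω → ℝ := fun l ω => ∑ s ∈ (Finset.range n).filter fun s => l ≤ s + N,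
    I (s + N - l) ((l : ℤ) + 1 - N) ω with hΔ
  have hΔpast : ∀ l : ℕ, Measurable[pastInnovations ε ((l : ℤ) + 1 - N)] (Δ l) := fun l =>
    @Finset.measurable_sum _ _ _ _ _ _ (pastInnovations ε ((l : ℤ) + 1 - N)) _ _
      fun s _ => hIpast _ _
  have hΔmem : ∀ l, MemLp (Δ l) (ENNReal.ofReal r) P := fun l =>
    memLp_finsetSum _ fun s _ => hImem _ _
  have hΔnorm : ∀ l, ∫ ω, |Δ l ω| ^ r ∂P ≤
      (∑ s ∈ Finset.range n, if l ≤ s + N then η (s + N - l) else 0) ^ r := by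
    intro l
    have h0 : 0 ≤ ∑ s ∈ Finset.range n, if l ≤ s + N then η (s + N - l) else 0 :=
      Finset.sum_nonneg fun s _ => by split_ifs; exacts [hη0 _, le_rfl]
    have h1 : eLpNorm (Δ l) (ENNReal.ofReal r) P ≤
        ENNReal.ofReal (∑ s ∈ Finset.range n, if l ≤ s + N then η (s + N - l) else 0) := by
      rw [← Finset.sum_filter, ENNReal.ofReal_sum_of_nonneg fun s _ => hη0 _]
      have e : Δ l = ∑ s ∈ (Finset.range n).filter fun s => l ≤ s + N,
          I (s + N - l) ((l : ℤ) + 1 - N) := by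
        ext ω; simp [hΔ]
      rw [e]
      exact (eLpNorm_sum_le (fun s _ => (hImem _ _).1) hrr).trans
        (Finset.sum_le_sum fun s _ => hInorm _ _)
    rw [eLpNorm_ofReal_eq hr0 (hΔmem l), ENNReal.ofReal_le_ofReal_iff h0] at h1
    have hI0 : 0 ≤ ∫ ω, |Δ l ω| ^ r ∂P := integral_nonneg fun ω => by positivity
    have h2 := Real.rpow_le_rpow (by positivity) h1 hr0.le
    rwa [← Real.rpow_mul hI0, one_div_mul_cancel hr0.ne', Real.rpow_one] at h2
  have horth : ∀ l < N + n,
      ∫ ω, signedPow (r - 1) (∑ i ∈ Finset.range l, Δ i ω) * Δ l ω ∂P = 0 := by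
    intro l _
    have hW : Measurable[pastInnovations ε ((l : ℤ) + 1 - N - 1)]
        fun ω => ∑ i ∈ Finset.range l, Δ i ω :=
      @Finset.measurable_sum _ _ _ _ _ _ (pastInnovations ε ((l : ℤ) + 1 - N - 1)) _ _
        fun i hi => (hΔpast i).mono (pastInnovations_mono (by
          have := Finset.mem_range.1 hi
          omega)) le_rfl
    exact h.integral_signedPow_mul_eq_zero hr hγ hγ1 hG hA hW _ (fun s => s + N - l)
      (memLp_finsetSum _ fun i _ => hΔmem i) (hΔmem l)
  have e : (fun ω => ∑ s ∈ Finset.range n, ∑ j ∈ Finset.range (s + N + 1),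
      I j ((s : ℤ) + 1 - j) ω) = fun ω => ∑ l ∈ Finset.range (N + n), Δ l ω := by
    ext ω
    rw [← sum_window_reflect (fun s j => I j ((s : ℤ) + 1 - j) ω)]
    refine Finset.sum_congr rfl fun l _ => ?_
    rw [← Finset.sum_filter]
    refine Finset.sum_congr rfl fun s hs => ?_
    have hs := (Finset.mem_filter.1 hs).2
    congr 1
    omega
  have hgoal := integral_abs_sum_rpow_le hr hr2 Δ (N + n) (fun k _ => hΔmem k) horth
  change eLpNorm (fun ω => ∑ s ∈ Finset.range n, ∑ j ∈ Finset.range (s + N + 1),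
      I j ((s : ℤ) + 1 - j) ω) (ENNReal.ofReal r) P ≤ _
  rw [e, eLpNorm_ofReal_eq hr0 (memLp_finsetSum _ fun i _ => hΔmem i)]
  refine ENNReal.ofReal_le_ofReal (Real.rpow_le_rpow (integral_nonneg fun ω => by positivity)
    (hgoal.trans ?_) (by positivity))
  exact mul_le_mul_of_nonneg_left (Finset.sum_le_sum fun l _ => hΔnorm l) (by positivity)

end CenteredInnovations

lemma exists_sum_abs_rpow_le {a : ℕ → ℝ} {c₀ κ p : ℝ} (hp : 0 < p)
    (hc : ∀ j : ℕ, |a j| ≤ c₀ * ((j : ℝ) + 1) ^ (-κ)) (hpκ : 1 < p * κ) :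
    ∃ B, ∀ N, ∑ i ∈ Finset.range N, |a i| ^ p ≤ B :=
  ⟨_, fun N => by simpa using sum_tail_abs_rpow_le hp hc hpκ 0 N⟩

/-! ### The linearization error, uniformly in the function. -/

namespace CenteredInnovations

variable {Ω : Type*} [MeasurableSpace Ω] {P : Measure Ω} [IsProbabilityMeasure P]
  {ε : ℤ → Ω → ℝ} {p r γ c₀ κ A B D M : ℝ} {a : ℕ → ℝ} {G : ℝ → ℝ} {J : ℕ}

lemma memLp_linearProcess_at (h : CenteredInnovations P ε p) {b : ℕ → ℝ}
    (hB : ∀ N, ∑ i ∈ Finset.range N, |b i| ^ p ≤ B) (t : ℤ) :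
    MemLp (linearProcess b ε t) (ENNReal.ofReal p) P :=
  ⟨(h.measurable_linearProcess_at b t).aestronglyMeasurable,
    (h.eLpNorm_linearProcess_le hB t).trans_lt ENNReal.ofReal_lt_top⟩

lemma integrable_polyWeight_tailLaw (h : CenteredInnovations P ε p) (hγ1 : γ ≤ 1)
    (hB : ∀ N, ∑ i ∈ Finset.range N, |a i| ^ p ≤ B) (j : ℕ) :
    Integrable (polyWeight γ) (tailLaw P ε a j) := by
  have hm := h.measurable_linearProcess_at (fun i => a (i + j)) 0
  rw [tailLaw, integrable_map_measure (measurable_polyWeight γ).aestronglyMeasurable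
    hm.aemeasurable]
  have hi := (h.memLp_linearProcess_at (sum_shift_abs_rpow_le hB j) 0).integrable
    (by simpa using h.one_lt.le)
  refine ((integrable_const 1).add hi.abs).mono'
    ((measurable_polyWeight γ).comp hm).aestronglyMeasurable (ae_of_all _ fun ω => ?_)
  rw [Real.norm_eq_abs, Function.comp_apply, abs_of_pos (polyWeight_pos _ _)]
  exact polyWeight_le_one_add hγ1 _

/-- Once the first `J` terms are smoothing, the averages over more terms are uniformly smooth. -/
lemma exists_smoothGrowth_blockAvg (h : CenteredInnovations P ε p) (hγ : 0 ≤ γ) (hγ1 : γ ≤ 1)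
    (hB : ∀ N, ∑ i ∈ Finset.range N, |a i| ^ p ≤ B)
    (hs : IsSmoothing γ M (blockLaw (P.map (ε 0)) a J)) :
    ∃ M', 0 ≤ M' ∧ ∀ (G : ℝ → ℝ) (A : ℝ), Measurable G → (∀ x, |G x| ≤ A * polyWeight γ x) →
      ∀ j, J ≤ j → SmoothGrowth γ (A * M') (blockAvg (P.map (ε 0)) a G j) := by
  have := h.isProbabilityMeasure_law
  have hw := h.integrable_polyWeight_law hγ1
  -- The smoothing constant is not assumed nonnegative; testing on the zero function with growth
  -- constant 1 shows that it is.
  have hM : 0 ≤ M := by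
    have h0 : SmoothGrowth γ (1 * M) _ := hs (fun _ => 0) 1 measurable_const
      fun x => by simpa using (polyWeight_pos γ x).le
    simpa using h0.nonneg
  have hB0 : 0 ≤ B := by simpa using hB 0
  have hI : 0 ≤ ∫ ω, |ε 0 ω| ^ p ∂P := integral_nonneg fun ω => by positivity
  have hp := h.one_lt
  refine ⟨M * (1 + (2 * p * (B * ∫ ω, |ε 0 ω| ^ p ∂P)) ^ (1 / p)), by positivity,
    fun G A hG hA j hj => ?_⟩
  obtain ⟨k, rfl⟩ := Nat.exists_eq_add_of_le hj
  have hc := hs.conv hγ (integrable_polyWeight_blockLaw hγ hw a J)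
    (integrable_polyWeight_blockLaw hγ hw (fun i => a (i + J)) k)
    (h.integral_polyWeight_blockLaw_le hγ1 (sum_shift_abs_rpow_le hB J) k)
  rw [← blockLaw_add] at hc
  exact hc G A hG hA

lemma avg_tailLaw_zero (h : CenteredInnovations P ε p) (hγ : 0 ≤ γ) (hγ1 : γ ≤ 1)
    (hB : ∀ N, ∑ i ∈ Finset.range N, |a i| ^ p ≤ B) (hG : Measurable G)
    (hA : ∀ x, |G x| ≤ A * polyWeight γ x) (j : ℕ) :
    avg (tailLaw P ε a 0) G = avg (tailLaw P ε a j) (blockAvg (P.map (ε 0)) a G j) := by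
  have := h.isProbabilityMeasure_law
  have := h.isProbabilityMeasure_tailLaw (a := a) j
  rw [h.tailLaw_zero_eq hB j]
  exact avg_conv hγ hG hA (integrable_polyWeight_blockLaw hγ (h.integrable_polyWeight_law hγ1) a j)
    (h.integrable_polyWeight_tailLaw hγ1 hB j)

lemma integral_tailLaw_zero (h : CenteredInnovations P ε p) (hγ : 0 ≤ γ) (hγ1 : γ ≤ 1)
    (hB : ∀ N, ∑ i ∈ Finset.range N, |a i| ^ p ≤ B) (hG : Measurable G)
    (hA : ∀ x, |G x| ≤ A * polyWeight γ x) (j : ℕ) :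
    ∫ z, G z ∂(tailLaw P ε a 0) =
      ∫ z, blockAvg (P.map (ε 0)) a G j z ∂(tailLaw P ε a j) := by
  have := congrFun (h.avg_tailLaw_zero hγ hγ1 hB hG hA j) 0
  simpa [avg] using this

/-- Rewriting E[G(X_0 + x)] as the expectation of the smooth G_j at V_j + x allows differentiation
under the integral. The left side does not depend on j, so the same D centres the derivatives of all
smooth G_j. -/
lemma hasDerivAt_avg_tailLaw_zero (h : CenteredInnovations P ε p) (hγ : 0 ≤ γ) (hγ1 : γ ≤ 1)
    (hB : ∀ N, ∑ i ∈ Finset.range N, |a i| ^ p ≤ B) (hG : Measurable G)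
    (hA : ∀ x, |G x| ≤ A * polyWeight γ x) {j : ℕ}
    (hg : SmoothGrowth γ M (blockAvg (P.map (ε 0)) a G j)) :
    HasDerivAt (avg (tailLaw P ε a 0) G)
      (∫ z, deriv (blockAvg (P.map (ε 0)) a G j) z ∂(tailLaw P ε a j)) 0 := by
  rw [h.avg_tailLaw_zero hγ hγ1 hB hG hA j]
  have := hg.hasDerivAt_avg hγ (h.integrable_polyWeight_tailLaw hγ1 hB j) 0
  simpa [avg] using this

/-- A crude bound for the increments, used for the first ones. -/
lemma eLpNorm_increment_le (h : CenteredInnovations P ε p) (hr : 1 < r) (hrp : r ≤ p)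
    (hB : ∀ N, ∑ i ∈ Finset.range N, |a i| ^ p ≤ B) (hG : Measurable G) {Q : ℝ} (hQ0 : 0 ≤ Q)
    (hQ : eLpNorm G (ENNReal.ofReal r) (tailLaw P ε a 0) ≤ ENNReal.ofReal Q) (hD : |D| ≤ Q)
    (haj : ∀ j, |a j| ≤ c₀) (j : ℕ) :
    eLpNorm (increment (P.map (ε 0)) a G D j) (ENNReal.ofReal r)
      ((P.map (ε 0)).prod (tailLaw P ε a (j + 1))) ≤
    ENNReal.ofReal ((2 + c₀ * (eLpNorm (ε 0) (ENNReal.ofReal r) P).toReal) * Q) := by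
  have := h.isProbabilityMeasure_law
  have := fun j => h.isProbabilityMeasure_tailLaw (a := a) j
  have hrr : (1 : ℝ≥0∞) ≤ ENNReal.ofReal r := by simpa using hr.le
  have hc0 : 0 ≤ c₀ := (abs_nonneg _).trans (haj 0)
  have hε : eLpNorm (ε 0) (ENNReal.ofReal r) P ≠ ∞ :=
    (h.memLp.mono_exponent (ENNReal.ofReal_le_ofReal hrp)).2.ne
  set E := (eLpNorm (ε 0) (ENNReal.ofReal r) P).toReal with hE
  have hE0 : 0 ≤ E := ENNReal.toReal_nonneg
  set V : ℕ → ℤ → Ω → ℝ := fun j k => linearProcess (fun i => a (i + j)) ε k with hV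
  set g : ℕ → ℝ → ℝ := blockAvg (P.map (ε 0)) a G with hg
  have hgm : ∀ j, Measurable (g j) := measurable_blockAvg hG
  have hb : ∀ j k, eLpNorm (fun ω => g j (V j k ω)) (ENNReal.ofReal r) P ≤ ENNReal.ofReal Q := by
    intro j k
    rw [← h.eLpNorm_tailLaw (hgm j)]
    refine (eLpNorm_avg_le hr.le hG).trans ?_
    rwa [← h.tailLaw_zero_eq hB j]
  rw [← h.eLpNorm_increment_eq hG _ j 0]
  have hae := h.ae_linearProcess_eq (b := fun i => a (i + j)) (sum_shift_abs_rpow_le hB j) 0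
  have hm1 : Measurable fun ω => g j (V j 0 ω) := (hgm j).comp (h.measurable_linearProcess_at _ _)
  have hm2 : Measurable fun ω => g (j + 1) (V (j + 1) (0 - 1) ω) :=
    (hgm (j + 1)).comp (h.measurable_linearProcess_at _ _)
  calc _ = eLpNorm (fun ω => (g j (V j 0 ω) - g (j + 1) (V (j + 1) (0 - 1) ω)) -
        D * a j * ε 0 ω) (ENNReal.ofReal r) P := by
        refine eLpNorm_congr_ae ?_
        filter_upwards [hae] with ω hω
        have e : (fun i => a (i + 1 + j)) = fun i => a (i + (j + 1)) := by
          ext i; congr 1; ring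
        simp only [e, zero_add] at hω
        simp only [increment, hV, hω, hg]
        ring
    _ ≤ eLpNorm (fun ω => g j (V j 0 ω) - g (j + 1) (V (j + 1) (0 - 1) ω)) (ENNReal.ofReal r) P +
        eLpNorm (fun ω => D * a j * ε 0 ω) (ENNReal.ofReal r) P :=
        eLpNorm_sub_le (f := fun ω => g j (V j 0 ω) - g (j + 1) (V (j + 1) (0 - 1) ω))
          (g := fun ω => D * a j * ε 0 ω) (hm1.sub hm2).aestronglyMeasurable
          ((h.measurable 0).const_mul _).aestronglyMeasurable hrr
    _ ≤ (ENNReal.ofReal Q + ENNReal.ofReal Q) + ENNReal.ofReal (Q * c₀) * ENNReal.ofReal E := by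
        refine add_le_add ((eLpNorm_sub_le (f := fun ω => g j (V j 0 ω))
          (g := fun ω => g (j + 1) (V (j + 1) (0 - 1) ω)) hm1.aestronglyMeasurable
          hm2.aestronglyMeasurable hrr).trans (add_le_add (hb _ _) (hb _ _))) ?_
        rw [hE, ENNReal.ofReal_toReal hε]
        refine (eLpNorm_const_smul (D * a j) (ε 0) (ENNReal.ofReal r) P).le.trans ?_
        refine mul_le_mul_left ?_ _
        rw [← ofReal_norm, Real.norm_eq_abs, abs_mul]
        exact ENNReal.ofReal_le_ofReal (mul_le_mul hD (haj j) (abs_nonneg _) hQ0)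
    _ = _ := by
        rw [← ENNReal.ofReal_mul (by positivity), ← ENNReal.ofReal_add hQ0 hQ0,
          ← ENNReal.ofReal_add (by positivity) (by positivity)]
        congr 1; ring

/-- The contribution of the remote past is negligible. -/
lemma exists_eLpNorm_remainder_le (h : CenteredInnovations P ε p) (hr : 1 < r) (hγ : 0 ≤ γ)
    (hγ1 : γ ≤ 1) (hp : p = r * (1 + γ))
    (hc : ∀ j : ℕ, |a j| ≤ c₀ * ((j : ℝ) + 1) ^ (-κ)) (hpκ : 1 < p * κ) :
    ∃ R, 0 ≤ R ∧ ∀ (j : ℕ) (k : ℤ) (N D : ℝ) (g : ℝ → ℝ), SmoothGrowth γ N g →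
      eLpNorm (fun ω => g (linearProcess (fun i => a (i + j)) ε k ω) -
          (∫ z, g z ∂(tailLaw P ε a j)) - D * linearProcess (fun i => a (i + j)) ε k ω)
        (ENNReal.ofReal r) P ≤
      ENNReal.ofReal ((2 * N + |D|) * R * ((j : ℝ) + 1) ^ (1 / p - κ)) := by
  obtain ⟨R, hR0, hR⟩ := h.exists_eLpNorm_tailLaw_le hr hγ hγ1 hp hc hpκ
  have hr0 : 0 < r := by linarith
  have hrr : (1 : ℝ≥0∞) ≤ ENNReal.ofReal r := by simpa using hr.le
  obtain ⟨B, hB⟩ := exists_sum_abs_rpow_le (by linarith [h.one_lt]) hc hpκ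
  refine ⟨R, hR0, fun j k N D g hg => ?_⟩
  have := h.isProbabilityMeasure_tailLaw (a := a) j
  obtain ⟨hz, hw, hl⟩ := hR j
  have hN := hg.nonneg
  have hgm : Measurable g := hg.differentiable.continuous.measurable
  set x : ℝ := ((j : ℝ) + 1) ^ (1 / p - κ) with hx
  have hx0 : 0 ≤ x := by positivity
  have hml := measurable_abs_mul_polyWeight γ
  have hli := h.integrable_tailLaw_of_eLpNorm_le hr hml hl
  have hL := h.integral_tailLaw_le_of_eLpNorm_le hr hml
    (fun z => mul_nonneg (abs_nonneg _) (polyWeight_pos _ _).le) (by positivity) hl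
  have hgi : Integrable g (tailLaw P ε a j) := by
    simpa using integrable_comp_add hγ hgm hg.bound (h.integrable_polyWeight_tailLaw hγ1 hB j) 0
  set m := ∫ z, g z ∂(tailLaw P ε a j) with hm
  -- The mean and the random value are both compared with g(0); each deviation is controlled by the
  -- size of the tail.
  have hm0 : |m - g 0| ≤ N * (R * x) := by
    have h1 : |∫ w, (g w - g 0) ∂(tailLaw P ε a j)| ≤
        N * ∫ w, |w| * polyWeight γ w ∂(tailLaw P ε a j) := by
      calc _ ≤ ∫ w, N * (|w| * polyWeight γ w) ∂(tailLaw P ε a j) := by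
            rw [← Real.norm_eq_abs]
            exact norm_integral_le_of_norm_le (hli.const_mul _) (ae_of_all _ (hg.abs_sub_le hγ))
        _ = _ := integral_const_mul _ _
    rw [integral_sub hgi (integrable_const _)] at h1
    simp only [integral_const, probReal_univ, one_smul] at h1
    exact h1.trans (mul_le_mul_of_nonneg_left hL hN)
  have hf : Measurable fun z => g z - m - D * z := (hgm.sub_const m).sub (measurable_const_mul D)
  rw [← h.eLpNorm_tailLaw hf _ j k]
  have ec : ∀ (c : ℝ), 0 ≤ c → ∀ f : ℝ → ℝ, eLpNorm (fun q => c * f q)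
      (ENNReal.ofReal r) (tailLaw P ε a j) = ENNReal.ofReal c *
      eLpNorm f (ENNReal.ofReal r) (tailLaw P ε a j) := by
    intro c hc f
    rw [← Real.enorm_eq_ofReal hc]
    exact eLpNorm_const_smul c f _ _
  calc _ ≤ eLpNorm (fun z => N * (|z| * polyWeight γ z) + (N * (R * x) + |D| * |z|))
          (ENNReal.ofReal r) (tailLaw P ε a j) := by
        refine eLpNorm_mono_real fun z => ?_
        rw [Real.norm_eq_abs]
        have h1 := hg.abs_sub_le hγ z
        have e : g z - m - D * z = (g z - g 0) - (m - g 0) - D * z := by ring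
        rw [e]
        have h2 := abs_sub ((g z - g 0) - (m - g 0)) (D * z)
        have h3 := abs_sub (g z - g 0) (m - g 0)
        rw [abs_mul] at h2
        linarith
    _ ≤ eLpNorm (fun z => N * (|z| * polyWeight γ z)) (ENNReal.ofReal r) (tailLaw P ε a j) +
        (eLpNorm (fun _ => N * (R * x)) (ENNReal.ofReal r) (tailLaw P ε a j) +
          eLpNorm (fun z => |D| * |z|) (ENNReal.ofReal r) (tailLaw P ε a j)) := by
        have m2 : Measurable fun z : ℝ => |D| * |z| := by fun_prop
        refine (eLpNorm_fun_add_le (f := fun z => N * (|z| * polyWeight γ z))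
          (g := fun z => N * (R * x) + |D| * |z|) (hml.const_mul N).aestronglyMeasurable
          (m2.const_add _).aestronglyMeasurable hrr).trans (add_le_add le_rfl ?_)
        exact eLpNorm_fun_add_le (f := fun _ => N * (R * x)) (g := fun z => |D| * |z|)
          aestronglyMeasurable_const m2.aestronglyMeasurable hrr
    _ ≤ ENNReal.ofReal N * ENNReal.ofReal (R * x) +
        (ENNReal.ofReal (N * (R * x)) + ENNReal.ofReal |D| * ENNReal.ofReal (R * x)) := by
        rw [ec N hN, ec |D| (abs_nonneg D)]
        refine add_le_add (mul_le_mul_right hl _) (add_le_add ?_ (mul_le_mul_right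
          ((eLpNorm_norm (fun z : ℝ => z)).le.trans hz) _))
        rw [eLpNorm_const _ (by simpa using hr0) (IsProbabilityMeasure.ne_zero _)]
        simp only [measure_univ, ENNReal.one_rpow, mul_one]
        rw [Real.enorm_eq_ofReal (by positivity)]
    _ = _ := by
        rw [← ENNReal.ofReal_mul hN, ← ENNReal.ofReal_mul (abs_nonneg D),
          ← ENNReal.ofReal_add (by positivity) (by positivity),
          ← ENNReal.ofReal_add (by positivity) (by positivity)]
        congr 1; ring

/-- The bound for the linearization error of the partial sums, uniform in the function `G`. -/
lemma exists_eLpNorm_sum_sub_le (h : CenteredInnovations P ε p) (hr : 1 < r) (hγ : 0 ≤ γ)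
    (hγ1 : γ ≤ 1) (hp : p = r * (1 + γ))
    (hc : ∀ j : ℕ, |a j| ≤ c₀ * ((j : ℝ) + 1) ^ (-κ)) (hκ : 0 < κ) (hrκ : 1 < r * κ)
    (hτ : 1 / p ≤ κ * (1 - γ)) (hκγ : κ * (1 + γ) < 1)
    (hs : IsSmoothing γ M (blockLaw (P.map (ε 0)) a J)) :
    ∃ C, 0 < C ∧ ∀ (G : ℝ → ℝ) (A Q : ℝ) (n : ℕ), Measurable G →
      (∀ x, |G x| ≤ A * polyWeight γ x) → 0 ≤ Q →
      eLpNorm G (ENNReal.ofReal r) (tailLaw P ε a 0) ≤ ENNReal.ofReal Q →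
      |deriv (avg (tailLaw P ε a 0) G) 0| ≤ Q → 1 ≤ n →
      eLpNorm (fun ω => ∑ s ∈ Finset.range n,
          (G (linearProcess a ε ((s : ℤ) + 1) ω) - (∫ z, G z ∂(tailLaw P ε a 0)) -
            deriv (avg (tailLaw P ε a 0) G) 0 * linearProcess a ε ((s : ℤ) + 1) ω))
        (ENNReal.ofReal r) P ≤
      ENNReal.ofReal (C * (Q * (n : ℝ) ^ (1 / r) +
        A * (n : ℝ) ^ (1 + 1 / r - κ * (1 + γ)))) := by
  have := h.isProbabilityMeasure_law
  have hr0 : 0 < r := by linarith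
  have hrp : r ≤ p := by rw [hp]; nlinarith
  have hp0 : 0 < p := by linarith
  have hrr : (1 : ℝ≥0∞) ≤ ENNReal.ofReal r := by simpa using hr.le
  have hpκ : 1 < p * κ := hrκ.trans_le (mul_le_mul_of_nonneg_right hrp hκ.le)
  have hτ0 : 1 / p - κ < 0 := by
    rw [sub_neg, div_lt_iff₀ hp0]; linarith
  have hc0 : 0 ≤ c₀ := by simpa using (abs_nonneg _).trans (hc 0)
  have haj : ∀ j, |a j| ≤ c₀ := fun j => (hc j).trans (mul_le_of_le_one_right hc0
    (Real.rpow_le_one_of_one_le_of_nonpos (by linarith [(Nat.cast_nonneg j : (0 : ℝ) ≤ j)])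
      (by linarith)))
  have hr2 : r ≤ 2 := hrp.trans h.le_two
  obtain ⟨B, hB⟩ := exists_sum_abs_rpow_le hp0 hc hpκ
  obtain ⟨M', hM'0, hM'⟩ := h.exists_smoothGrowth_blockAvg hγ hγ1 hB hs
  obtain ⟨K, hK0, hK⟩ := h.exists_eLpNorm_increment_le hr hγ hγ1 hp hc hpκ hτ
  obtain ⟨R, hR0, hR⟩ := h.exists_eLpNorm_remainder_le hr hγ hγ1 hp hc hpκ
  obtain ⟨C, hC0, hC⟩ := exists_window_bound (b := κ * (1 + γ)) (by positivity) hκγ hr hr2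
    (by nlinarith [mul_nonneg (mul_nonneg hr0.le hκ.le) hγ]) J
  set E := (eLpNorm (ε 0) (ENNReal.ofReal r) P).toReal with hE
  have hE0 : 0 ≤ E := ENNReal.toReal_nonneg
  have hcE : 0 ≤ c₀ * E := by positivity
  have hMK : 0 ≤ M' * K := by positivity
  refine ⟨C * (2 + c₀ * E + M' * K), by positivity, fun G A Q n hG hA hQ0 hQ hD hn => ?_⟩
  have hA0 := nonneg_of_growth hA
  have hn0 : (0 : ℝ) < n := by exact_mod_cast hn
  set D := deriv (avg (tailLaw P ε a 0) G) 0 with hDdef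
  set m := ∫ z, G z ∂(tailLaw P ε a 0) with hm
  have hDj : ∀ j, J ≤ j →
      D = ∫ z, deriv (blockAvg (P.map (ε 0)) a G j) z ∂(tailLaw P ε a j) := fun j hj =>
    (h.hasDerivAt_avg_tailLaw_zero hγ hγ1 hB hG hA (hM' G A hG hA j hj)).deriv
  -- The crude bound is used below the smoothing lag J and the linearized one from J on; the second
  -- summand is kept for all lags only to give the form needed by `exists_window_bound`.
  set η : ℕ → ℝ := fun j => (if j < J then (2 + c₀ * E) * Q else 0) +
    A * (M' * K) * ((j : ℝ) + 1) ^ (-(κ * (1 + γ))) with hη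
  have hη0 : ∀ j, 0 ≤ η j := fun j => by
    simp only [hη]
    split_ifs <;> positivity
  have hinc : ∀ j, eLpNorm (increment (P.map (ε 0)) a G D j) (ENNReal.ofReal r)
      ((P.map (ε 0)).prod (tailLaw P ε a (j + 1))) ≤ ENNReal.ofReal (η j) := by
    intro j
    rcases lt_or_ge j J with hj | hj
    · refine (h.eLpNorm_increment_le hr hrp hB hG hQ0 hQ hD haj j).trans
        (ENNReal.ofReal_le_ofReal ?_)
      simp only [hη, hj, if_true, ← hE]
      have : 0 ≤ A * (M' * K) * ((j : ℝ) + 1) ^ (-(κ * (1 + γ))) := by positivity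
      linarith
    · have := hK j _ _ (hM' G A hG hA j hj)
      rw [← hDj j hj, ← blockAvg_succ hγ hG hA (h.integrable_polyWeight_law hγ1) j] at this
      refine this.trans (ENNReal.ofReal_le_ofReal ?_)
      simp only [hη, not_lt.2 hj, if_false, zero_add]
      exact le_of_eq (by ring)
  set V : ℕ → ℤ → Ω → ℝ := fun j k => linearProcess (fun i => a (i + j)) ε k with hV
  set bound := C * (2 + c₀ * E + M' * K) * (Q * (n : ℝ) ^ (1 / r) +
        A * (n : ℝ) ^ (1 + 1 / r - κ * (1 + γ))) with hbound
  have hbound0 : 0 ≤ bound := by positivity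
  set R' := (2 * (A * M') + |D|) * R with hR'
  have hR'0 : 0 ≤ R' := by positivity
  -- The expansion is cut off at a finite past and N then tends to infinity. N ≥ J makes the
  -- remaining averages smooth, N ≥ 1 keeps the negative power of N meaningful.
  have key : ∀ N : ℕ, max J 1 ≤ N → eLpNorm (fun ω => ∑ s ∈ Finset.range n,
      (G (linearProcess a ε ((s : ℤ) + 1) ω) - m - D * linearProcess a ε ((s : ℤ) + 1) ω))
      (ENNReal.ofReal r) P ≤
      ENNReal.ofReal (bound + n * (R' * (N : ℝ) ^ (1 / p - κ))) := by
    intro N hN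
    -- The number of lags depends on s so that all expansions stop at the same innovation time 1 -
    -- N; the remainders are functions of the process at time -N.
    set Mart : Ω → ℝ := fun ω => ∑ s ∈ Finset.range n, ∑ j ∈ Finset.range (s + N + 1),
      increment (P.map (ε 0)) a G D j (ε ((s : ℤ) + 1 - j) ω,
        linearProcess (fun i => a (i + (j + 1))) ε ((s : ℤ) + 1 - j - 1) ω) with hMart
    set Rem : ℕ → Ω → ℝ := fun s ω =>
      blockAvg (P.map (ε 0)) a G (s + N + 1) (V (s + N + 1) ((s : ℤ) + 1 - (s + N + 1 : ℕ)) ω) - m -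
        D * V (s + N + 1) ((s : ℤ) + 1 - (s + N + 1 : ℕ)) ω with hRem
    have hMm : Measurable Mart := Finset.measurable_sum _ fun s _ =>
      Finset.measurable_sum _ fun j _ => (measurable_increment hG j).comp
        ((h.measurable _).prodMk (h.measurable_linearProcess_at _ _))
    have hRm : ∀ s, Measurable (Rem s) := fun s =>
      (((measurable_blockAvg hG _).comp (h.measurable_linearProcess_at _ _)).sub_const m).sub
        ((h.measurable_linearProcess_at _ _).const_mul D)
    have hRb : ∀ s ∈ Finset.range n, eLpNorm (Rem s) (ENNReal.ofReal r) P ≤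
        ENNReal.ofReal (R' * (N : ℝ) ^ (1 / p - κ)) := by
      intro s _
      have h1 := hR (s + N + 1) ((s : ℤ) + 1 - (s + N + 1 : ℕ)) _ D _
        (hM' G A hG hA (s + N + 1) (by omega))
      rw [← h.integral_tailLaw_zero hγ hγ1 hB hG hA] at h1
      refine h1.trans (ENNReal.ofReal_le_ofReal (mul_le_mul_of_nonneg_left ?_ hR'0))
      refine Real.rpow_le_rpow_of_nonpos (by exact_mod_cast (le_of_max_le_right hN)) ?_ hτ0.le
      push_cast
      linarith [(Nat.cast_nonneg s : (0 : ℝ) ≤ s)]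
    have hae : ∀ᵐ ω ∂P, ∀ s : ℕ, G (linearProcess a ε ((s : ℤ) + 1) ω) -
        D * linearProcess a ε ((s : ℤ) + 1) ω = _ := ae_all_iff.2 fun s =>
      h.ae_eq_sum_increment hB G D ((s : ℤ) + 1) (s + N + 1)
    calc _ = eLpNorm (fun ω => Mart ω + ∑ s ∈ Finset.range n, Rem s ω) (ENNReal.ofReal r) P := by
          refine eLpNorm_congr_ae ?_
          filter_upwards [hae] with ω hω
          simp only [hMart, hRem, ← Finset.sum_add_distrib]
          refine Finset.sum_congr rfl fun s _ => ?_
          have := hω s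
          simp only [hV]
          linarith
      _ ≤ eLpNorm Mart (ENNReal.ofReal r) P +
          eLpNorm (fun ω => ∑ s ∈ Finset.range n, Rem s ω) (ENNReal.ofReal r) P :=
          eLpNorm_fun_add_le hMm.aestronglyMeasurable
            (Finset.measurable_sum _ fun s _ => hRm s).aestronglyMeasurable hrr
      _ ≤ ENNReal.ofReal bound + ENNReal.ofReal (n * (R' * (N : ℝ) ^ (1 / p - κ))) := by
          refine add_le_add ?_ ?_
          · refine (h.eLpNorm_sum_increment_le hr hr2 hγ hγ1 hG hA hη0 hinc n N).trans
              (ENNReal.ofReal_le_ofReal ?_)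
            refine (hC ((2 + c₀ * E) * Q) (A * (M' * K)) n N (by positivity) (by positivity)
              hn).trans ?_
            have p1 : 0 ≤ Q * (n : ℝ) ^ (1 / r) := by positivity
            have p2 : 0 ≤ A * (n : ℝ) ^ (1 + 1 / r - κ * (1 + γ)) := by positivity
            rw [hbound, mul_assoc C]
            refine mul_le_mul_of_nonneg_left ?_ hC0.le
            nlinarith
          · have e : (fun ω => ∑ s ∈ Finset.range n, Rem s ω) = ∑ s ∈ Finset.range n, Rem s := by
              ext ω; simp
            rw [e]
            refine (eLpNorm_sum_le (fun s _ => (hRm s).aestronglyMeasurable) hrr).trans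
              ((Finset.sum_le_sum hRb).trans ?_)
            rw [Finset.sum_const, Finset.card_range, nsmul_eq_mul,
              ENNReal.ofReal_mul hn0.le, ENNReal.ofReal_natCast]
      _ = _ := by rw [← ENNReal.ofReal_add hbound0 (by positivity)]
  have hlim : Tendsto (fun N : ℕ => ENNReal.ofReal (bound + n * (R' * (N : ℝ) ^ (1 / p - κ))))
      atTop (𝓝 (ENNReal.ofReal bound)) := by
    refine ENNReal.tendsto_ofReal ?_
    have h1 : Tendsto (fun N : ℕ => (N : ℝ) ^ (1 / p - κ)) atTop (𝓝 0) := by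
      have := (tendsto_rpow_neg_atTop (y := κ - 1 / p) (by linarith)).comp
        tendsto_natCast_atTop_atTop
      simpa [Function.comp_def] using this
    have := ((h1.const_mul R').const_mul (n : ℝ)).const_add bound
    simpa using this
  exact ge_of_tendsto hlim (eventually_atTop.2 ⟨max J 1, key⟩)

end CenteredInnovations

/-! ### Consequences of the assumptions on moments, coefficients and thresholds. -/

section TailExponent

variable {μ : Measure ℝ}

lemma tailExponent_le_two (μ : Measure ℝ) : tailExponent μ ≤ 2 :=
  ENNReal.toReal_le_of_le_ofReal (by norm_num) (by simp)

lemma ofReal_tailExponent (μ : Measure ℝ) :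
    ENNReal.ofReal (tailExponent μ) = min 2 (momentIndex μ) :=
  ENNReal.ofReal_toReal (ne_top_of_le_ne_top ENNReal.ofNat_ne_top (min_le_left _ _))

lemma memLp_of_lt_tailExponent [IsFiniteMeasure μ] {p : ℝ} (hp : 0 < p)
    (hpα : p < tailExponent μ) :
    MemLp (fun x : ℝ => x) (ENNReal.ofReal p) μ := by
  have h1 : ENNReal.ofReal p < momentIndex μ := by
    have := (ENNReal.ofReal_lt_ofReal_iff (hp.trans hpα)).2 hpα
    rw [ofReal_tailExponent] at this
    exact this.trans_le (min_le_right _ _)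
  obtain ⟨q, ⟨-, -, hq⟩, hpq⟩ := lt_sSup_iff.1 h1
  exact hq.mono_exponent hpq.le

lemma integral_id_eq_zero_of_symmetric (h : μ.map (fun x => -x) = μ) : ∫ x, x ∂μ = 0 := by
  have h1 : ∫ x, x ∂μ = -∫ x, x ∂μ := by
    conv_lhs => rw [← h]
    rw [integral_map (by fun_prop) measurable_id'.aestronglyMeasurable, integral_neg]
  linarith

end TailExponent

namespace LongMemory

variable {μ : Measure ℝ} {a : ℕ → ℝ} {d : ℝ}

lemma one_lt_tailExponent (h : LongMemory μ a d) : 1 < tailExponent μ := by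
  have h1 : (1 : ℝ≥0∞) < ENNReal.ofReal (tailExponent μ) := by
    rw [ofReal_tailExponent]
    exact lt_min (by norm_num) h.one_lt_momentIndex
  simpa using h1

lemma d_lt_one (h : LongMemory μ a d) : d < 1 := by
  have h1 := h.one_lt_tailExponent
  have h2 := h.d_lt
  have : 0 < 1 / tailExponent μ := by positivity
  linarith

/-- A rearrangement of d < 1 - 1/α. It leaves room for p < α with p(1 - d) > 1, that is, with ε in
L^p and ∑ |a_j|^p finite. -/
lemma one_div_lt_tailExponent (h : LongMemory μ a d) : 1 / (1 - d) < tailExponent μ := by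
  have h1 := h.one_lt_tailExponent
  have h2 := h.d_lt
  have h3 := h.d_lt_one
  rw [div_lt_iff₀ (by linarith)]
  have h4 : 1 / tailExponent μ < 1 - d := by linarith
  rw [div_lt_iff₀ (by linarith)] at h4
  linarith

lemma one_lt_one_div (h : LongMemory μ a d) : 1 < 1 / (1 - d) := by
  rw [lt_div_iff₀ (by linarith [h.d_lt_one])]
  linarith [h.d_pos]

lemma eventually_ne_zero (h : LongMemory μ a d) : ∀ᶠ i in atTop, a i ≠ 0 := by
  obtain ⟨c, hc0, hc⟩ := h.coeff
  filter_upwards [hc.eventually_ne hc0] with i hi h0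
  exact hi (by rw [h0, mul_zero])

lemma exists_abs_le (h : LongMemory μ a d) :
    ∃ c₀, ∀ j : ℕ, |a j| ≤ c₀ * ((j : ℝ) + 1) ^ (-(1 - d)) := by
  obtain ⟨c, -, hc⟩ := h.coeff
  obtain ⟨K, hK⟩ := hc.abs.bddAbove_range
  have hd := h.d_lt_one
  have hd0 := h.d_pos
  have hK' : ∀ n : ℕ, (n : ℝ) ^ (1 - d) * |a n| ≤ K := fun n => by
    have := hK (Set.mem_range_self n)
    rwa [abs_mul, abs_of_nonneg (by positivity : (0 : ℝ) ≤ (n : ℝ) ^ (1 - d))] at this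
  have hK0 : 0 ≤ K := le_trans (by positivity) (hK' 0)
  -- The term |a 0| handles j = 0, and the factor 2 comes from (j + 1)^(1-d) ≤ 2 j^(1-d) for j ≥ 1.
  refine ⟨|a 0| + 2 * K, fun j => ?_⟩
  have hj : (0 : ℝ) < (j : ℝ) + 1 := by positivity
  rw [Real.rpow_neg hj.le, ← div_eq_mul_inv, le_div_iff₀ (by positivity)]
  rcases Nat.eq_zero_or_pos j with h0 | h0
  · subst h0
    simp only [Nat.cast_zero, zero_add, Real.one_rpow, mul_one]
    linarith
  · have hj1 : (1 : ℝ) ≤ j := by exact_mod_cast h0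
    have h1 : ((j : ℝ) + 1) ^ (1 - d) ≤ 2 * (j : ℝ) ^ (1 - d) := by
      calc _ ≤ (2 * (j : ℝ)) ^ (1 - d) :=
            Real.rpow_le_rpow hj.le (by linarith) (by linarith)
        _ = 2 ^ (1 - d) * (j : ℝ) ^ (1 - d) := Real.mul_rpow (by norm_num) (by positivity)
        _ ≤ _ := by
            refine mul_le_mul_of_nonneg_right ?_ (by positivity)
            calc (2 : ℝ) ^ (1 - d) ≤ 2 ^ (1 : ℝ) :=
                  Real.rpow_le_rpow_of_exponent_le (by norm_num) (by linarith)
              _ = 2 := Real.rpow_one 2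
    have h2 := mul_le_mul_of_nonneg_left h1 (abs_nonneg (a j))
    have h3 := hK' j
    linarith [abs_nonneg (a 0)]

end LongMemory

namespace ThresholdGrowth

variable {G : ℕ → ℝ → ℝ} {u : ℕ → ℝ} {γG : ℝ}

lemma exists_growth (h : ThresholdGrowth G u γG) : ∃ C, 0 ≤ C ∧ ∀ n, 1 ≤ n → ∀ x,
    |G n x| ≤ C * polyWeight γG x ∧ (x ≤ u n → G n x = 0) := by
  obtain ⟨C, hC⟩ := h.bound
  refine ⟨|C|, abs_nonneg C, fun n hn x => ⟨?_, fun hx => ?_⟩⟩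
  · refine (hC n hn x).trans (mul_le_mul (le_abs_self C) ?_ ?_ (abs_nonneg C))
    · refine mul_le_of_le_one_right (by positivity) ?_
      exact Set.indicator_le_self' (fun _ _ => zero_le_one) x
    · exact mul_nonneg (by positivity) (Set.indicator_nonneg (fun _ _ => zero_le_one) x)
  · have := hC n hn x
    rw [Set.indicator_of_notMem (by simpa using hx), mul_zero, mul_zero] at this
    exact abs_nonpos_iff.1 this

/-- A smaller growth constant for a larger growth exponent. -/
lemma exists_growth_rpow (h : ThresholdGrowth G u γG) : ∃ C, 0 ≤ C ∧ ∀ γ, γG ≤ γ →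
    ∀ n, 1 ≤ n → 0 < u n → ∀ x, |G n x| ≤ C * u n ^ (γG - γ) * polyWeight γ x := by
  obtain ⟨C, hC0, hC⟩ := h.exists_growth
  refine ⟨C, hC0, fun γ hγ n hn hu x => ?_⟩
  obtain ⟨h1, h2⟩ := hC n hn x
  rcases le_or_gt x (u n) with hx | hx
  · rw [h2 hx, abs_zero]
    exact mul_nonneg (by positivity) (polyWeight_pos _ _).le
  · refine h1.trans ?_
    rw [mul_assoc]
    refine mul_le_mul_of_nonneg_left ?_ hC0
    have hx0 : 0 < 1 + |x| := by positivity
    have hux : u n ≤ 1 + |x| := by linarith [le_abs_self x]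
    unfold polyWeight
    calc (1 + |x|) ^ γG = (1 + |x|) ^ (γG - γ) * (1 + |x|) ^ γ := by
          rw [← Real.rpow_add hx0]; congr 1; ring
      _ ≤ _ := mul_le_mul_of_nonneg_right
          (Real.rpow_le_rpow_of_nonpos hu hux (by linarith)) (by positivity)

/-- Eventually u_n ≥ 1 and the power is at most 1; the finitely many earlier values are simply added
up. This bounds the right-hand side of the moment estimate by a pure power of n. -/
lemma exists_rpow_threshold_le (h : ThresholdGrowth G u γG) {s : ℝ} (hs : s ≤ 0) :
    ∃ K, 0 ≤ K ∧ ∀ n, u n ^ s ≤ K := by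
  obtain ⟨N, hN⟩ := eventually_atTop.1 (h.tendsto.eventually_ge_atTop 1)
  have h0 : 0 ≤ ∑ i ∈ Finset.range N, |u i ^ s| := Finset.sum_nonneg fun _ _ => abs_nonneg _
  refine ⟨1 + ∑ i ∈ Finset.range N, |u i ^ s|, by positivity, fun n => ?_⟩
  rcases lt_or_ge n N with hn | hn
  · have := Finset.single_le_sum (f := fun i => |u i ^ s|) (fun _ _ => abs_nonneg _)
      (Finset.mem_range.2 hn)
    linarith [le_abs_self (u n ^ s)]
  · linarith [Real.rpow_le_one_of_one_le_of_nonpos (hN n hn) hs]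

end ThresholdGrowth

lemma sum_Icc_one_eq_sum_range {E : Type*} [AddCommMonoid E] (f : ℕ → E) (n : ℕ) :
    ∑ t ∈ Finset.Icc 1 n, f t = ∑ s ∈ Finset.range n, f (s + 1) := by
  induction n with
  | zero => simp
  | succ n ih => rw [Finset.sum_Icc_succ_top (by omega), ih, Finset.sum_range_succ]

/-! ### Assembly of the theorem. -/

section LinearProcess

variable {Ω : Type*} [MeasurableSpace Ω] {P : Measure Ω} [IsProbabilityMeasure P]
  {ε : ℤ → Ω → ℝ} {p : ℝ} {a : ℕ → ℝ}

lemma CenteredInnovations.of_symmetric (hmeas : ∀ t, Measurable (ε t)) (hindep : iIndepFun ε P)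
    (hident : ∀ t, IdentDistrib (ε t) (ε 0) P P)
    (hsymm : (P.map (ε 0)).map (fun x => -x) = P.map (ε 0)) (hp : 1 < p)
    (hpα : p < tailExponent (P.map (ε 0))) : CenteredInnovations P ε p where
  measurable := hmeas
  indep := hindep
  ident := hident
  one_lt := hp
  le_two := hpα.le.trans (tailExponent_le_two _)
  memLp := (memLp_map_measure_iff measurable_id'.aestronglyMeasurable (hmeas 0).aemeasurable).1
    (memLp_of_lt_tailExponent (by linarith) hpα)
  centered := by
    have := integral_id_eq_zero_of_symmetric hsymm
    rwa [integral_map (hmeas 0).aemeasurable measurable_id'.aestronglyMeasurable] at this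

lemma CenteredInnovations.integral_comp_add_eq_avg (h : CenteredInnovations P ε p) {G : ℝ → ℝ}
    (hG : Measurable G) (x : ℝ) :
    ∫ ω, G (linearProcess a ε 0 ω + x) ∂P = avg (tailLaw P ε a 0) G x := by
  have hGx : Measurable fun z => G (x + z) := hG.comp (measurable_const_add x)
  rw [avg, tailLaw, integral_map (h.measurable_linearProcess_at _ _).aemeasurable
    hGx.aestronglyMeasurable]
  simp only [add_zero, add_comm x]

lemma CenteredInnovations.meanShiftDeriv_eq (h : CenteredInnovations P ε p) {G : ℝ → ℝ}
    (hG : Measurable G) :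
    meanShiftDeriv P G (linearProcess a ε 0) = deriv (avg (tailLaw P ε a 0) G) 0 := by
  unfold meanShiftDeriv
  congr 1
  exact funext fun x => h.integral_comp_add_eq_avg hG x

lemma CenteredInnovations.integrable_comp_add_linearProcess_at (h : CenteredInnovations P ε p)
    {G : ℝ → ℝ} {γ A B : ℝ} (hγ : 0 ≤ γ) (hγ1 : γ ≤ 1)
    (hB : ∀ N, ∑ i ∈ Finset.range N, |a i| ^ p ≤ B) (hG : Measurable G)
    (hA : ∀ x, |G x| ≤ A * polyWeight γ x) (x : ℝ) :
    Integrable (fun ω => G (linearProcess a ε 0 ω + x)) P := by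
  have h1 := integrable_comp_add hγ hG hA (h.integrable_polyWeight_tailLaw hγ1 hB 0) x
  have hGx : Measurable fun z => G (x + z) := hG.comp (measurable_const_add x)
  rw [tailLaw, integrable_map_measure hGx.aestronglyMeasurable
    (h.measurable_linearProcess_at _ _).aemeasurable] at h1
  simpa only [Function.comp_def, add_zero, add_comm x] using h1

end LinearProcess

theorem theorem1 {Ω : Type*} [MeasurableSpace Ω] (P : Measure Ω) [IsProbabilityMeasure P]
    (ε : ℤ → Ω → ℝ) (hmeas : ∀ t, Measurable (ε t)) (hindep : iIndepFun ε P)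
    (hident : ∀ t, IdentDistrib (ε t) (ε 0) P P)
    (a : ℕ → ℝ) (d : ℝ) (hmem : LongMemory (P.map (ε 0)) a d)
    (G : ℕ → ℝ → ℝ) (u : ℕ → ℝ) (γG : ℝ) (hG : ThresholdGrowth G u γG)
    (hreg : RegularInnovations (P.map (ε 0))) :
    -- the series defining the linear process converges almost surely
    (∀ t : ℤ, ∀ᵐ ω ∂P,
      Tendsto (fun N : ℕ => ∑ j ∈ Finset.range N, a j * ε (t - (j : ℤ)) ω) atTop
        (𝓝 (linearProcess a ε t ω))) ∧
    -- the expectations and their derivative at zero are well-defined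
    (γG < tailExponent (P.map (ε 0)) - 1 → ∀ n : ℕ, 1 ≤ n →
      (∀ x : ℝ, Integrable (fun ω => G n (linearProcess a ε 0 ω + x)) P) ∧
      DifferentiableAt ℝ (fun x : ℝ => ∫ ω, G n (linearProcess a ε 0 ω + x) ∂P) 0) ∧
    -- the moment bounds
    (∀ γ r : ℝ, γG < γ →
      γ < min (d / (1 - d))
        (min (1 - 1 / (r * (1 - d))) (tailExponent (P.map (ε 0)) / r - 1)) →
      1 / (1 - d) < r → r < tailExponent (P.map (ε 0)) →
      ∃ C : ℝ, 0 < C ∧ ∀ n : ℕ, 1 ≤ n → 0 < u n →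
        eLpNorm (fun ω =>
            ∑ t ∈ Finset.Icc 1 n, (G n (linearProcess a ε (t : ℤ) ω)
                - ∫ ω', G n (linearProcess a ε 0 ω') ∂P)
              - meanShiftDeriv P (G n) (linearProcess a ε 0)
                * ∑ t ∈ Finset.Icc 1 n, linearProcess a ε (t : ℤ) ω)
            (ENNReal.ofReal r) P
          ≤ ENNReal.ofReal C *
            (ENNReal.ofReal (u n ^ (γG - γ) * (n : ℝ) ^ (1 + 1 / r - (1 - d) * (1 + γ)))
              + ENNReal.ofReal ((n : ℝ) ^ (1 / r)) *
                max (eLpNorm (fun ω => G n (linearProcess a ε 0 ω)) (ENNReal.ofReal r) P)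
                  (ENNReal.ofReal |meanShiftDeriv P (G n) (linearProcess a ε 0)|)) ∧
        ENNReal.ofReal (u n ^ (γG - γ) * (n : ℝ) ^ (1 + 1 / r - (1 - d) * (1 + γ)))
            + ENNReal.ofReal ((n : ℝ) ^ (1 / r)) *
              max (eLpNorm (fun ω => G n (linearProcess a ε 0 ω)) (ENNReal.ofReal r) P)
                (ENNReal.ofReal |meanShiftDeriv P (G n) (linearProcess a ε 0)|)
          ≤ ENNReal.ofReal C *
            ENNReal.ofReal ((n : ℝ) ^ (1 + 1 / r - (1 - d) * (1 + γ)))) := by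
  set α := tailExponent (P.map (ε 0)) with hα
  have hα2 : α ≤ 2 := tailExponent_le_two _
  have hd0 := hmem.d_pos
  have hd1 := hmem.d_lt_one
  have hκ : 0 < 1 - d := by linarith
  have hdα := hmem.one_div_lt_tailExponent
  have h1d := hmem.one_lt_one_div
  obtain ⟨c₀, hc⟩ := hmem.exists_abs_le
  have hγG := hG.nonneg
  -- Any such p serves for the convergence of the series and for (a); the moment bound discards it
  -- in favour of p = r(1 + γ).
  obtain ⟨p, hp1, hpα⟩ := exists_between hdα
  have hCI := CenteredInnovations.of_symmetric hmeas hindep hident hreg.symmetric (h1d.trans hp1) hpα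
  have hprob := hCI.isProbabilityMeasure_law
  have hpκ : 1 < p * (1 - d) := (div_lt_iff₀ hκ).1 hp1
  obtain ⟨B, hB⟩ := exists_sum_abs_rpow_le (by linarith) hc hpκ
  have hsmooth : ∀ γ, 0 ≤ γ → γ < α - 1 →
      ∃ J M, IsSmoothing γ M (blockLaw (P.map (ε 0)) a J) := fun γ hγ hγα =>
    hreg.exists_isSmoothing hγ hγα (hCI.integrable_polyWeight_law (by linarith))
      hmem.eventually_ne_zero
  refine ⟨hCI.ae_tendsto_linearProcess_at hB, fun hγα n hn => ?_, fun γ r hγGγ hγmin hr1 hrα => ?_⟩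
  · obtain ⟨C, -, hC⟩ := hG.exists_growth
    have hA := fun x => (hC n hn x).1
    have hGm := hG.measurable n hn
    have hγ1 : γG ≤ 1 := by linarith
    refine ⟨hCI.integrable_comp_add_linearProcess_at hγG hγ1 hB hGm hA, ?_⟩
    obtain ⟨J, M, hs⟩ := hsmooth γG hγG hγα
    rw [funext fun x => hCI.integral_comp_add_eq_avg hGm x]
    exact (hCI.hasDerivAt_avg_tailLaw_zero hγG hγ1 hB hGm hA
      (hs (G n) C hGm hA)).differentiableAt
  · clear hpκ hCI hB hp1 hpα
    clear B p
    -- The three bounds on γ serve different ends. The bound d/(1-d) gives κ(1 + γ) < 1 for the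
    -- window sums. The bound 1 - 1/(rκ) gives γ ≤ 1 and makes the fluctuation of the derivative as
    -- small as the Taylor remainder. The bound α/r - 1 gives the innovations a moment of order p =
    -- r(1 + γ).
    obtain ⟨hγd, hγmin⟩ := lt_min_iff.1 hγmin
    obtain ⟨hγr, hγα⟩ := lt_min_iff.1 hγmin
    have hr : 1 < r := h1d.trans hr1
    have hr0 : 0 < r := by linarith
    have hγ : 0 ≤ γ := by linarith
    have hrκ : 1 < r * (1 - d) := (div_lt_iff₀ hκ).1 hr1
    have hκγ : (1 - d) * (1 + γ) < 1 := by
      rw [lt_div_iff₀ hκ] at hγd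
      linarith
    have hγ1 : γ ≤ 1 := by
      have : 0 < 1 / (r * (1 - d)) := by positivity
      linarith
    obtain ⟨p, hp⟩ : ∃ p, p = r * (1 + γ) := ⟨_, rfl⟩
    have hrp : r ≤ p := by rw [hp]; nlinarith
    have hpα : p < α := by
      have : 1 + γ < α / r := by linarith
      rw [lt_div_iff₀ hr0] at this
      rw [hp]; linarith
    have hγα1 : γ < α - 1 := by
      have : 1 + γ ≤ p := by rw [hp]; nlinarith
      linarith
    have hτ : 1 / p ≤ (1 - d) * (1 - γ) := by
      have h1 : 1 / (r * (1 - d)) < 1 - γ := by linarith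
      rw [div_lt_iff₀ (by positivity)] at h1
      have h2 : 1 / p ≤ 1 / r := one_div_le_one_div_of_le hr0 hrp
      have h3 : 1 / r ≤ (1 - d) * (1 - γ) := by
        rw [div_le_iff₀ hr0]; linarith
      exact h2.trans h3
    have hpκ : 1 < p * (1 - d) := hrκ.trans_le (mul_le_mul_of_nonneg_right hrp hκ.le)
    have hCI := CenteredInnovations.of_symmetric hmeas hindep hident hreg.symmetric (hr.trans_le hrp) hpα
    obtain ⟨B, hB⟩ := exists_sum_abs_rpow_le (by linarith) hc hpκ
    obtain ⟨J, M, hs⟩ := hsmooth γ hγ hγα1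
    obtain ⟨M', hM'0, hM'⟩ := hCI.exists_smoothGrowth_blockAvg hγ hγ1 hB hs
    obtain ⟨C₁, hC₁0, hC₁⟩ := hCI.exists_eLpNorm_sum_sub_le hr hγ hγ1 hp hc hκ hrκ hτ hκγ hs
    obtain ⟨C₂, hC₂0, hC₂⟩ := hG.exists_growth_rpow
    obtain ⟨K, hK0, hK⟩ := hG.exists_rpow_threshold_le (s := γG - γ) (by linarith)
    obtain ⟨R, hR0, hR⟩ := hCI.exists_eLpNorm_tailLaw_le hr hγ hγ1 hp hc hpκ
    have hRw := (hR 0).2.1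
    set W := ∫ z, polyWeight γ z ∂(tailLaw P ε a J) with hW
    have hW0 : 0 ≤ W := integral_nonneg fun z => (polyWeight_pos _ _).le
    -- The first summand serves the linearization bound, the second the growth of its right-hand
    -- side.
    set C := C₁ * (1 + C₂) + (K + C₂ * K * (R + M' * W)) with hCdef
    refine ⟨C, by positivity, fun n hn hu => ?_⟩
    have hn1 : (1 : ℝ) ≤ n := by exact_mod_cast hn
    have hGm := hG.measurable n hn
    have hun : 0 ≤ u n ^ (γG - γ) := by positivity
    set A := C₂ * u n ^ (γG - γ) with hA
    have hA0 : 0 ≤ A := by positivity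
    have hAK : A ≤ C₂ * K := mul_le_mul_of_nonneg_left (hK n) hC₂0
    have hgr : ∀ x, |G n x| ≤ A * polyWeight γ x := hC₂ γ hγGγ.le n hn hu
    rw [hCI.meanShiftDeriv_eq hGm]
    have hnorm : eLpNorm (fun ω => G n (linearProcess a ε 0 ω)) (ENNReal.ofReal r) P =
        eLpNorm (G n) (ENNReal.ofReal r) (tailLaw P ε a 0) :=
      (hCI.eLpNorm_tailLaw hGm _ 0 0).symm
    have hmean : ∫ ω, G n (linearProcess a ε 0 ω) ∂P = ∫ z, G n z ∂(tailLaw P ε a 0) := by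
      have := hCI.integral_comp_add_eq_avg (a := a) hGm 0
      simpa [avg] using this
    rw [hnorm, hmean]
    set D := deriv (avg (tailLaw P ε a 0) (G n)) 0 with hD
    have hGle : eLpNorm (G n) (ENNReal.ofReal r) (tailLaw P ε a 0) ≤
        ENNReal.ofReal (C₂ * K * R) := by
      refine (eLpNorm_le_mul_eLpNorm_of_ae_le_mul (g := polyWeight γ) (c := A)
        (ae_of_all _ fun x => ?_) _).trans ?_
      · rw [Real.norm_eq_abs, Real.norm_eq_abs, abs_of_pos (polyWeight_pos _ _)]
        exact hgr x
      · rw [ENNReal.ofReal_mul (p := C₂ * K) (by positivity)]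
        exact mul_le_mul' (ENNReal.ofReal_le_ofReal hAK) hRw
    -- D is the derivative at 0 of the tail average of the smooth function G_J, so it is controlled
    -- by the growth constant of G n.
    have hDle : |D| ≤ C₂ * K * (M' * W) := by
      have h1 := (hM' (G n) A hGm hgr J le_rfl).averaged hγ
        (hCI.integrable_polyWeight_tailLaw hγ1 hB J) le_rfl
      rw [← hCI.avg_tailLaw_zero hγ hγ1 hB hGm hgr J] at h1
      have h2 := h1.deriv_bound 0
      rw [polyWeight_zero, mul_one, mul_assoc] at h2
      exact h2.trans (mul_le_mul_of_nonneg_right hAK (by positivity))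
    set m := max (eLpNorm (G n) (ENNReal.ofReal r) (tailLaw P ε a 0)) (ENNReal.ofReal |D|) with hm
    have hmle : m ≤ ENNReal.ofReal (C₂ * K * (R + M' * W)) := by
      rw [mul_add, hm]
      refine max_le (hGle.trans (ENNReal.ofReal_le_ofReal ?_)) (ENNReal.ofReal_le_ofReal ?_)
      · linarith [show 0 ≤ C₂ * K * (M' * W) by positivity]
      · linarith [show 0 ≤ C₂ * K * R by positivity]
    have hmtop : m ≠ ∞ := ne_top_of_le_ne_top ENNReal.ofReal_ne_top hmle
    set e := 1 + 1 / r - (1 - d) * (1 + γ) with he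
    -- Since κ(1 + γ) < 1, the exponent e exceeds 1/r, so the n^(1/r) term is absorbed by the main
    -- one.
    have hne : (n : ℝ) ^ (1 / r) ≤ (n : ℝ) ^ e :=
      Real.rpow_le_rpow_of_exponent_le hn1 (by rw [he]; linarith)
    constructor
    · obtain ⟨q, hq0, hmq⟩ : ∃ q, 0 ≤ q ∧ m = ENNReal.ofReal q :=
        ⟨m.toReal, ENNReal.toReal_nonneg, (ENNReal.ofReal_toReal hmtop).symm⟩
      have h1 := hC₁ (G n) A q n hGm hgr hq0 (hmq ▸ le_max_left _ _)
        ((ENNReal.ofReal_le_ofReal_iff hq0).1 (hmq ▸ le_max_right _ _)) hn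
      have h2 : (fun ω => ∑ t ∈ Finset.Icc 1 n, (G n (linearProcess a ε (t : ℤ) ω) -
            ∫ z, G n z ∂(tailLaw P ε a 0)) -
            D * ∑ t ∈ Finset.Icc 1 n, linearProcess a ε (t : ℤ) ω) =
          fun ω => ∑ s ∈ Finset.range n, (G n (linearProcess a ε ((s : ℤ) + 1) ω) -
            (∫ z, G n z ∂(tailLaw P ε a 0)) - D * linearProcess a ε ((s : ℤ) + 1) ω) := by
        ext ω
        rw [sum_Icc_one_eq_sum_range, sum_Icc_one_eq_sum_range, Finset.mul_sum,
          ← Finset.sum_sub_distrib]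
        push_cast
        rfl
      rw [h2]
      refine h1.trans ?_
      rw [hmq, ← ENNReal.ofReal_mul (by positivity), ← ENNReal.ofReal_add (by positivity)
        (by positivity), ← ENNReal.ofReal_mul (by positivity)]
      refine ENNReal.ofReal_le_ofReal ?_
      have q1 : 0 ≤ u n ^ (γG - γ) * (n : ℝ) ^ e := by positivity
      have q2 : 0 ≤ (n : ℝ) ^ (1 / r) * q := by positivity
      have q3 : 0 ≤ K + C₂ * K * (R + M' * W) := by positivity
      have q4 : 0 ≤ C₁ * C₂ := by positivity
      calc _ = C₁ * C₂ * (u n ^ (γG - γ) * (n : ℝ) ^ e) +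
            C₁ * ((n : ℝ) ^ (1 / r) * q) := by rw [hA]; ring
        _ ≤ C * (u n ^ (γG - γ) * (n : ℝ) ^ e) + C * ((n : ℝ) ^ (1 / r) * q) :=
            add_le_add (mul_le_mul_of_nonneg_right (by rw [hCdef]; linarith) q1)
              (mul_le_mul_of_nonneg_right (by rw [hCdef]; linarith) q2)
        _ = _ := by ring
    · calc _ ≤ ENNReal.ofReal (K * (n : ℝ) ^ e) + ENNReal.ofReal ((n : ℝ) ^ e) *
            ENNReal.ofReal (C₂ * K * (R + M' * W)) :=
            add_le_add (ENNReal.ofReal_le_ofReal (mul_le_mul_of_nonneg_right (hK n)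
              (by positivity))) (mul_le_mul' (ENNReal.ofReal_le_ofReal hne) hmle)
        _ = ENNReal.ofReal ((K + C₂ * K * (R + M' * W)) * (n : ℝ) ^ e) := by
            rw [← ENNReal.ofReal_mul (by positivity), ← ENNReal.ofReal_add (by positivity)
              (by positivity)]
            congr 1; ring
        _ ≤ _ := by
            rw [← ENNReal.ofReal_mul (by positivity)]
            refine ENNReal.ofReal_le_ofReal (mul_le_mul_of_nonneg_right ?_ (by positivity))
            rw [hCdef]
            linarith [show 0 ≤ C₁ * (1 + C₂) by positivity]
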